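/- **Setting.** Let $L>0$, let $F:\mathbb R^d\to\mathbb R^d$ be $L$-Lipschitz and $G:\mathbb R^d\rightrightarrows\mathbb R^d$ maximally monotone. Let $x^\star$ satisfy $0\in F(x^\star)+G(x^\star)$ and, for some $\rho>0$, the weak Minty variational inequality $\langle u,x-x^\star\rangle\ge-\rho\|u\|^2$ for all $x$ and all $u\in F(x)+G(x)$. A stochastic oracle $\widetilde F$ returns at each queried point $x$, with a fresh independent seed, a sample with $\mathbb E[\widetilde F(x)]=F(x)$ and $\mathbb E\|\widetilde F(x)-F(x)\|^2\le\sigma^2$. Let $\rho<\eta<1/L$, $\alpha=1-\rho/\eta$, $\mu=1-\eta L$, $L_B=1+\eta L$, and let $J_A=(\mathrm{Id}+A)^{-1}$ denote the resolvent of $A$. **Algorithm.** From $x_0\in\mathbb R^d$, for $k=0,1,\dots$ put $$\alpha_k=\frac{\alpha}{\sqrt{k+2}\,\log(k+3)},\qquad N_k=\left\lceil\frac{96\,\mu^{-2}}{\min\{\frac{\alpha_k}{120\alpha(k+1)},\frac1{120}\}}\right\rceil,\qquad M_k=\left\lceil\frac{672\cdot120\,\log_2N_k}{\mu^2}\right\rceil,$$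 and $x_{k+1}=(1-\alpha_k)x_k+\frac{\alpha_k}{M_k}\sum_{m=1}^{M_k}\widetilde J^{(m)}$, where $\widetilde J^{(1)},\dots,\widetilde J^{(M_k)}$ are independent copies of the following estimator: draw $I$ with $\Pr(I=i)=2^{-i}$, $i\ge1$; the estimator is $y^0+2^I(y^I-y^{I-1})$ if $2^I\le N_k$, and $y^0$ otherwise. Here $y^i$ is the result of $2^i$ iterations of stochastic forward-backward-forward (FBF) started at $z_0=x_k$, with seeds independent of $I$ and of the other runs: with $\tau_t=\frac{2}{(t+1)\mu+6L_B}$ and $\widetilde B(z)=z+\eta\widetilde F(z)-x_k$, $$z_{t+1/2}=J_{\tau_t\eta G}(z_t-\tau_t\widetilde B(z_t)),\qquad z_{t+1}=z_{t+1/2}+\tau_t\widetilde B(z_t)-\tau_t\widetilde B(z_{t+1/2}),$$ where the same sample $\widetilde B(z_t)$ is used in both formulas. Thus each FBF iteration makes two oracle calls and one resolvent call (the resolvent of a multiple of $G$). **Theorem.** The resolvents $J_{\eta(F+G)}$ and $J_{cG}$, $c>0$, are single-valued and defined on all of $\mathbb R^d$, and the following hold. 1. (Rate.) For every $K\ge1$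 and $x^{\mathrm{out}}$ uniform among $x_0,\dots,x_{K-1}$ (index independent of the run), $$\mathbb E\|(\mathrm{Id}-J_{\eta(F+G)})(x^{\mathrm{out}})\|^2\le\frac{64\left(\|x_0-x^\star\|^2+\alpha^2\eta^2\sigma^2\right)\log(K+3)}{\alpha^2\sqrt K}.$$ 2. (Cost per iteration.) There is a constant $C$ depending only on $\eta$ and $L$ such that iteration $k$ makes, in expectation, at most $C\log^2(k+2)$ oracle calls and at most $C\log^2(k+2)$ resolvent calls, for every $k\ge0$. 3. (Total complexity.) For every $D$ there are a constant $C'$ and a map $\varepsilon\mapsto K(\varepsilon)\ge1$, depending only on $\eta,L,\rho,\sigma,D$, such that whenever $\|x_0-x^\star\|\le D$: for every $\varepsilon>0$, running $K=K(\varepsilon)$ iterations gives $\mathbb E\|(\mathrm{Id}-J_{\eta(F+G)})(x^{\mathrm{out}})\|\le\varepsilon$ and $\eta^{-1}\mathbb E\|(\mathrm{Id}-J_{\eta(F+G)})(x^{\mathrm{out}})\|\le\varepsilon$; and for $0<\varepsilon\le1$ the expected total numbers of oracle calls and of resolvent calls are each at most $C'\varepsilon^{-4}(1+\log(1/\varepsilon))^4$,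 i.e. $\widetilde O(\varepsilon^{-4})$. -/

import Mathlib

open MeasureTheory ProbabilityTheory
open scoped NNReal RealInnerProductSpace

noncomputable section

namespace StochKM

/-! ### Set-valued operators -/

section Operators

variable {E : Type*} [NormedAddCommGroup E] [InnerProductSpace ℝ E]

/-- The operator `F + G` for single-valued `F` and set-valued `G`. -/
def opAdd (F : E → E) (G : E → Set E) : E → Set E :=
  fun x => {w | ∃ u ∈ G x, w = F x + u}

/-- The operator `c A`. -/
def opSmul (c : ℝ) (A : E → Set E) : E → Set E :=
  fun x => {w | ∃ u ∈ A x, w = c • u}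

/-- Monotonicity of a set-valued operator. -/
def IsMonotoneOp (A : E → Set E) : Prop :=
  ∀ x y : E, ∀ u ∈ A x, ∀ v ∈ A y, 0 ≤ ⟪u - v, x - y⟫

/-- Maximal monotonicity: the graph is not strictly contained in the graph of another monotone
operator. -/
def IsMaximalMonotone (A : E → Set E) : Prop :=
  IsMonotoneOp A ∧ ∀ B : E → Set E, IsMonotoneOp B → (∀ x, A x ⊆ B x) → B = A

/-- The set-valued resolvent `(Id + A)⁻¹`. -/
def resolventValues (A : E → Set E) (x : E) : Set E :=
  {y | ∃ u ∈ A y, x = y + u}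

open Classical in
/-- The resolvent `(Id + A)⁻¹` as a map: an element of `resolventValues A x`. This is used for
operators whose resolvent is everywhere defined and single-valued (the value where the resolvent
set is empty is a placeholder). -/
def resolventMap (A : E → Set E) (x : E) : E :=
  if h : (resolventValues A x).Nonempty then h.some else x

/-- `xs` is a solution of `0 ∈ (F + G)(x)`. -/
def IsSolution (F : E → E) (G : E → Set E) (xs : E) : Prop :=
  (0 : E) ∈ opAdd F G xs

/-- The weak Minty variational inequality with parameter `ρ` holds at `xs`. -/
def WeakMVI (ρ : ℝ) (F : E → E) (G : E → Set E) (xs : E) : Prop :=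
  ∀ x : E, ∀ u ∈ opAdd F G x, -ρ * ‖u‖ ^ 2 ≤ ⟪u, x - xs⟫

end Operators

/-! ### Randomness -/

/-- `Ft x s` is the answer of the stochastic first-order oracle at the point `x` with random seed
`s ∼ ν`: it is unbiased for `F x` and has variance at most `σ ^ 2`. -/
structure IsStochasticOracle {E Ξ : Type*} [NormedAddCommGroup E] [InnerProductSpace ℝ E]
    [MeasurableSpace E] [MeasurableSpace Ξ] (Ft : E → Ξ → E) (ν : Measure Ξ) (F : E → E)
    (σ : ℝ) : Prop where
  measurable : Measurable (Function.uncurry Ft)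
  integrable : ∀ x, Integrable (fun s => Ft x s) ν
  unbiased : ∀ x, ∫ s, Ft x s ∂ν = F x
  integrable_sq : ∀ x, Integrable (fun s => ‖Ft x s - F x‖ ^ 2) ν
  variance_le : ∀ x, ∫ s, ‖Ft x s - F x‖ ^ 2 ∂ν ≤ σ ^ 2

/-- Label of an oracle call: outer iteration `k`, copy `m` of the multilevel estimator, level `i`
(the run of the inner solver that computes `y ^ i`), inner iteration `t`, and whether the call is
made at `z_t` (`half = false`) or at `z_{t + 1/2}` (`half = true`). -/
structure SeedIndex where
  iter : ℕ
  copy : ℕ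
  level : ℕ
  step : ℕ
  half : Bool

/-- All random draws of the algorithm: the seeds `ξ j` are distributed as `ν`, the levels
`I (k, m)` are geometric with parameter `1/2` on `{1, 2, …}`, and all of these random variables are
mutually independent. -/
structure IsSampling {Ξ Ω : Type*} [MeasurableSpace Ξ] [MeasurableSpace Ω] (P : Measure Ω)
    (ν : Measure Ξ) (ξ : SeedIndex → Ω → Ξ) (I : ℕ × ℕ → Ω → ℕ) : Prop where
  measurable_seed : ∀ j, Measurable (ξ j)
  measurable_level : ∀ j, Measurable (I j)
  law_seed : ∀ j, P.map (ξ j) = ν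
  law_level : ∀ j, ∀ i : ℕ, P {ω | I j ω = i + 1} = (1 / 2) ^ (i + 1)
  indep_seed : iIndepFun ξ P
  indep_level : iIndepFun I P
  indep_seed_level : IndepFun (fun ω j => ξ j ω) (fun ω j => I j ω) P

/-- `X` is integrable and `𝔼[X] ≤ c`. -/
def ExpectationLE {Ω : Type*} [MeasurableSpace Ω] (P : Measure Ω) (X : Ω → ℝ) (c : ℝ) : Prop :=
  Integrable X P ∧ ∫ ω, X ω ∂P ≤ c

/-! ### The algorithm, with counters for its oracle calls -/

/-- A point together with the numbers of calls to the stochastic oracle and to the resolvent of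
(a multiple of) `G` that were made to compute it. -/
structure Run (E : Type*) where
  point : E
  oracleCalls : ℕ
  resolventCalls : ℕ

section Algorithm

variable {E Ξ : Type*} [NormedAddCommGroup E] [InnerProductSpace ℝ E]

/-- `T` iterations of the stochastic forward-backward-forward method for `A + B`, started from
`z₀`, where `B = B_in - z₀` and `B_in` is accessed through the oracle `Bin`. The step size is
`τ_t = 2 / ((t + 1) μ + 6 L_B)`. Iteration `t` evaluates the oracle at `z_t` with seed
`seed t false`, the resolvent of `τ_t A` once, and the oracle at `z_{t + 1/2}` with seed
`seed t true`. -/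
def fbf (μ LB : ℝ) (A : E → Set E) (Bin : E → Ξ → E) (z₀ : E) (seed : ℕ → Bool → Ξ) :
    ℕ → Run E
  | 0 => ⟨z₀, 0, 0⟩
  | t + 1 =>
    let r := fbf μ LB A Bin z₀ seed t
    let z := r.point
    let τ : ℝ := 2 / (((t : ℝ) + 1) * μ + 6 * LB)
    let b := Bin z (seed t false) - z₀
    let zh := resolventMap (opSmul τ A) (z - τ • b)
    let bh := Bin zh (seed t true) - z₀
    ⟨zh + τ • b - τ • bh, r.oracleCalls + 2, r.resolventCalls + 1⟩

/-- The multilevel Monte Carlo estimator built on `fbf`: with `y i` the result of `2 ^ i`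
iterations of `fbf` (on its own seeds `seed i`) and with drawn level `I`, it is
`y 0 + 2 ^ I (y I - y (I - 1))` if `2 ^ I ≤ N`, and `y 0` otherwise. -/
def mlmcFbf (μ LB : ℝ) (A : E → Set E) (Bin : E → Ξ → E) (z₀ : E) (N : ℕ) (I : ℕ)
    (seed : ℕ → ℕ → Bool → Ξ) : Run E :=
  let y : ℕ → Run E := fun i => fbf μ LB A Bin z₀ (seed i) (2 ^ i)
  if 2 ^ I ≤ N then
    ⟨(y 0).point + (2 ^ I : ℝ) • ((y I).point - (y (I - 1)).point),
      (y 0).oracleCalls + (y I).oracleCalls + (y (I - 1)).oracleCalls,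
      (y 0).resolventCalls + (y I).resolventCalls + (y (I - 1)).resolventCalls⟩
  else y 0

/-- `α = 1 - ρ / η`. -/
def relax (η ρ : ℝ) : ℝ := 1 - ρ / η

/-- `α_k = α / (√(k + 2) log (k + 3))`. -/
def stepSize (η ρ : ℝ) (k : ℕ) : ℝ :=
  relax η ρ / (√((k : ℝ) + 2) * Real.log ((k : ℝ) + 3))

/-- `N_k = ⌈96 (1 - η L)⁻² / min {α_k / (120 α (k + 1)), 1 / 120}⌉`. -/
def levelCap (L η ρ : ℝ) (k : ℕ) : ℕ :=
  ⌈96 * ((1 - η * L) ^ 2)⁻¹ /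
    min (stepSize η ρ k / (120 * relax η ρ * ((k : ℝ) + 1))) (1 / 120)⌉₊

/-- `M_k = ⌈672 · 120 · log₂ N_k / (1 - η L)²⌉`. -/
def batchSize (L η ρ : ℝ) (k : ℕ) : ℕ :=
  ⌈672 * 120 * Real.logb 2 (levelCap L η ρ k) / (1 - η * L) ^ 2⌉₊

/-- The estimate of `J_{η(F+G)}(x)` used in iteration `k`: the average of `M_k` copies of the
multilevel estimator with `A = η G`, `B_in = Id + η Ft`, `L_B = 1 + η L`, `μ = 1 - η L`. -/
def estimate (L η ρ : ℝ) (G : E → Set E) (Ft : E → Ξ → E) (ξ : SeedIndex → Ξ) (I : ℕ × ℕ → ℕ)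
    (k : ℕ) (x : E) : Run E :=
  let M := batchSize L η ρ k
  let J : ℕ → Run E := fun m =>
    mlmcFbf (1 - η * L) (1 + η * L) (opSmul η G) (fun z s => z + η • Ft z s) x
      (levelCap L η ρ k) (I (k, m)) (fun i t h => ξ ⟨k, m, i, t, h⟩)
  ⟨(M : ℝ)⁻¹ • ∑ m ∈ Finset.range M, (J m).point,
    ∑ m ∈ Finset.range M, (J m).oracleCalls,
    ∑ m ∈ Finset.range M, (J m).resolventCalls⟩

/-- The inexact Krasnosel'skii-Mann iteration
`x_{k+1} = (1 - α_k) x_k + α_k · estimate of J_{η(F+G)}(x_k)`. The counters of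
`km … k` count all calls made in iterations `0, …, k - 1`. -/
def km (L η ρ : ℝ) (G : E → Set E) (Ft : E → Ξ → E) (x₀ : E) (ξ : SeedIndex → Ξ)
    (I : ℕ × ℕ → ℕ) : ℕ → Run E
  | 0 => ⟨x₀, 0, 0⟩
  | k + 1 =>
    let r := km L η ρ G Ft x₀ ξ I k
    let e := estimate L η ρ G Ft ξ I k r.point
    ⟨(1 - stepSize η ρ k) • r.point + stepSize η ρ k • e.point,
      r.oracleCalls + e.oracleCalls, r.resolventCalls + e.resolventCalls⟩

end Algorithm

section RandomRun

variable {E Ξ Ω : Type*} [NormedAddCommGroup E] [InnerProductSpace ℝ E]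

/-- The random state of the algorithm after `k` iterations: the iterate `x_k` and the numbers of
calls made in iterations `0, …, k - 1`. -/
def run (L η ρ : ℝ) (G : E → Set E) (Ft : E → Ξ → E) (x₀ : E) (ξ : SeedIndex → Ω → Ξ)
    (I : ℕ × ℕ → Ω → ℕ) (k : ℕ) (ω : Ω) : Run E :=
  km L η ρ G Ft x₀ (fun j => ξ j ω) (fun j => I j ω) k

/-- The random estimate of `J_{η(F+G)}(x_k)` computed in iteration `k`, with the numbers of calls
made in that iteration. -/
def iteration (L η ρ : ℝ) (G : E → Set E) (Ft : E → Ξ → E) (x₀ : E) (ξ : SeedIndex → Ω → Ξ)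
    (I : ℕ × ℕ → Ω → ℕ) (k : ℕ) (ω : Ω) : Run E :=
  estimate L η ρ G Ft (fun j => ξ j ω) (fun j => I j ω) k (run L η ρ G Ft x₀ ξ I k ω).point

/-- The output `x_κ` of the algorithm for the index `κ = q.1` and the outcome `ω = q.2`. -/
def xout (L η ρ : ℝ) (G : E → Set E) (Ft : E → Ξ → E) (x₀ : E) (ξ : SeedIndex → Ω → Ξ)
    (I : ℕ × ℕ → Ω → ℕ) (q : ℕ × Ω) : E :=
  (run L η ρ G Ft x₀ ξ I q.1 q.2).point

/-- The norm `‖(Id - J_{η(F+G)})(x)‖` of the fixed-point residual. -/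
def fpResidual (η : ℝ) (F : E → E) (G : E → Set E) (x : E) : ℝ :=
  ‖x - resolventMap (opSmul η (opAdd F G)) x‖

end RandomRun

/-- Joint law of a uniform index in `{0, …, K - 1}` and an independent outcome of the algorithm. -/
def withUniformIndex {Ω : Type*} [MeasurableSpace Ω] (K : ℕ) (P : Measure Ω) :
    Measure (ℕ × Ω) :=
  (uniformOn (Set.Iio K)).prod P

end StochKM

end

open StochKM

noncomputable section

namespace StochKM

-- Write `J` for the resolvent of `η (F + G)`, `R` for the residual `‖x - J x‖`, `D` for the
-- distance from `x` to the solution and `S = R² + η²σ²`. Since `x - J x = η u` with `u ∈ (F + G)(J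
-- x)`, the weak Minty inequality at `J x` gives `α R² ≤ ⟪x - J x, x - xs⟫`
-- (`WeakMVI.relax_mul_sq_le`). Hence an exact relaxed step of length `a ≤ α` lowers `D²` by at
-- least `a α R²`.
--
-- `J x` is not available, but it solves a strongly monotone Lipschitz inclusion: `η L < 1` makes
-- `Id + η F` strongly monotone although `F` need not be monotone. After `T` iterations from `x` the
-- stochastic forward-backward-forward method has mean square error `O(S / T)`
-- (`expectationLE_innerFbf`). This error is relative to the residual, up to noise. The multilevel
-- estimator has the bias of a run of about `N` iterations at expected cost `O(log N)`; its second
-- moment is `O(S log N)`, and averaging `O(log N)` copies brings this down to a small multiple of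
-- `S` (`multilevel_estimator`, `average_estimator`, `estimate_moments`).
--
-- With `β_k = α_k / (α (k + 1))`, the cap `N_k` makes the squared bias at most `β_k S / 480`.
-- Young's inequality with weight `β_k` then turns the bias into a factor `1 + β_k` on `D²`, plus a
-- multiple of `α_k² S` whose `R²` part is absorbed by the decrease (`expectationLE_step`). As `∑
-- β_k ≤ 3` and `∑ α_k² ≤ 3 α²`, a Grönwall argument bounds `∑ α α_k 𝔼 R_k² / 2`; dividing by the
-- smallest `α_k` gives the rate.
--
-- `N_k` is polynomial in `k`, so an iteration costs `O(log² k)`. Reaching `ε` takes of order `ε⁻⁴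
-- log² (1/ε)` iterations, hence four logarithms in the total cost.

theorem resolventMap_mem {E : Type*} [NormedAddCommGroup E] {A : E → Set E} {x : E} (h : ∃! y, y ∈ resolventValues A x) :
    resolventMap A x ∈ resolventValues A x := by
  have h' : (resolventValues A x).Nonempty := h.exists
  rw [resolventMap, dif_pos h']
  exact h'.some_mem

-- Resolvents of monotone operators and of `η (F + G)`.

section Minty

variable {E : Type*} [NormedAddCommGroup E] [InnerProductSpace ℝ E]

/-- Twice the difference of the two sides is `∑ i, ∑ j, w i * w j * ⟪u i - u j, a i - a j⟫`, a sum
of nonnegative terms. -/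
theorem inner_sum_le_sum_inner {ι : Type*} [Fintype ι] (a u : ι → E)
    (hmono : ∀ i j, 0 ≤ ⟪u i - u j, a i - a j⟫) (w : ι → ℝ) (hw : w ∈ stdSimplex ℝ ι) :
    ⟪∑ i, w i • u i, ∑ i, w i • a i⟫ ≤ ∑ i, w i * ⟪u i, a i⟫ := by
  have h0 : 0 ≤ ∑ i, ∑ j, w i * w j * ⟪u i - u j, a i - a j⟫ :=
    Finset.sum_nonneg fun i _ => Finset.sum_nonneg fun j _ =>
      mul_nonneg (mul_nonneg (hw.1 i) (hw.1 j)) (hmono i j)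
  have h1 : ∀ i, ∑ j, w i * w j * ⟪u i - u j, a i - a j⟫ =
      w i * ⟪u i, a i⟫ - ⟪w i • u i, ∑ j, w j • a j⟫ - ⟪∑ j, w j • u j, w i • a i⟫ +
        w i * ∑ j, w j * ⟪u j, a j⟫ := by
    intro i
    have : w i * ⟪u i, a i⟫ = ∑ j, w j * (w i * ⟪u i, a i⟫) := by
      rw [← Finset.sum_mul, hw.2, one_mul]
    rw [this, inner_sum, sum_inner, Finset.mul_sum, ← Finset.sum_sub_distrib,
      ← Finset.sum_sub_distrib, ← Finset.sum_add_distrib]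
    refine Finset.sum_congr rfl fun j _ => ?_
    simp only [inner_sub_left, inner_sub_right, real_inner_smul_left, real_inner_smul_right]
    ring
  simp only [h1, Finset.sum_add_distrib, Finset.sum_sub_distrib, ← sum_inner, ← inner_sum,
    ← Finset.sum_mul, hw.2] at h0
  linarith

/-- A minimax argument reduced to one minimization. With `c i = (a i - u i) / 2` the required
quantity is `⟪u i, a i⟫ + 2 ⟪y, c i⟫ - ‖y‖²`. Take `y = ∑ w i • c i` for a minimizer `w` of `φ` on
the simplex: the first-order condition towards vertex `i`, added to `0 ≤ φ w`, is exactly the claim.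
-/
theorem exists_monotone_extension_of_fintype {ι : Type*} [Fintype ι] [Nonempty ι] (a u : ι → E)
    (hmono : ∀ i j, 0 ≤ ⟪u i - u j, a i - a j⟫) : ∃ y : E, ∀ i, 0 ≤ ⟪u i + y, a i - y⟫ := by
  classical
  let c : ι → E := fun i => (1 / 2 : ℝ) • (a i - u i)
  let φ : (ι → ℝ) → ℝ := fun w => ∑ i, w i * ⟪u i, a i⟫ + ‖∑ i, w i • c i‖ ^ 2
  have hφ : Continuous φ := by fun_prop
  obtain ⟨w, hw, hmin⟩ := (isCompact_stdSimplex (𝕜 := ℝ) ι).exists_isMinOn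
    ⟨_, ite_eq_mem_stdSimplex ℝ (Classical.arbitrary ι)⟩ hφ.continuousOn
  set y : E := ∑ i, w i • c i with hy
  -- By the previous lemma `φ w` is at least `‖∑ w i • a i + ∑ w i • u i‖² / 4`.
  have hnonneg : 0 ≤ φ w := by
    have h := inner_sum_le_sum_inner a u hmono w hw
    have e : y = (1 / 2 : ℝ) • (∑ i, w i • a i - ∑ i, w i • u i) := by
      rw [hy, ← Finset.sum_sub_distrib, Finset.smul_sum]
      refine Finset.sum_congr rfl fun i _ => ?_
      simp only [c, ← smul_sub, smul_comm (w i)]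
    have e2 : ‖y‖ ^ 2 + ⟪∑ i, w i • u i, ∑ i, w i • a i⟫ =
        (1 / 4) * ‖∑ i, w i • a i + ∑ i, w i • u i‖ ^ 2 := by
      rw [e, norm_smul, mul_pow, norm_sub_sq_real, norm_add_sq_real,
        real_inner_comm (∑ i, w i • a i)]
      norm_num
      ring
    have : 0 ≤ (1 / 4) * ‖∑ i, w i • a i + ∑ i, w i • u i‖ ^ 2 := by positivity
    change 0 ≤ ∑ i, w i * ⟪u i, a i⟫ + ‖y‖ ^ 2
    linarith
  refine ⟨y, fun i => ?_⟩
  set A : ℝ := ⟪u i, a i⟫ - ∑ j, w j * ⟪u j, a j⟫ + 2 * ⟪y, c i - y⟫ with hA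
  have hdir : ∀ t ∈ Set.Ioc (0 : ℝ) 1, 0 ≤ A + t * ‖c i - y‖ ^ 2 := by
    intro t ht
    let e : ι → ℝ := fun j => if i = j then 1 else 0
    have hmem : (1 - t) • w + t • e ∈ stdSimplex ℝ ι :=
      convex_stdSimplex ℝ ι hw (ite_eq_mem_stdSimplex ℝ i) (by linarith [ht.2]) ht.1.le (by ring)
    have h := hmin hmem
    have h1 : ∑ j, ((1 - t) • w + t • e) j • c j = y + t • (c i - y) := by
      simp only [Pi.add_apply, Pi.smul_apply, add_smul, Finset.sum_add_distrib, smul_assoc,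
        ← Finset.smul_sum, e, ite_smul, one_smul, zero_smul, Finset.sum_ite_eq, Finset.mem_univ,
        if_true, ← hy]
      module
    have h2 : ∑ j, ((1 - t) • w + t • e) j * ⟪u j, a j⟫ =
        ∑ j, w j * ⟪u j, a j⟫ + t * (⟪u i, a i⟫ - ∑ j, w j * ⟪u j, a j⟫) := by
      simp only [Pi.add_apply, Pi.smul_apply, add_mul, Finset.sum_add_distrib, smul_eq_mul,
        mul_assoc, ← Finset.mul_sum, e, ite_mul, one_mul, zero_mul, Finset.sum_ite_eq,
        Finset.mem_univ, if_true]
      ring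
    have h3 : φ w ≤ φ ((1 - t) • w + t • e) := h
    simp only [φ, h1, h2, ← hy] at h3
    rw [norm_add_sq_real, norm_smul, mul_pow, Real.norm_eq_abs, sq_abs, inner_smul_right] at h3
    have h4 : 0 ≤ t * (A + t * ‖c i - y‖ ^ 2) := by rw [hA]; linarith
    exact nonneg_of_mul_nonneg_right h4 ht.1
  have hA0 : 0 ≤ A := by
    have hc : Filter.Tendsto (fun t : ℝ => A + t * ‖c i - y‖ ^ 2) (nhdsWithin 0 (Set.Ioi 0))
        (nhds (A + 0 * ‖c i - y‖ ^ 2)) :=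
      Filter.Tendsto.mono_left (Continuous.tendsto (by fun_prop) 0) nhdsWithin_le_nhds
    rw [zero_mul, add_zero] at hc
    refine ge_of_tendsto hc ?_
    filter_upwards [Ioc_mem_nhdsGT (zero_lt_one' ℝ)] with t ht using hdir t ht
  have e1 : ⟪u i + y, a i - y⟫ = ⟪u i, a i⟫ + 2 * ⟪y, c i⟫ - ‖y‖ ^ 2 := by
    simp only [c, inner_add_left, inner_sub_right, inner_smul_right, real_inner_self_eq_norm_sq,
      real_inner_comm y (u i)]
    ring
  have e2 : ⟪y, c i - y⟫ = ⟪y, c i⟫ - ‖y‖ ^ 2 := by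
    rw [inner_sub_right, real_inner_self_eq_norm_sq]
  have e3 : φ w = ∑ i, w i * ⟪u i, a i⟫ + ‖y‖ ^ 2 := rfl
  rw [e1]
  rw [hA, e2] at hA0
  linarith

/-- A form of Minty's theorem: every point has a resolvent value of some monotone extension. -/
theorem IsMonotoneOp.exists_monotone_extension [FiniteDimensional ℝ E] {A : E → Set E}
    (hA : IsMonotoneOp A) (x : E) : ∃ y : E, ∀ a, ∀ u ∈ A a, 0 ≤ ⟪u - (x - y), a - y⟫ := by
  rcases isEmpty_or_nonempty {p : E × E // p.2 ∈ A p.1} with hne | ⟨⟨p₀⟩⟩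
  · exact ⟨0, fun a u hu => (hne.false ⟨(a, u), hu⟩).elim⟩
  -- Completing the square shows that each `C p` is a closed ball, so compactness reduces the claim
  -- to finitely many graph points.
  let C : {p : E × E // p.2 ∈ A p.1} → Set E :=
    fun p => {y | 0 ≤ ⟪p.1.2 - (x - y), p.1.1 - y⟫}
  have hC : ∀ p, IsClosed (C p) := fun p => isClosed_le continuous_const (by fun_prop)
  have hcomp : IsCompact (C p₀) := by
    refine Metric.isCompact_of_isClosed_isBounded (hC p₀) ?_
    set v : E := p₀.1.2 - x
    set a : E := p₀.1.1
    refine (Metric.isBounded_closedBall (x := (1 / 2 : ℝ) • (a - v))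
      (r := √(‖(1 / 2 : ℝ) • (a - v)‖ ^ 2 + ⟪v, a⟫))).subset fun y hy => ?_
    rw [mem_closedBall_iff_norm]
    refine Real.le_sqrt_of_sq_le ?_
    have hy' : 0 ≤ ⟪p₀.1.2 - (x - y), a - y⟫ := hy
    have e : p₀.1.2 - (x - y) = v + y := by simp only [v]; abel
    rw [e, inner_add_left, inner_sub_right, inner_sub_right, real_inner_self_eq_norm_sq,
      real_inner_comm y v] at hy'
    rw [norm_sub_sq_real, inner_smul_right, inner_sub_right]
    linarith
  have hfin : ∀ s : Finset {p : E × E // p.2 ∈ A p.1}, (C p₀ ∩ ⋂ i ∈ s, C i).Nonempty := by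
    intro s
    classical
    have : Nonempty {p // p ∈ insert p₀ s} := ⟨⟨p₀, Finset.mem_insert_self _ _⟩⟩
    obtain ⟨y, hy⟩ := exists_monotone_extension_of_fintype
      (ι := {p // p ∈ insert p₀ s}) (fun p => p.1.1.1) (fun p => p.1.1.2 - x) (fun p q => by
        have := hA p.1.1.1 q.1.1.1 p.1.1.2 p.1.2 q.1.1.2 q.1.2
        simpa using this)
    have hmem : ∀ p ∈ insert p₀ s, y ∈ C p := fun p hp => by
      have := hy ⟨p, hp⟩
      have e : p.1.2 - (x - y) = p.1.2 - x + y := by abel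
      simpa only [C, Set.mem_ofPred_eq, e] using this
    exact ⟨y, hmem _ (Finset.mem_insert_self _ _), by
      simp only [Set.mem_iInter]
      exact fun p hp => hmem p (Finset.mem_insert_of_mem hp)⟩
  obtain ⟨y, -, hy⟩ := hcomp.inter_iInter_nonempty C hC hfin
  exact ⟨y, fun a u hu => Set.mem_iInter.1 hy ⟨(a, u), hu⟩⟩

theorem IsMonotoneOp.smul {A : E → Set E} (hA : IsMonotoneOp A) {c : ℝ} (hc : 0 ≤ c) :
    IsMonotoneOp (opSmul c A) := by
  rintro x y _ ⟨u, hu, rfl⟩ _ ⟨v, hv, rfl⟩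
  rw [← smul_sub, real_inner_smul_left]
  exact mul_nonneg hc (hA x y u hu v hv)

theorem opSmul_opSmul (c e : ℝ) (A : E → Set E) : opSmul c (opSmul e A) = opSmul (c * e) A := by
  funext x
  ext w
  constructor
  · rintro ⟨_, ⟨u, hu, rfl⟩, rfl⟩
    exact ⟨u, hu, smul_smul _ _ _⟩
  · rintro ⟨u, hu, rfl⟩
    exact ⟨e • u, ⟨u, hu, rfl⟩, (smul_smul _ _ _).symm⟩

/-- Adjoining the single pair `(y, v)` to the graph keeps it monotone, so by maximality the pair was
already there. -/
theorem IsMaximalMonotone.mem_of_forall {G : E → Set E} (hG : IsMaximalMonotone G) {y v : E}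
    (h : ∀ a, ∀ u ∈ G a, 0 ≤ ⟪u - v, a - y⟫) : v ∈ G y := by
  have hB : IsMonotoneOp (fun z => {w | w ∈ G z ∨ z = y ∧ w = v}) := by
    rintro a b u (hu | ⟨rfl, rfl⟩) w (hw | ⟨rfl, rfl⟩)
    · exact hG.1 a b u hu w hw
    · exact h a u hu
    · rw [← neg_sub, ← neg_sub b, inner_neg_neg]
      exact h b w hw
    · simp
  have := hG.2 _ hB fun x u hu => Or.inl hu
  rw [← this]
  exact Or.inr ⟨rfl, rfl⟩

theorem IsMonotoneOp.norm_sub_le_of_mem_resolventValues {A : E → Set E} (hA : IsMonotoneOp A)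
    {x x' y y' : E} (h : y ∈ resolventValues A x) (h' : y' ∈ resolventValues A x') :
    ‖y - y'‖ ≤ ‖x - x'‖ := by
  obtain ⟨u, hu, rfl⟩ := h
  obtain ⟨v, hv, rfl⟩ := h'
  have h0 := hA y y' u hu v hv
  have e : y + u - (y' + v) = (y - y') + (u - v) := by abel
  refine le_of_sq_le_sq ?_ (norm_nonneg _)
  rw [e, norm_add_sq_real, real_inner_comm]
  nlinarith [sq_nonneg ‖u - v‖]

/-- Defining relation of the resolvent of `η (F + G)`. -/
theorem mem_resolventValues_opAdd {F : E → E} {G : E → Set E} {η : ℝ} {x y : E} :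
    y ∈ resolventValues (opSmul η (opAdd F G)) x ↔ ∃ g ∈ G y, x = y + η • (F y + g) := by
  constructor
  · rintro ⟨_, ⟨_, ⟨g, hg, rfl⟩, rfl⟩, rfl⟩
    exact ⟨g, hg, rfl⟩
  · rintro ⟨g, hg, rfl⟩
    exact ⟨_, ⟨_, ⟨g, hg, rfl⟩, rfl⟩, rfl⟩

/-- `y` is the resolvent of `η G` at `x - η F y`; nonexpansiveness costs an extra `η L ‖y - y'‖`,
which is moved to the left. -/
theorem norm_sub_le_of_mem_resolventValues_opAdd {F : E → E} {G : E → Set E} {L : ℝ≥0} {η : ℝ}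
    (hF : LipschitzWith L F) (hG : IsMonotoneOp G) (hη : 0 < η) {x x' y y' : E}
    (h : y ∈ resolventValues (opSmul η (opAdd F G)) x)
    (h' : y' ∈ resolventValues (opSmul η (opAdd F G)) x') :
    (1 - η * L) * ‖y - y'‖ ≤ ‖x - x'‖ := by
  obtain ⟨g, hg, rfl⟩ := mem_resolventValues_opAdd.1 h
  obtain ⟨g', hg', rfl⟩ := mem_resolventValues_opAdd.1 h'
  have h0 : ‖y - y'‖ ≤ ‖(y + η • g) - (y' + η • g')‖ :=
    (hG.smul hη.le).norm_sub_le_of_mem_resolventValues ⟨_, ⟨g, hg, rfl⟩, rfl⟩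
      ⟨_, ⟨g', hg', rfl⟩, rfl⟩
  have e : (y + η • g) - (y' + η • g') =
      (y + η • (F y + g) - (y' + η • (F y' + g'))) - η • (F y - F y') := by module
  have h1 : ‖η • (F y - F y')‖ ≤ η * (L * ‖y - y'‖) := by
    rw [norm_smul, Real.norm_of_nonneg hη.le]
    have := hF.dist_le_mul y y'
    rw [dist_eq_norm, dist_eq_norm] at this
    gcongr
  have h2 := norm_sub_le (y + η • (F y + g) - (y' + η • (F y' + g'))) (η • (F y - F y'))
  rw [← e] at h2
  linarith

variable [FiniteDimensional ℝ E]

theorem IsMaximalMonotone.existsUnique_resolvent {G : E → Set E} (hG : IsMaximalMonotone G)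
    {c : ℝ} (hc : 0 < c) (x : E) : ∃! y, y ∈ resolventValues (opSmul c G) x := by
  have hm := hG.1.smul hc.le
  refine existsUnique_of_exists_of_unique ?_ fun y y' h h' => ?_
  · obtain ⟨y, hy⟩ := hm.exists_monotone_extension x
    refine ⟨y, x - y, ⟨c⁻¹ • (x - y), hG.mem_of_forall fun a u hu => ?_, ?_⟩, by abel⟩
    · have h := hy a (c • u) ⟨u, hu, rfl⟩
      have e : c • u - (x - y) = c • (u - c⁻¹ • (x - y)) := by
        rw [smul_sub, smul_inv_smul₀ hc.ne']
      rw [e, real_inner_smul_left] at h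
      exact nonneg_of_mul_nonneg_right h hc
    · rw [smul_inv_smul₀ hc.ne']
  · have := hm.norm_sub_le_of_mem_resolventValues h h'
    rw [sub_self, norm_zero] at this
    exact sub_eq_zero.1 (norm_le_zero_iff.1 this)

theorem IsMaximalMonotone.lipschitzWith_resolventMap {G : E → Set E} (hG : IsMaximalMonotone G)
    {c : ℝ} (hc : 0 < c) : LipschitzWith 1 (resolventMap (opSmul c G)) :=
  LipschitzWith.of_dist_le_mul fun x y => by
    rw [dist_eq_norm, dist_eq_norm, NNReal.coe_one, one_mul]
    exact (hG.1.smul hc.le).norm_sub_le_of_mem_resolventValues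
      (resolventMap_mem (hG.existsUnique_resolvent hc x))
      (resolventMap_mem (hG.existsUnique_resolvent hc y))

/-- Existence is Banach's theorem: the resolvent is a fixed point of `y ↦ J_{ηG}(x - η F y)`, a
contraction with factor `η L`. -/
theorem existsUnique_resolvent_opAdd {F : E → E} {G : E → Set E} {L : ℝ≥0} {η : ℝ}
    (hF : LipschitzWith L F) (hG : IsMaximalMonotone G) (hη : 0 < η) (hηL : η * L < 1) (x : E) :
    ∃! y, y ∈ resolventValues (opSmul η (opAdd F G)) x := by
  refine existsUnique_of_exists_of_unique ?_ fun y y' h h' => ?_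
  · have hc : ContractingWith (η.toNNReal * L)
        (fun y => resolventMap (opSmul η G) (x - η • F y)) := by
      refine ⟨?_, ?_⟩
      · rw [← NNReal.coe_lt_coe]
        simpa [hη.le] using hηL
      · refine LipschitzWith.of_dist_le_mul fun y y' => ?_
        refine ((hG.lipschitzWith_resolventMap hη).dist_le_mul _ _).trans ?_
        have := hF.dist_le_mul y y'
        rw [NNReal.coe_one, one_mul, dist_sub_left, dist_smul₀, Real.norm_of_nonneg hη.le,
          NNReal.coe_mul, Real.coe_toNNReal _ hη.le, mul_assoc]
        gcongr
    refine ⟨hc.fixedPoint, mem_resolventValues_opAdd.2 ?_⟩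
    have hfix := hc.fixedPoint_isFixedPt
    set y := hc.fixedPoint with hy
    have hm := resolventMap_mem (hG.existsUnique_resolvent hη (x - η • F y))
    rw [show resolventMap (opSmul η G) (x - η • F y) = y from hfix] at hm
    obtain ⟨_, ⟨g, hg, rfl⟩, hu⟩ := hm
    refine ⟨g, hg, ?_⟩
    rw [smul_add, add_left_comm, ← hu]
    abel
  · have h0 := norm_sub_le_of_mem_resolventValues_opAdd hF hG.1 hη h h'
    rw [sub_self, norm_zero] at h0
    have : ‖y - y'‖ ≤ 0 := by
      by_contra hlt
      have := mul_pos (sub_pos.2 hηL) (not_le.1 hlt)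
      linarith
    exact sub_eq_zero.1 (norm_le_zero_iff.1 this)

theorem continuous_resolventMap_opAdd {F : E → E} {G : E → Set E} {L : ℝ≥0} {η : ℝ}
    (hF : LipschitzWith L F) (hG : IsMaximalMonotone G) (hη : 0 < η) (hηL : η * L < 1) :
    Continuous (resolventMap (opSmul η (opAdd F G))) := by
  have hpos : 0 < 1 - η * L := by linarith
  refine (LipschitzWith.of_dist_le_mul (K := (1 - η * L)⁻¹.toNNReal) fun x y => ?_).continuous
  rw [Real.coe_toNNReal _ (inv_nonneg.2 hpos.le), inv_mul_eq_div, le_div_iff₀ hpos, mul_comm,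
    dist_eq_norm, dist_eq_norm]
  exact norm_sub_le_of_mem_resolventValues_opAdd hF hG.1 hη
    (resolventMap_mem (existsUnique_resolvent_opAdd hF hG hη hηL x))
    (resolventMap_mem (existsUnique_resolvent_opAdd hF hG hη hηL y))

/-- Under the weak Minty inequality the resolvent is star-conically nonexpansive. -/
theorem WeakMVI.relax_mul_sq_le {F : E → E} {G : E → Set E} {L : ℝ≥0} {η ρ : ℝ} {xs : E}
    (hF : LipschitzWith L F) (hG : IsMaximalMonotone G) (hη : 0 < η) (hηL : η * L < 1)
    (hW : WeakMVI ρ F G xs) (x : E) :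
    relax η ρ * ‖x - resolventMap (opSmul η (opAdd F G)) x‖ ^ 2 ≤
      ⟪x - resolventMap (opSmul η (opAdd F G)) x, x - xs⟫ := by
  have hm := resolventMap_mem (existsUnique_resolvent_opAdd hF hG hη hηL x)
  set y := resolventMap (opSmul η (opAdd F G)) x
  obtain ⟨g, hg, hx⟩ := mem_resolventValues_opAdd.1 hm
  -- The inequality is used at the resolvent `y`, not at `x`. Then `⟪x - y, x - xs⟫` splits into `‖x
  -- - y‖²` and a term at least `-(ρ / η) ‖x - y‖²`.
  have h := hW y (F y + g) ⟨g, hg, rfl⟩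
  have e : x - y = η • (F y + g) := by rw [hx]; abel
  have e2 : x - xs = (x - y) + (y - xs) := by abel
  rw [e2, inner_add_right, real_inner_self_eq_norm_sq, e, real_inner_smul_left, norm_smul,
    Real.norm_of_nonneg hη.le, relax]
  have : (1 - ρ / η) * (η * ‖F y + g‖) ^ 2 = (η * ‖F y + g‖) ^ 2 - η * (ρ * ‖F y + g‖ ^ 2) := by
    field_simp
  rw [this]
  nlinarith

end Minty

theorem ExpectationLE.mono {Ω : Type*} [MeasurableSpace Ω] {P : Measure Ω} {f : Ω → ℝ} {a b : ℝ} (h : ExpectationLE P f a) (hab : a ≤ b) :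
    ExpectationLE P f b :=
  ⟨h.1, h.2.trans hab⟩

-- Conditioning on one of two independent variables.

section Freezing

variable {Ω 𝒳 𝒴 : Type*} [MeasurableSpace Ω] [MeasurableSpace 𝒳] [MeasurableSpace 𝒴]
  {P : Measure Ω} [IsProbabilityMeasure P] {X : Ω → 𝒳} {Y : Ω → 𝒴}

theorem lintegral_comp_of_indepFun (hXY : IndepFun X Y P) (hX : Measurable X) (hY : Measurable Y)
    {h : 𝒳 → 𝒴 → ENNReal} (hm : Measurable (Function.uncurry h)) :
    ∫⁻ ω, h (X ω) (Y ω) ∂P = ∫⁻ ω, ∫⁻ ω', h (X ω) (Y ω') ∂P ∂P := by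
  calc ∫⁻ ω, h (X ω) (Y ω) ∂P
      = ∫⁻ p, Function.uncurry h p ∂(P.map fun ω => (X ω, Y ω)) :=
        (lintegral_map hm (hX.prodMk hY)).symm
    _ = ∫⁻ x, ∫⁻ y, h x y ∂(P.map Y) ∂(P.map X) := by
        have := Measure.isProbabilityMeasure_map (μ := P) hY.aemeasurable
        rw [hXY.map_prod_eq_prod_map_map hX.aemeasurable hY.aemeasurable,
          lintegral_prod _ hm.aemeasurable]
        rfl
    _ = ∫⁻ ω, ∫⁻ ω', h (X ω) (Y ω') ∂P ∂P := by
        have := Measure.isProbabilityMeasure_map (μ := P) hY.aemeasurable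
        rw [lintegral_map (f := fun x => ∫⁻ y, h x y ∂(P.map Y))
          (Measurable.lintegral_prod_right' hm) hX]
        refine lintegral_congr fun ω => ?_
        exact lintegral_map (hm.comp measurable_prodMk_left) hY

/-- Bounding the expectation of a nonnegative function of two independent variables by freezing
the first one. -/
theorem expectationLE_of_indepFun (hXY : IndepFun X Y P) (hX : Measurable X) (hY : Measurable Y)
    {h : 𝒳 → 𝒴 → ℝ} (hm : Measurable (Function.uncurry h)) (h0 : ∀ x y, 0 ≤ h x y) {φ : 𝒳 → ℝ}
    (hle : ∀ x, ExpectationLE P (fun ω => h x (Y ω)) (φ x))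
    (hφ : Integrable (fun ω => φ (X ω)) P) :
    ExpectationLE P (fun ω => h (X ω) (Y ω)) (∫ ω, φ (X ω) ∂P) := by
  have hφ0 : ∀ x, 0 ≤ φ x := fun x => (integral_nonneg fun ω => h0 x (Y ω)).trans (hle x).2
  -- Tonelli for `lintegral` needs no prior integrability, so integrability of the composite is a
  -- consequence of the bound.
  have key : ∫⁻ ω, ENNReal.ofReal (h (X ω) (Y ω)) ∂P ≤ ENNReal.ofReal (∫ ω, φ (X ω) ∂P) := by
    rw [lintegral_comp_of_indepFun hXY hX hY (h := fun x y => ENNReal.ofReal (h x y))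
      hm.ennreal_ofReal, ofReal_integral_eq_lintegral_ofReal hφ
        (Filter.Eventually.of_forall fun ω => hφ0 _)]
    refine lintegral_mono fun ω => ?_
    rw [← ofReal_integral_eq_lintegral_ofReal (hle _).1
      (Filter.Eventually.of_forall fun ω => h0 _ _)]
    exact ENNReal.ofReal_le_ofReal (hle _).2
  have hmeas : Measurable fun ω => h (X ω) (Y ω) := hm.comp (hX.prodMk hY)
  have hn : 0 ≤ᵐ[P] fun ω => h (X ω) (Y ω) := Filter.Eventually.of_forall fun ω => h0 _ _
  have hi : Integrable (fun ω => h (X ω) (Y ω)) P := by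
    refine ⟨hmeas.aestronglyMeasurable, ?_⟩
    rw [hasFiniteIntegral_iff_ofReal hn]
    exact key.trans_lt ENNReal.ofReal_lt_top
  refine ⟨hi, ?_⟩
  rw [integral_eq_lintegral_of_nonneg_ae hn hmeas.aestronglyMeasurable]
  exact ENNReal.toReal_le_of_le_ofReal (integral_nonneg fun ω => hφ0 _) key

end Freezing

-- Independence of disjoint families of random draws.

section Draws

variable {Ξ Ω : Type*} [MeasurableSpace Ξ] {ξ : SeedIndex → Ω → Ξ} {I : ℕ × ℕ → Ω → ℕ}

/-- The σ-algebra generated by a single draw: a seed or a level. -/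
@[reducible]
def drawSigma (ξ : SeedIndex → Ω → Ξ) (I : ℕ × ℕ → Ω → ℕ) :
    SeedIndex ⊕ (ℕ × ℕ) → MeasurableSpace Ω
  | .inl j => MeasurableSpace.comap (ξ j) inferInstance
  | .inr j => MeasurableSpace.comap (I j) inferInstance

/-- The σ-algebra generated by a set of draws. -/
@[reducible]
def drawsSigma (ξ : SeedIndex → Ω → Ξ) (I : ℕ × ℕ → Ω → ℕ) (S : Set (SeedIndex ⊕ (ℕ × ℕ))) :
    MeasurableSpace Ω :=
  ⨆ j ∈ S, drawSigma ξ I j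

theorem drawsSigma_mono {S T : Set (SeedIndex ⊕ (ℕ × ℕ))} (h : S ⊆ T) :
    drawsSigma ξ I S ≤ drawsSigma ξ I T :=
  biSup_mono h

theorem measurable_seed_drawsSigma {S : Set (SeedIndex ⊕ (ℕ × ℕ))} {j : SeedIndex}
    (hj : .inl j ∈ S) : Measurable[drawsSigma ξ I S] (ξ j) :=
  Measurable.mono (comap_measurable (ξ j)) (le_biSup (drawSigma ξ I) hj) le_rfl

theorem measurable_level_drawsSigma {S : Set (SeedIndex ⊕ (ℕ × ℕ))} {j : ℕ × ℕ}
    (hj : .inr j ∈ S) : Measurable[drawsSigma ξ I S] (I j) :=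
  Measurable.mono (comap_measurable (I j)) (le_biSup (drawSigma ξ I) hj) le_rfl

end Draws

section Sampling

variable {Ξ Ω : Type*} [MeasurableSpace Ξ] [mΩ : MeasurableSpace Ω] {P : Measure Ω}
  {ν : Measure Ξ} {ξ : SeedIndex → Ω → Ξ} {I : ℕ × ℕ → Ω → ℕ}

theorem IsSampling.drawSigma_le (hS : IsSampling P ν ξ I) (j : SeedIndex ⊕ (ℕ × ℕ)) :
    drawSigma ξ I j ≤ mΩ := by
  rcases j with j | j
  · exact (hS.measurable_seed j).comap_le
  · exact (hS.measurable_level j).comap_le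

/-- Seeds and levels are merged into one independent family: a finite intersection of events splits
into its seed part and its level part. All later independence claims reduce to disjointness of index
sets. -/
theorem IsSampling.iIndep_drawSigma (hS : IsSampling P ν ξ I) : iIndep (drawSigma ξ I) P := by
  rw [iIndep_iff]
  intro s f hf
  have e : ⋂ i ∈ s, f i = (⋂ j ∈ s.toLeft, f (.inl j)) ∩ ⋂ j ∈ s.toRight, f (.inr j) := by
    ext ω
    simp
  have hl : ∀ j ∈ s.toLeft, MeasurableSet[drawSigma ξ I (.inl j)] (f (.inl j)) :=
    fun j hj => hf _ (by simpa using hj)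
  have hr : ∀ j ∈ s.toRight, MeasurableSet[drawSigma ξ I (.inr j)] (f (.inr j)) :=
    fun j hj => hf _ (by simpa using hj)
  have h1 := (Indep_iff _ _ _).1 ((IndepFun_iff_Indep _ _ _).1 hS.indep_seed_level)
    (⋂ j ∈ s.toLeft, f (.inl j)) (⋂ j ∈ s.toRight, f (.inr j))
    (Finset.measurableSet_biInter _ fun j hj => by
      obtain ⟨B, hB, h⟩ := hl j hj
      exact ⟨(fun g : SeedIndex → Ξ => g j) ⁻¹' B, measurable_pi_apply j hB, h⟩)
    (Finset.measurableSet_biInter _ fun j hj => by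
      obtain ⟨B, hB, h⟩ := hr j hj
      exact ⟨(fun g : ℕ × ℕ → ℕ => g j) ⁻¹' B, measurable_pi_apply j hB, h⟩)
  rw [e, h1, (iIndep_iff _ _).1 ((iIndepFun_iff_iIndep _ _ _).1 hS.indep_seed) s.toLeft hl,
    (iIndep_iff _ _).1 ((iIndepFun_iff_iIndep _ _ _).1 hS.indep_level) s.toRight hr,
    Finset.prod_sum_eq_prod_toLeft_mul_prod_toRight]

theorem IsSampling.indep_drawsSigma (hS : IsSampling P ν ξ I) {S T : Set (SeedIndex ⊕ (ℕ × ℕ))}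
    (hST : Disjoint S T) : Indep (drawsSigma ξ I S) (drawsSigma ξ I T) P :=
  indep_iSup_of_disjoint hS.drawSigma_le hS.iIndep_drawSigma hST

theorem IsSampling.drawsSigma_le (hS : IsSampling P ν ξ I) (S : Set (SeedIndex ⊕ (ℕ × ℕ))) :
    drawsSigma ξ I S ≤ mΩ :=
  iSup₂_le fun j _ => hS.drawSigma_le j

theorem IsSampling.indepFun (hS : IsSampling P ν ξ I) {S T : Set (SeedIndex ⊕ (ℕ × ℕ))}
    (hST : Disjoint S T) {𝒳 𝒴 : Type*} [MeasurableSpace 𝒳] [MeasurableSpace 𝒴] {X : Ω → 𝒳}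
    {Y : Ω → 𝒴} (hX : Measurable[drawsSigma ξ I S] X) (hY : Measurable[drawsSigma ξ I T] Y) :
    IndepFun X Y P :=
  (IndepFun_iff_Indep _ _ _).2 (indep_of_indep_of_le_left (indep_of_indep_of_le_right
    (hS.indep_drawsSigma hST) hY.comap_le) hX.comap_le)

end Sampling

-- Mean square error of the stochastic forward-backward-forward method.

section ForwardBackwardForward

variable {E : Type*} [NormedAddCommGroup E] [InnerProductSpace ℝ E]

/-- One forward-backward-forward step whose second evaluation is exact. -/
theorem fbf_step_sq_le {A : E → Set E} (hA : IsMonotoneOp A) {β : E → E} {μ LB τ : ℝ}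
    (hmono : ∀ z w, μ * ‖z - w‖ ^ 2 ≤ ⟪β z - β w, z - w⟫)
    (hlip : ∀ z w, ‖β z - β w‖ ≤ LB * ‖z - w‖) (hτ : 0 < τ) (hμ : 0 ≤ μ) (hμL : μ ≤ LB)
    (hτL : τ * LB ≤ 1 / 3) {z b zh y : E}
    (hzh : zh ∈ resolventValues (opSmul τ A) (z - τ • b)) (hy : -β y ∈ A y) :
    ‖zh + τ • b - τ • β zh - y‖ ^ 2 ≤
      (1 - τ * μ) * ‖z - y‖ ^ 2 + 2 * τ ^ 2 * ‖b - β z‖ ^ 2 := by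
  obtain ⟨_, ⟨p, hp, rfl⟩, hz⟩ := hzh
  set d := z - zh with hd
  set v := zh - y with hv
  set g := τ • (β zh - b) with hg
  have hmon : τ * μ * ‖v‖ ^ 2 ≤ ⟪v, d + g⟫ := by
    have e : d + g = τ • (p + β zh) := by
      have : z = zh + τ • p + τ • b := by rw [← hz]; abel
      rw [hd, hg, this]
      module
    have h1 := hA zh y p hp _ hy
    have h2 := hmono zh y
    have h3 : ⟪v, p + β zh⟫ = ⟪p - -β y, v⟫ + ⟪β zh - β y, v⟫ := by
      rw [← inner_add_left, real_inner_comm]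
      congr 1
      abel
    rw [e, inner_smul_right, h3, mul_assoc]
    exact mul_le_mul_of_nonneg_left (by linarith) hτ.le
  have hgn : ‖g‖ ^ 2 ≤ 2 / 9 * ‖d‖ ^ 2 + 2 * τ ^ 2 * ‖b - β z‖ ^ 2 := by
    have e : g = τ • (β zh - β z) - τ • (b - β z) := by rw [hg]; module
    have h1 : ‖τ • (β zh - β z)‖ ≤ 1 / 3 * ‖d‖ := by
      rw [norm_smul, Real.norm_of_nonneg hτ.le, hd, norm_sub_rev z]
      calc τ * ‖β zh - β z‖ ≤ τ * (LB * ‖zh - z‖) := by gcongr; exact hlip _ _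
        _ = τ * LB * ‖zh - z‖ := by ring
        _ ≤ 1 / 3 * ‖zh - z‖ := by gcongr
    have h2 : ‖τ • (b - β z)‖ = τ * ‖b - β z‖ := by
      rw [norm_smul, Real.norm_of_nonneg hτ.le]
    have h3 := norm_sub_le (τ • (β zh - β z)) (τ • (b - β z))
    rw [← e, h2] at h3
    have h4 : ‖g‖ ^ 2 ≤ (1 / 3 * ‖d‖ + τ * ‖b - β z‖) ^ 2 := by gcongr; linarith
    nlinarith [sq_nonneg (1 / 3 * ‖d‖ - τ * ‖b - β z‖)]
  have e1 : zh + τ • b - τ • β zh - y = v - g := by rw [hv, hg]; module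
  have e2 : z - y = d + v := by rw [hd, hv]; abel
  have hτμ : τ * μ ≤ 1 / 3 := (mul_le_mul_of_nonneg_left hμL hτ.le).trans hτL
  have hτμ0 : 0 ≤ τ * μ := mul_nonneg hτ.le hμ
  rw [e1, e2, norm_sub_sq_real, norm_add_sq_real]
  rw [inner_add_right] at hmon
  -- The cross term in `τ μ ‖d + v‖²` is split evenly. Since `τ μ ≤ 1/3`, the surplus is at least
  -- `(1 - 2/3 - 2/9) ‖d‖²`, which is nonnegative.
  have h5 : 2 * ⟪d, v⟫ ≤ ‖d‖ ^ 2 + ‖v‖ ^ 2 := by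
    have := sq_nonneg ‖d - v‖
    rw [norm_sub_sq_real] at this
    linarith
  have h6 : τ * μ * (2 * ⟪d, v⟫) ≤ τ * μ * (‖d‖ ^ 2 + ‖v‖ ^ 2) :=
    mul_le_mul_of_nonneg_left h5 hτμ0
  have h7 : τ * μ * ‖d‖ ^ 2 ≤ 1 / 3 * ‖d‖ ^ 2 := mul_le_mul_of_nonneg_right hτμ (sq_nonneg _)
  rw [real_inner_comm] at hmon
  nlinarith [sq_nonneg ‖d‖]

variable {Ξ Ω : Type*} [MeasurableSpace Ξ] [MeasurableSpace Ω]

/-- The basic expansion used below: the linear term keeps the exact mean of `g`, so it sees only a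
bias, and vanishes for centred noise. -/
theorem expectationLE_norm_add_smul_sq [FiniteDimensional ℝ E] {P : Measure Ω}
    [IsProbabilityMeasure P] {g : Ω → E} {v : ℝ} (hg : Integrable g P)
    (h2 : ExpectationLE P (fun ω => ‖g ω‖ ^ 2) v) (a : E) (c : ℝ) :
    ExpectationLE P (fun ω => ‖a + c • g ω‖ ^ 2)
      (‖a‖ ^ 2 + 2 * c * ⟪a, ∫ ω, g ω ∂P⟫ + c ^ 2 * v) := by
  have e : (fun ω => ‖a + c • g ω‖ ^ 2) =
      fun ω => ‖a‖ ^ 2 + 2 * c * ⟪a, g ω⟫ + c ^ 2 * ‖g ω‖ ^ 2 := by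
    funext ω
    rw [norm_add_sq_real, norm_smul, mul_pow, inner_smul_right, Real.norm_eq_abs, sq_abs]
    ring
  have hi : Integrable (fun ω => ⟪a, g ω⟫) P := hg.const_inner a
  have hi1 : Integrable (fun ω => ‖a‖ ^ 2 + 2 * c * ⟪a, g ω⟫) P :=
    (integrable_const _).add (hi.const_mul _)
  have hi2 : Integrable (fun ω => c ^ 2 * ‖g ω‖ ^ 2) P := h2.1.const_mul _
  rw [e]
  refine ⟨hi1.add hi2, ?_⟩
  rw [integral_add hi1 hi2, integral_add (integrable_const _) (hi.const_mul _),
    integral_const_mul, integral_const_mul, integral_inner hg, integral_const]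
  simp only [probReal_univ, one_smul]
  gcongr
  exact h2.2

/-- The assumptions on the problem that concern the inner solver. -/
structure InnerProblem [MeasurableSpace E] (L : ℝ≥0) (η σ : ℝ) (F : E → E) (G : E → Set E)
    (Ft : E → Ξ → E) (ν : Measure Ξ) : Prop where
  lipschitz : LipschitzWith L F
  maximal : IsMaximalMonotone G
  eta_pos : 0 < η
  eta_mul_lt : η * L < 1
  oracle : IsStochasticOracle Ft ν F σ

variable [FiniteDimensional ℝ E] [MeasurableSpace E] [BorelSpace E]
  {L : ℝ≥0} {η σ : ℝ} {F : E → E} {G : E → Set E} {Ft : E → Ξ → E} {ν : Measure Ξ}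

/-- The inner solver used by the algorithm. -/
abbrev innerFbf (L : ℝ≥0) (η : ℝ) (G : E → Set E) (Ft : E → Ξ → E) (x : E)
    (seed : ℕ → Bool → Ξ) (T : ℕ) : Run E :=
  fbf (1 - η * L) (1 + η * L) (opSmul η G) (fun z s => z + η • Ft z s) x seed T

/-- The step size of the inner solver. -/
def innerStep (L : ℝ≥0) (η : ℝ) (t : ℕ) : ℝ :=
  2 / (((t : ℝ) + 1) * (1 - η * L) + 6 * (1 + η * L))

/-- The half step of the inner solver. -/
def innerHalf (L : ℝ≥0) (η : ℝ) (G : E → Set E) (Ft : E → Ξ → E) (t : ℕ) (x z : E) (s : Ξ) : E :=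
  resolventMap (opSmul (innerStep L η t) (opSmul η G))
    (z - innerStep L η t • (z + η • Ft z s - x))

omit [FiniteDimensional ℝ E] [MeasurableSpace E] [BorelSpace E] [MeasurableSpace Ξ] in
theorem innerFbf_succ_point (x : E) (seed : ℕ → Bool → Ξ) (t : ℕ) :
    (innerFbf L η G Ft x seed (t + 1)).point =
      innerHalf L η G Ft t x (innerFbf L η G Ft x seed t).point (seed t false) +
        innerStep L η t • ((innerFbf L η G Ft x seed t).point +
          η • Ft (innerFbf L η G Ft x seed t).point (seed t false) - x) -
        innerStep L η t • (innerHalf L η G Ft t x (innerFbf L η G Ft x seed t).point (seed t false) +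
          η • Ft (innerHalf L η G Ft t x (innerFbf L η G Ft x seed t).point (seed t false))
            (seed t true) - x) :=
  rfl

namespace InnerProblem

variable (h : InnerProblem L η σ F G Ft ν)
include h

omit [FiniteDimensional ℝ E] [BorelSpace E] in
theorem innerStep_pos (t : ℕ) : 0 < innerStep L η t := by
  have h1 := h.eta_mul_lt
  have h2 : 0 ≤ η * L := mul_nonneg h.eta_pos.le L.2
  have h3 : 0 < 1 - η * L := by linarith
  unfold innerStep
  positivity

omit [FiniteDimensional ℝ E] [BorelSpace E] in
theorem innerStep_mul_le (t : ℕ) : innerStep L η t * (1 + η * L) ≤ 1 / 3 := by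
  have h1 := h.eta_mul_lt
  have h2 : 0 ≤ η * L := mul_nonneg h.eta_pos.le L.2
  have h3 : 0 < 1 - η * L := by linarith
  have h4 : 0 ≤ ((t : ℝ) + 1) * (1 - η * L) := by positivity
  unfold innerStep
  rw [div_mul_eq_mul_div, div_le_iff₀ (by linarith)]
  linarith

omit [BorelSpace E] in
theorem lipschitzWith_half (t : ℕ) :
    LipschitzWith 1 (resolventMap (opSmul (innerStep L η t) (opSmul η G))) := by
  rw [opSmul_opSmul]
  exact h.maximal.lipschitzWith_resolventMap (mul_pos (h.innerStep_pos t) h.eta_pos)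

theorem measurable_innerHalf {Ω' : Type*} {_ : MeasurableSpace Ω'} (t : ℕ) {X Z : Ω' → E}
    {s : Ω' → Ξ} (hX : Measurable X) (hZ : Measurable Z) (hs : Measurable s) :
    Measurable fun ω => innerHalf L η G Ft t (X ω) (Z ω) (s ω) := by
  have h1 : Measurable fun ω => Ft (Z ω) (s ω) := h.oracle.measurable.comp (hZ.prodMk hs)
  exact (h.lipschitzWith_half t).continuous.measurable.comp
    (hZ.sub (((hZ.add (h1.const_smul η)).sub hX).const_smul _))

theorem measurable_innerFbf {Ω' : Type*} {_ : MeasurableSpace Ω'} {X : Ω' → E} (hX : Measurable X)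
    {s : ℕ → Bool → Ω' → Ξ} {T : ℕ} (hs : ∀ t < T, ∀ b, Measurable (s t b)) :
    Measurable fun ω => (innerFbf L η G Ft (X ω) (fun t b => s t b ω) T).point := by
  induction T with
  | zero => exact hX
  | succ t ih =>
    have hz := ih fun t' ht' => hs t' (ht'.trans (Nat.lt_succ_self t))
    have hf := hs t (Nat.lt_succ_self t) false
    have ht := hs t (Nat.lt_succ_self t) true
    have hh := h.measurable_innerHalf t hX hz hf
    have h1 := h.oracle.measurable.comp (hz.prodMk hf)
    have h2 := h.oracle.measurable.comp (hh.prodMk ht)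
    simp only [innerFbf_succ_point]
    exact (hh.add (((hz.add (h1.const_smul η)).sub hX).const_smul _)).sub
      (((hh.add (h2.const_smul η)).sub hX).const_smul _)

omit [FiniteDimensional ℝ E] [BorelSpace E] in
theorem integrable_seed {P : Measure Ω} {s : Ω → Ξ} (hs : Measurable s) (hl : P.map s = ν)
    (z : E) : Integrable (fun ω => Ft z (s ω)) P :=
  (MeasurePreserving.mk hs hl).integrable_comp_of_integrable (h.oracle.integrable z)

omit [FiniteDimensional ℝ E] [BorelSpace E] in
theorem integral_seed {P : Measure Ω} {s : Ω → Ξ} (hs : Measurable s) (hl : P.map s = ν)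
    (z : E) : ∫ ω, Ft z (s ω) ∂P = F z := by
  rw [← h.oracle.unbiased z, ← hl, integral_map hs.aemeasurable]
  rw [hl]
  exact (h.oracle.integrable z).aestronglyMeasurable

omit [FiniteDimensional ℝ E] [BorelSpace E] in
theorem expectationLE_seed {P : Measure Ω} {s : Ω → Ξ} (hs : Measurable s) (hl : P.map s = ν)
    (z : E) : ExpectationLE P (fun ω => ‖Ft z (s ω) - F z‖ ^ 2) (σ ^ 2) := by
  refine ⟨(MeasurePreserving.mk hs hl).integrable_comp_of_integrable (h.oracle.integrable_sq z),
    ?_⟩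
  refine le_trans (le_of_eq ?_) (h.oracle.variance_le z)
  rw [← hl, integral_map (f := fun s => ‖Ft z s - F z‖ ^ 2) hs.aemeasurable]
  rw [hl]
  exact (h.oracle.integrable_sq z).aestronglyMeasurable

omit [FiniteDimensional ℝ E] [BorelSpace E] in
-- Cauchy-Schwarz and the Lipschitz bound let `η F` spoil the strong monotonicity of the identity by
-- at most `η L`.
theorem strongMono (x z w : E) :
    (1 - η * L) * ‖z - w‖ ^ 2 ≤ ⟪(z + η • F z - x) - (w + η • F w - x), z - w⟫ := by
  have e : (z + η • F z - x) - (w + η • F w - x) = (z - w) + η • (F z - F w) := by module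
  rw [e, inner_add_left, real_inner_self_eq_norm_sq, real_inner_smul_left]
  have h1 := h.lipschitz.dist_le_mul z w
  rw [dist_eq_norm, dist_eq_norm] at h1
  have h2 := (abs_le.1 (abs_real_inner_le_norm (F z - F w) (z - w))).1
  have h3 : ‖F z - F w‖ * ‖z - w‖ ≤ L * ‖z - w‖ * ‖z - w‖ := by gcongr
  have h4 : η * -(L * ‖z - w‖ * ‖z - w‖) ≤ η * ⟪F z - F w, z - w⟫ :=
    mul_le_mul_of_nonneg_left (by linarith) h.eta_pos.le
  nlinarith

omit [FiniteDimensional ℝ E] [BorelSpace E] in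
theorem lip (x z w : E) :
    ‖(z + η • F z - x) - (w + η • F w - x)‖ ≤ (1 + η * L) * ‖z - w‖ := by
  have e : (z + η • F z - x) - (w + η • F w - x) = (z - w) + η • (F z - F w) := by module
  have h1 := h.lipschitz.dist_le_mul z w
  rw [dist_eq_norm, dist_eq_norm] at h1
  rw [e]
  refine (norm_add_le _ _).trans ?_
  rw [norm_smul, Real.norm_of_nonneg h.eta_pos.le]
  have := mul_le_mul_of_nonneg_left h1 h.eta_pos.le
  linarith

omit [BorelSpace E] in
theorem innerHalf_mem (t : ℕ) (x z : E) (s : Ξ) :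
    innerHalf L η G Ft t x z s ∈ resolventValues (opSmul (innerStep L η t) (opSmul η G))
      (z - innerStep L η t • (z + η • Ft z s - x)) := by
  refine resolventMap_mem ?_
  rw [opSmul_opSmul]
  exact h.maximal.existsUnique_resolvent (mul_pos (h.innerStep_pos t) h.eta_pos) _

omit [BorelSpace E] in
theorem neg_mem_of_resolvent (x : E) :
    -(resolventMap (opSmul η (opAdd F G)) x + η • F (resolventMap (opSmul η (opAdd F G)) x) - x) ∈
      opSmul η G (resolventMap (opSmul η (opAdd F G)) x) := by
  have hm := resolventMap_mem
    (existsUnique_resolvent_opAdd h.lipschitz h.maximal h.eta_pos h.eta_mul_lt x)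
  set y := resolventMap (opSmul η (opAdd F G)) x
  obtain ⟨g, hg, hx⟩ := mem_resolventValues_opAdd.1 hm
  refine ⟨g, hg, ?_⟩
  rw [hx]
  module

/-- Contraction in mean square of one iteration of the inner solver. -/
theorem expectationLE_innerFbf_succ {P : Measure Ω} [IsProbabilityMeasure P] (x : E)
    {s : ℕ → Bool → Ω → Ξ} (hs : ∀ t b, Measurable (s t b)) (hl : ∀ t b, P.map (s t b) = ν)
    (t : ℕ)
    (hi : IndepFun (fun ω => (innerFbf L η G Ft x (fun t b => s t b ω) t).point) (s t false) P)
    (hi' : IndepFun (fun ω => ((innerFbf L η G Ft x (fun t b => s t b ω) t).point, s t false ω))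
      (s t true) P) {v : ℝ}
    (hv : ExpectationLE P (fun ω => ‖(innerFbf L η G Ft x (fun t b => s t b ω) t).point -
      resolventMap (opSmul η (opAdd F G)) x‖ ^ 2) v) :
    ExpectationLE P (fun ω => ‖(innerFbf L η G Ft x (fun t b => s t b ω) (t + 1)).point -
      resolventMap (opSmul η (opAdd F G)) x‖ ^ 2)
      ((1 - innerStep L η t * (1 - η * L)) * v + 3 * innerStep L η t ^ 2 * (η ^ 2 * σ ^ 2)) := by
  set y := resolventMap (opSmul η (opAdd F G)) x with hy
  set τ := innerStep L η t with hτ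
  have hZ : Measurable fun ω => (innerFbf L η G Ft x (fun t b => s t b ω) t).point :=
    h.measurable_innerFbf measurable_const fun t _ b => hs t b
  set Z : Ω → E := fun ω => (innerFbf L η G Ft x (fun t b => s t b ω) t).point with hZdef
  have hηL0 : 0 ≤ η * L := mul_nonneg h.eta_pos.le L.2
  have hηL := h.eta_mul_lt
  have hτ0 : 0 < τ := h.innerStep_pos t
  have hτL : τ * (1 + η * L) ≤ 1 / 3 := h.innerStep_mul_le t
  have hτμ : 0 ≤ 1 - τ * (1 - η * L) := by nlinarith
  have hF : Measurable F := h.lipschitz.continuous.measurable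
  -- noise of the first sample
  have hnoise : ExpectationLE P (fun ω => ‖Ft (Z ω) (s t false ω) - F (Z ω)‖ ^ 2) (σ ^ 2) := by
    have := expectationLE_of_indepFun hi hZ (hs t false)
      (h := fun z s => ‖Ft z s - F z‖ ^ 2) (φ := fun _ => σ ^ 2)
      ((h.oracle.measurable.sub (hF.comp measurable_fst)).norm.pow_const 2)
      (fun _ _ => sq_nonneg _) (fun z => h.expectationLE_seed (hs t false) (hl t false) z)
      (integrable_const _)
    simpa using this
  -- `φ` bounds the conditional expectation over the second seed. The first sample also enters
  -- through the half step, so its noise is bounded by `2 τ²`; the second enters linearly with mean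
  -- zero and adds `τ²`. Together they give the factor 3.
  let φ : E × Ξ → ℝ := fun q => (1 - τ * (1 - η * L)) * ‖q.1 - y‖ ^ 2 +
    2 * τ ^ 2 * (η ^ 2 * ‖Ft q.1 q.2 - F q.1‖ ^ 2) + τ ^ 2 * (η ^ 2 * σ ^ 2)
  have hφ1 : Integrable (fun ω => (1 - τ * (1 - η * L)) * ‖Z ω - y‖ ^ 2) P := hv.1.const_mul _
  have hφ2 : Integrable
      (fun ω => 2 * τ ^ 2 * (η ^ 2 * ‖Ft (Z ω) (s t false ω) - F (Z ω)‖ ^ 2)) P :=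
    (hnoise.1.const_mul _).const_mul _
  have hφ12 : Integrable (fun ω => (1 - τ * (1 - η * L)) * ‖Z ω - y‖ ^ 2 +
      2 * τ ^ 2 * (η ^ 2 * ‖Ft (Z ω) (s t false ω) - F (Z ω)‖ ^ 2)) P := hφ1.add hφ2
  have hφi : Integrable (fun ω => φ (Z ω, s t false ω)) P := hφ12.add (integrable_const _)
  have hφle : ∫ ω, φ (Z ω, s t false ω) ∂P ≤
      (1 - τ * (1 - η * L)) * v + 3 * τ ^ 2 * (η ^ 2 * σ ^ 2) := by
    have e : ∫ ω, φ (Z ω, s t false ω) ∂P = (1 - τ * (1 - η * L)) * ∫ ω, ‖Z ω - y‖ ^ 2 ∂P +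
        2 * τ ^ 2 * (η ^ 2 * ∫ ω, ‖Ft (Z ω) (s t false ω) - F (Z ω)‖ ^ 2 ∂P) +
        τ ^ 2 * (η ^ 2 * σ ^ 2) := by
      simp only [φ]
      rw [integral_add hφ12 (integrable_const _), integral_add hφ1 hφ2,
        integral_const_mul, integral_const_mul, integral_const_mul, integral_const]
      simp
    rw [e]
    have h1 := mul_le_mul_of_nonneg_left hv.2 hτμ
    have h2 : 2 * τ ^ 2 * (η ^ 2 * ∫ ω, ‖Ft (Z ω) (s t false ω) - F (Z ω)‖ ^ 2 ∂P) ≤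
        2 * τ ^ 2 * (η ^ 2 * σ ^ 2) := by
      gcongr
      exact hnoise.2
    linarith
  let zh : E × Ξ → E := fun q => innerHalf L η G Ft t x q.1 q.2
  have hzh : Measurable zh := h.measurable_innerHalf t measurable_const measurable_fst measurable_snd
  let H : E × Ξ → Ξ → ℝ := fun q s' =>
    ‖zh q + τ • (q.1 + η • Ft q.1 q.2 - x) - τ • (zh q + η • Ft (zh q) s' - x) - y‖ ^ 2
  have hHm : Measurable (Function.uncurry H) := by
    have m1 : Measurable fun p : (E × Ξ) × Ξ => zh p.1 := hzh.comp measurable_fst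
    have m2 : Measurable fun p : (E × Ξ) × Ξ => Ft p.1.1 p.1.2 :=
      h.oracle.measurable.comp measurable_fst
    have m3 : Measurable fun p : (E × Ξ) × Ξ => Ft (zh p.1) p.2 :=
      h.oracle.measurable.comp (m1.prodMk measurable_snd)
    have m4 : Measurable fun p : (E × Ξ) × Ξ => p.1.1 := measurable_fst.comp measurable_fst
    exact ((((m1.add (((m4.add (m2.const_smul η)).sub_const x).const_smul τ)).sub
      (((m1.add (m3.const_smul η)).sub_const x).const_smul τ)).sub_const y).norm).pow_const 2
  have key := expectationLE_of_indepFun hi' (hZ.prodMk (hs t false)) (hs t true) hHm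
    (fun _ _ => sq_nonneg _) (φ := φ) (fun q => ?_) hφi
  · exact key.mono hφle
  set a : E := zh q + τ • (q.1 + η • Ft q.1 q.2 - x) - τ • (zh q + η • F (zh q) - x) - y with ha
  have hint : Integrable (fun ω => Ft (zh q) (s t true ω)) P :=
    h.integrable_seed (hs t true) (hl t true) _
  have hmean : ∫ ω, (Ft (zh q) (s t true ω) - F (zh q)) ∂P = 0 := by
    rw [integral_sub hint (integrable_const _), h.integral_seed (hs t true) (hl t true)]
    simp
  have h1 := expectationLE_norm_add_smul_sq (hint.sub (integrable_const (F (zh q))))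
    (h.expectationLE_seed (hs t true) (hl t true) (zh q)) a (-(τ * η))
  simp only [Pi.sub_apply, hmean, inner_zero_right, mul_zero, add_zero] at h1
  have e : (fun ω => H q (s t true ω)) =
      fun ω => ‖a + -(τ * η) • (Ft (zh q) (s t true ω) - F (zh q))‖ ^ 2 := by
    funext ω
    simp only [H, ha]
    congr 2
    module
  rw [e]
  refine h1.mono ?_
  have h2 := fbf_step_sq_le (h.maximal.1.smul h.eta_pos.le) (h.strongMono x) (h.lip x) hτ0
    (by linarith) (by linarith) hτL (h.innerHalf_mem t x q.1 q.2) (h.neg_mem_of_resolvent x)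
  have e2 : q.1 + η • Ft q.1 q.2 - x - (q.1 + η • F q.1 - x) = η • (Ft q.1 q.2 - F q.1) := by
    module
  rw [e2, norm_smul, mul_pow, Real.norm_eq_abs, sq_abs] at h2
  simp only [φ]
  have h3 : (-(τ * η)) ^ 2 * σ ^ 2 = τ ^ 2 * (η ^ 2 * σ ^ 2) := by ring
  rw [h3]
  linarith

/-- Mean square error of the inner solver. -/
theorem expectationLE_innerFbf {P : Measure Ω} [IsProbabilityMeasure P] (x : E)
    {s : ℕ → Bool → Ω → Ξ} (hs : ∀ t b, Measurable (s t b)) (hl : ∀ t b, P.map (s t b) = ν)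
    (hi : ∀ t, IndepFun (fun ω => (innerFbf L η G Ft x (fun t b => s t b ω) t).point)
      (s t false) P)
    (hi' : ∀ t, IndepFun (fun ω => ((innerFbf L η G Ft x (fun t b => s t b ω) t).point,
      s t false ω)) (s t true) P) {T : ℕ} (hT : 1 ≤ T) :
    ExpectationLE P (fun ω => ‖(innerFbf L η G Ft x (fun t b => s t b ω) T).point -
      resolventMap (opSmul η (opAdd F G)) x‖ ^ 2)
      (12 * ((1 - η * L) ^ 2)⁻¹ *
        (‖x - resolventMap (opSmul η (opAdd F G)) x‖ ^ 2 + η ^ 2 * σ ^ 2) / T) := by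
  set y := resolventMap (opSmul η (opAdd F G)) x with hy
  have hηL0 : 0 ≤ η * L := mul_nonneg h.eta_pos.le L.2
  have hηL := h.eta_mul_lt
  set μ : ℝ := 1 - η * L with hμ
  have hμ0 : 0 < μ := by linarith
  have hμ1 : μ ≤ 1 := by linarith
  set c : ℝ := 6 * (1 + η * L) / μ with hc
  have hc6 : 6 ≤ c := by rw [hc, le_div_iff₀ hμ0]; linarith
  have hc12 : c ≤ 12 * (μ ^ 2)⁻¹ := by
    rw [hc, div_eq_mul_inv, pow_two, mul_inv, ← mul_assoc]
    refine mul_le_mul_of_nonneg_right ?_ (inv_nonneg.2 hμ0.le)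
    have : 1 ≤ μ⁻¹ := (one_le_inv₀ hμ0).2 hμ1
    linarith
  set R : ℝ := ‖x - y‖ ^ 2 with hR
  set V : ℝ := η ^ 2 * σ ^ 2 with hV
  have hR0 : 0 ≤ R := sq_nonneg _
  have hV0 : 0 ≤ V := by positivity
  have hstep : ∀ t : ℕ, innerStep L η t = 2 / (μ * (t + 1 + c)) := by
    intro t
    rw [innerStep, hc, ← hμ]
    congr 1
    field_simp
  -- Here `τ_t μ = 2 / (t + 1 + c)`, so the contraction factor is `(t + c - 1) / (t + c + 1)`. After
  -- multiplication by `(t + c) (t + c + 1)` the recursion telescopes, each step adding at most `12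
  -- μ⁻² V`.
  have main : ∀ t : ℕ, ExpectationLE P
      (fun ω => ‖(innerFbf L η G Ft x (fun t b => s t b ω) t).point - y‖ ^ 2)
      ((c * (c - 1) * R + 12 * (μ ^ 2)⁻¹ * V * t) / ((t + c - 1) * (t + c))) := by
    intro t
    induction t with
    | zero =>
      have e : (c * (c - 1) * R + 12 * (μ ^ 2)⁻¹ * V * (0 : ℕ)) /
          (((0 : ℕ) + c - 1) * ((0 : ℕ) + c)) = R := by
        have : c - 1 ≠ 0 := by linarith
        have : c ≠ 0 := by linarith
        push_cast
        rw [zero_add, mul_zero, add_zero]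
        field_simp
      rw [e]
      change ExpectationLE P (fun _ => ‖x - y‖ ^ 2) R
      refine ⟨integrable_const _, ?_⟩
      rw [integral_const, probReal_univ, one_smul]
    | succ t ih =>
      refine (h.expectationLE_innerFbf_succ x hs hl t (hi t) (hi' t) ih).mono ?_
      rw [hstep t, ← hμ, ← hV]
      set S : ℝ := (t : ℝ) + c with hS
      have hS6 : 6 ≤ S := by have : (0 : ℝ) ≤ t := t.cast_nonneg; linarith
      have e1 : (t : ℝ) + 1 + c = S + 1 := by rw [hS]; ring
      have e2 : ((t + 1 : ℕ) : ℝ) + c = S + 1 := by push_cast; rw [hS]; ring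
      rw [e1, e2, show S + 1 - 1 = S by ring]
      have hS0 : S ≠ 0 := by linarith
      have hS1 : S + 1 ≠ 0 := by linarith
      have hSm : S - 1 ≠ 0 := by linarith
      push_cast
      have e3 : (1 - 2 / (μ * (S + 1)) * μ) *
          ((c * (c - 1) * R + 12 * (μ ^ 2)⁻¹ * V * t) / ((S - 1) * S)) =
          (c * (c - 1) * R + 12 * (μ ^ 2)⁻¹ * V * t) / (S * (S + 1)) := by
        field_simp
        ring
      have e5 : c * (c - 1) * R + 12 * (μ ^ 2)⁻¹ * V * (t + 1) =
          c * (c - 1) * R + 12 * (μ ^ 2)⁻¹ * V * t + 12 * (μ ^ 2)⁻¹ * V := by ring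
      rw [e3, e5, add_div (c * (c - 1) * R + 12 * (μ ^ 2)⁻¹ * V * t)]
      refine add_le_add le_rfl ?_
      have e4 : 3 * (2 / (μ * (S + 1))) ^ 2 * V = 12 * (μ ^ 2)⁻¹ * V / ((S + 1) * (S + 1)) := by
        field_simp
        ring
      rw [e4]
      gcongr
      linarith
  refine (main T).mono ?_
  have hT1 : (1 : ℝ) ≤ T := by exact_mod_cast hT
  rw [div_le_div_iff₀ (by nlinarith) (by linarith)]
  have a1 : c * (c - 1) * R * T ≤ 12 * (μ ^ 2)⁻¹ * R * ((T + c - 1) * (T + c)) := by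
    have b1 : (c - 1) * (T : ℝ) ≤ (T + c - 1) * (T + c) := by nlinarith
    have b2 : c * R ≤ 12 * (μ ^ 2)⁻¹ * R := mul_le_mul_of_nonneg_right hc12 hR0
    calc c * (c - 1) * R * T = c * R * ((c - 1) * T) := by ring
      _ ≤ 12 * (μ ^ 2)⁻¹ * R * ((T + c - 1) * (T + c)) := by
        gcongr
        nlinarith
  have a2 : 12 * (μ ^ 2)⁻¹ * V * T * T ≤ 12 * (μ ^ 2)⁻¹ * V * ((T + c - 1) * (T + c)) := by
    rw [mul_assoc _ (T : ℝ)]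
    gcongr <;> linarith
  nlinarith

end InnerProblem

end ForwardBackwardForward

-- Bias and second moments of averages and of the multilevel estimator.

section MeanSquare

variable {E : Type*} [NormedAddCommGroup E] [InnerProductSpace ℝ E] [FiniteDimensional ℝ E]
  [MeasurableSpace E] [BorelSpace E] {Ω : Type*} [MeasurableSpace Ω] {P : Measure Ω}
  [IsProbabilityMeasure P]

omit [InnerProductSpace ℝ E] [FiniteDimensional ℝ E] [MeasurableSpace E] [BorelSpace E] in
theorem norm_add_sq_le_two_mul (a b : E) : ‖a + b‖ ^ 2 ≤ 2 * ‖a‖ ^ 2 + 2 * ‖b‖ ^ 2 := by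
  have h := norm_add_le a b
  have h2 : ‖a + b‖ ^ 2 ≤ (‖a‖ + ‖b‖) ^ 2 := by gcongr
  nlinarith [sq_nonneg (‖a‖ - ‖b‖)]

theorem integrable_of_integrable_norm_sub_sq {X : Ω → E} (hX : Measurable X) {y : E}
    (h : Integrable (fun ω => ‖X ω - y‖ ^ 2) P) : Integrable X P := by
  have h1 : Integrable (fun ω => X ω - y) P := by
    refine Integrable.mono' ((integrable_const (1 : ℝ)).add h)
      (hX.sub_const y).aestronglyMeasurable (Filter.Eventually.of_forall fun ω => ?_)
    simp only [Pi.add_apply]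
    nlinarith [sq_nonneg (‖X ω - y‖ - 1 / 2)]
  have e : X = fun ω => X ω - y + y := by
    funext ω
    rw [sub_add_cancel]
  rw [e]
  exact h1.add (integrable_const y)

omit [MeasurableSpace E] [BorelSpace E] in
-- Jensen's inequality, read off from `0 ≤ 𝔼‖X - 𝔼X‖² ≤ v - ‖𝔼X - y‖²`.
theorem norm_integral_sub_sq_le {X : Ω → E} (hX : Integrable X P) {y : E} {v : ℝ}
    (h : ExpectationLE P (fun ω => ‖X ω - y‖ ^ 2) v) : ‖∫ ω, X ω ∂P - y‖ ^ 2 ≤ v := by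
  have hm : ∫ ω, (X ω - y) ∂P = ∫ ω, X ω ∂P - y := by
    rw [integral_sub hX (integrable_const _)]
    simp
  have h1 := expectationLE_norm_add_smul_sq (hX.sub (integrable_const y)) h
    (-(∫ ω, X ω ∂P - y)) 1
  have h2 : (0 : ℝ) ≤ ∫ ω, ‖-(∫ ω, X ω ∂P - y) + (1 : ℝ) • (X ω - y)‖ ^ 2 ∂P :=
    integral_nonneg fun ω => sq_nonneg _
  have h3 := h2.trans h1.2
  simp only [Pi.sub_apply, hm] at h3
  rw [inner_neg_left, real_inner_self_eq_norm_sq, norm_neg] at h3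
  linarith

omit [MeasurableSpace E] [BorelSpace E] in
theorem expectationLE_norm_sub_integral_sq {X : Ω → E} (hX : Integrable X P) {y : E} {v : ℝ}
    (h : ExpectationLE P (fun ω => ‖X ω - y‖ ^ 2) v) :
    ExpectationLE P (fun ω => ‖X ω - ∫ ω', X ω' ∂P‖ ^ 2) v := by
  have hm : ∫ ω, (X ω - y) ∂P = ∫ ω, X ω ∂P - y := by
    rw [integral_sub hX (integrable_const _)]
    simp
  have h1 := expectationLE_norm_add_smul_sq (hX.sub (integrable_const y)) h
    (-(∫ ω, X ω ∂P - y)) 1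
  simp only [Pi.sub_apply, hm, inner_neg_left, real_inner_self_eq_norm_sq, norm_neg] at h1
  have e : (fun ω => ‖-(∫ ω, X ω ∂P - y) + (1 : ℝ) • (X ω - y)‖ ^ 2) =
      fun ω => ‖X ω - ∫ ω', X ω' ∂P‖ ^ 2 := by
    funext ω
    congr 2
    module
  rw [e] at h1
  exact h1.mono (by nlinarith [sq_nonneg ‖∫ ω, X ω ∂P - y‖])

omit [IsProbabilityMeasure P] in
theorem integral_inner_eq_zero_of_indepFun {X Y : Ω → E} (h : IndepFun X Y P)
    (hX : Integrable X P) (hY : Integrable Y P) (h0 : ∫ ω, Y ω ∂P = 0) :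
    Integrable (fun ω => ⟪X ω, Y ω⟫) P ∧ ∫ ω, ⟪X ω, Y ω⟫ ∂P = 0 := by
  refine ⟨h.integrable_bilin hX hY (innerSL ℝ), ?_⟩
  have := h.integral_bilin hX hY (innerSL ℝ)
  rw [h0, map_zero] at this
  exact this

/-- Second moment of a sum of pairwise independent centred vectors. -/
theorem expectationLE_norm_sum_sq {W : ℕ → Ω → E} (hW : ∀ m, Integrable (W m) P)
    (h0 : ∀ m, ∫ ω, W m ω ∂P = 0) {v : ℝ} (h2 : ∀ m, ExpectationLE P (fun ω => ‖W m ω‖ ^ 2) v)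
    (hi : ∀ m n, m ≠ n → IndepFun (W m) (W n) P) (M : ℕ) :
    ExpectationLE P (fun ω => ‖∑ m ∈ Finset.range M, W m ω‖ ^ 2) (M * v) := by
  induction M with
  | zero => simp [ExpectationLE]
  | succ n ih =>
    have e : (fun ω => ‖∑ m ∈ Finset.range (n + 1), W m ω‖ ^ 2) =
        fun ω => ‖∑ m ∈ Finset.range n, W m ω‖ ^ 2 +
          2 * ∑ m ∈ Finset.range n, ⟪W m ω, W n ω⟫ + ‖W n ω‖ ^ 2 := by
      funext ω
      rw [Finset.sum_range_succ, norm_add_sq_real, sum_inner]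
    have hin : ∀ m ∈ Finset.range n, Integrable (fun ω => ⟪W m ω, W n ω⟫) P ∧
        ∫ ω, ⟪W m ω, W n ω⟫ ∂P = 0 := fun m hm =>
      integral_inner_eq_zero_of_indepFun (hi m n (Finset.mem_range.1 hm).ne) (hW m) (hW n) (h0 n)
    have hsum : Integrable (fun ω => 2 * ∑ m ∈ Finset.range n, ⟪W m ω, W n ω⟫) P :=
      (integrable_finsetSum _ fun m hm => (hin m hm).1).const_mul _
    have h12 : Integrable (fun ω => ‖∑ m ∈ Finset.range n, W m ω‖ ^ 2 +
      2 * ∑ m ∈ Finset.range n, ⟪W m ω, W n ω⟫) P := ih.1.add hsum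
    rw [e]
    refine ⟨h12.add (h2 n).1, ?_⟩
    rw [integral_add h12 (h2 n).1, integral_add ih.1 hsum, integral_const_mul,
      integral_finsetSum _ fun m hm => (hin m hm).1,
      Finset.sum_eq_zero fun m hm => (hin m hm).2]
    push_cast
    linarith [ih.2, (h2 n).2]

/-- Bias and second moment of an average of pairwise independent estimators. -/
theorem average_estimator {V : ℕ → Ω → E} (hV : ∀ m, Integrable (V m) P)
    (hi : ∀ m n, m ≠ n → IndepFun (V m) (V n) P) {y : E} {b v : ℝ}
    (hb : ∀ m, ‖∫ ω, V m ω ∂P - y‖ ≤ b)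
    (hv : ∀ m, ExpectationLE P (fun ω => ‖V m ω - y‖ ^ 2) v) {M : ℕ} (hM : 0 < M) :
    Integrable (fun ω => (M : ℝ)⁻¹ • ∑ m ∈ Finset.range M, V m ω) P ∧
      ‖∫ ω, (M : ℝ)⁻¹ • ∑ m ∈ Finset.range M, V m ω ∂P - y‖ ≤ b ∧
      ExpectationLE P (fun ω => ‖(M : ℝ)⁻¹ • ∑ m ∈ Finset.range M, V m ω - y‖ ^ 2)
        (b ^ 2 + v / M) := by
  have hM0 : (M : ℝ) ≠ 0 := by positivity
  have hint : Integrable (fun ω => (M : ℝ)⁻¹ • ∑ m ∈ Finset.range M, V m ω) P :=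
    (integrable_finsetSum _ fun m _ => hV m).smul _
  -- `c` is the bias of the average; the remainder is an average of centred independent terms.
  -- Averaging divides the variance by `M` but leaves the bound on the bias.
  set c : E := (M : ℝ)⁻¹ • ∑ m ∈ Finset.range M, (∫ ω, V m ω ∂P - y) with hc
  have hcb : ‖c‖ ≤ b := by
    rw [hc, norm_smul, norm_inv, RCLike.norm_natCast, inv_mul_le_iff₀ (by positivity)]
    refine (norm_sum_le_of_le _ fun m _ => hb m).trans ?_
    simp
  have hmean : ∫ ω, (M : ℝ)⁻¹ • ∑ m ∈ Finset.range M, V m ω ∂P - y = c := by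
    rw [integral_smul, integral_finsetSum _ fun m _ => hV m, hc, Finset.sum_sub_distrib, smul_sub,
      Finset.sum_const, Finset.card_range, ← Nat.cast_smul_eq_nsmul ℝ, smul_smul,
      inv_mul_cancel₀ hM0, one_smul]
  refine ⟨hint, hmean ▸ hcb, ?_⟩
  let W : ℕ → Ω → E := fun m ω => V m ω - ∫ ω', V m ω' ∂P
  have hW : ∀ m, Integrable (W m) P := fun m => (hV m).sub (integrable_const _)
  have hW0 : ∀ m, ∫ ω, W m ω ∂P = 0 := fun m => by
    simp only [W]
    rw [integral_sub (hV m) (integrable_const _)]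
    simp
  have hsum := expectationLE_norm_sum_sq hW hW0
    (fun m => expectationLE_norm_sub_integral_sq (hV m) (hv m))
    (fun m n hmn => (hi m n hmn).comp (measurable_id.sub_const _) (measurable_id.sub_const _)) M
  have hWs : Integrable (fun ω => ∑ m ∈ Finset.range M, W m ω) P :=
    integrable_finsetSum _ fun m _ => hW m
  have h1 := expectationLE_norm_add_smul_sq hWs hsum c (M : ℝ)⁻¹
  rw [integral_finsetSum _ fun m _ => hW m, Finset.sum_eq_zero fun m _ => hW0 m,
    inner_zero_right, mul_zero, add_zero] at h1
  have e : (fun ω => ‖c + (M : ℝ)⁻¹ • ∑ m ∈ Finset.range M, W m ω‖ ^ 2) =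
      fun ω => ‖(M : ℝ)⁻¹ • ∑ m ∈ Finset.range M, V m ω - y‖ ^ 2 := by
    funext ω
    congr 2
    rw [hc, ← smul_add, ← Finset.sum_add_distrib]
    have e1 : ∀ m, ∫ ω, V m ω ∂P - y + W m ω = V m ω - y := fun m => by
      simp only [W]
      abel
    simp only [e1]
    rw [Finset.sum_sub_distrib, smul_sub, Finset.sum_const, Finset.card_range,
      ← Nat.cast_smul_eq_nsmul ℝ, smul_smul, inv_mul_cancel₀ hM0, one_smul]
  rw [e] at h1
  refine h1.mono ?_
  have h2 : ‖c‖ ^ 2 ≤ b ^ 2 := by gcongr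
  have h3 : (M : ℝ)⁻¹ ^ 2 * (M * v) = v / M := by field_simp
  linarith

/-- Bias and second moment of the multilevel estimator. -/
theorem multilevel_estimator {Y : ℕ → Ω → E} (hY : ∀ i, Measurable (Y i)) {J : Ω → ℕ}
    (hJ : Measurable J) (hlaw : ∀ i : ℕ, P {ω | J ω = i + 1} = (1 / 2) ^ (i + 1))
    (hi : ∀ i, IndepFun J (fun ω => Y (i + 1) ω - Y i ω) P) {y : E} {B : ℝ}
    (hv : ∀ i, ExpectationLE P (fun ω => ‖Y i ω - y‖ ^ 2) (B / 2 ^ i)) {N : ℕ} (hN : N ≠ 0) :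
    Integrable (fun ω => if 2 ^ J ω ≤ N then
        Y 0 ω + (2 ^ J ω : ℝ) • (Y (J ω) ω - Y (J ω - 1) ω) else Y 0 ω) P ∧
      ‖∫ ω, (if 2 ^ J ω ≤ N then
        Y 0 ω + (2 ^ J ω : ℝ) • (Y (J ω) ω - Y (J ω - 1) ω) else Y 0 ω) ∂P - y‖ ^ 2 ≤
          B / 2 ^ Nat.log 2 N ∧
      ExpectationLE P (fun ω => ‖(if 2 ^ J ω ≤ N then
        Y 0 ω + (2 ^ J ω : ℝ) • (Y (J ω) ω - Y (J ω - 1) ω) else Y 0 ω) - y‖ ^ 2)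
          ((2 + 12 * Nat.log 2 N) * B) := by
  classical
  set n := Nat.log 2 N with hn
  set D : ℕ → Ω → E := fun i ω => Y (i + 1) ω - Y i ω with hD
  have hpow : ∀ j, 2 ^ j ≤ N ↔ j ≤ n := fun j => (Nat.le_log_iff_pow_le (by norm_num) hN).symm
  set A : ℕ → Set Ω := fun i => {ω | J ω = i + 1} with hA
  have hAm : ∀ i, MeasurableSet (A i) := fun i => hJ (measurableSet_singleton (i + 1))
  have hAP : ∀ i, P.real (A i) = (1 / 2) ^ (i + 1) := fun i => by
    rw [Measure.real, hlaw i]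
    simp
  have hYi : ∀ i, Integrable (Y i) P := fun i => integrable_of_integrable_norm_sub_sq (hY i) (hv i).1
  have hDi : ∀ i, Integrable (D i) P := fun i => (hYi (i + 1)).sub (hYi i)
  have hDm : ∀ i, Measurable (D i) := fun i => (hY (i + 1)).sub (hY i)
  have hAD : ∀ i, Indep (MeasurableSpace.comap J inferInstance)
      (MeasurableSpace.comap (D i) inferInstance) P := fun i => (IndepFun_iff_Indep _ _ _).1 (hi i)
  have hAJ : ∀ i, MeasurableSet[MeasurableSpace.comap J inferInstance] (A i) :=
    fun i => ⟨{i + 1}, measurableSet_singleton _, rfl⟩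
  set V : Ω → E := fun ω => if 2 ^ J ω ≤ N then
        Y 0 ω + (2 ^ J ω : ℝ) • (Y (J ω) ω - Y (J ω - 1) ω) else Y 0 ω with hVdef
  have hVcase : ∀ ω, V ω = Y 0 ω ∨ ∃ j < n, ω ∈ A j ∧ V ω = Y 0 ω + (2 ^ (j + 1) : ℝ) • D j ω := by
    intro ω
    simp only [hVdef, hpow]
    -- The value `J ω = 0` has probability zero but is not excluded pointwise; truncated subtraction
    -- then makes the correction vanish.
    rcases hJω : J ω with _ | j
    · left; simp
    · by_cases hj : j + 1 ≤ n
      · right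
        exact ⟨j, hj, hJω, by simp [hj, hD]⟩
      · left; simp [hj]
  have hVsum : ∀ ω, V ω = Y 0 ω +
      ∑ i ∈ Finset.range n, (A i).indicator (fun ω => (2 ^ (i + 1) : ℝ) • D i ω) ω := by
    intro ω
    simp only [hVdef, hpow]
    rcases hJω : J ω with _ | j
    · rw [Finset.sum_eq_zero]
      · simp
      · intro i _
        exact Set.indicator_of_notMem (by simp [hA, hJω]) _
    · have h1 : ∀ i ∈ Finset.range n, i ≠ j →
          (A i).indicator (fun ω => (2 ^ (i + 1) : ℝ) • D i ω) ω = 0 := fun i _ hij =>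
        Set.indicator_of_notMem (by simpa [hA, hJω] using Ne.symm hij) _
      by_cases hj : j + 1 ≤ n
      · rw [Finset.sum_eq_single_of_mem j (Finset.mem_range.2 hj) h1,
          Set.indicator_of_mem (show ω ∈ A j from hJω)]
        simp [hj, hD]
      · rw [Finset.sum_eq_zero]
        · simp [hj]
        · intro i hi'
          exact h1 i hi' (by rintro rfl; exact hj (Finset.mem_range.1 hi'))
  have hterm : ∀ i, Integrable ((A i).indicator fun ω => (2 ^ (i + 1) : ℝ) • D i ω) P :=
    fun i => ((hDi i).smul _).indicator (hAm i)
  have hVeq : V = fun ω => Y 0 ω +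
      ∑ i ∈ Finset.range n, (A i).indicator (fun ω => (2 ^ (i + 1) : ℝ) • D i ω) ω := funext hVsum
  have hVint : Integrable V P := by
    rw [hVeq]
    exact (hYi 0).add (integrable_finsetSum _ fun i _ => hterm i)
  refine ⟨hVint, ?_, ?_⟩
  -- The weight `2 ^ (i + 1)` cancels the probability of level `i + 1`, so the mean telescopes to
  -- that of `Y n`: the bias is that of the longest permitted run.
  · have hmean : ∫ ω, V ω ∂P = ∫ ω, Y n ω ∂P := by
      rw [hVeq, integral_add (hYi 0) (integrable_finsetSum _ fun i _ => hterm i),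
        integral_finsetSum _ fun i _ => hterm i]
      have h1 : ∀ i ∈ Finset.range n,
          ∫ ω, (A i).indicator (fun ω => (2 ^ (i + 1) : ℝ) • D i ω) ω ∂P =
            ∫ ω, Y (i + 1) ω ∂P - ∫ ω, Y i ω ∂P := by
        intro i _
        have h2 := Indep.setIntegral_eq_smul (X := D i) (f := id) hJ.comap_le (hAD i)
          (hDm i).aemeasurable (hAJ i) measurable_id.aestronglyMeasurable
        simp only [id] at h2
        rw [integral_indicator (hAm i), integral_smul, h2, hAP i, smul_smul,
          ← mul_pow]
        norm_num
        exact integral_sub (hYi _) (hYi _)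
      rw [Finset.sum_congr rfl h1, Finset.sum_range_sub (fun i => ∫ ω, Y i ω ∂P)]
      abel
    rw [hmean]
    exact norm_integral_sub_sq_le (hYi n) (hv n)
  · have hD2 : ∀ i, ExpectationLE P (fun ω => ‖D i ω‖ ^ 2) (6 * B / 2 ^ (i + 1)) := by
      intro i
      have hb : Integrable (fun ω => 2 * ‖Y (i + 1) ω - y‖ ^ 2 + 2 * ‖Y i ω - y‖ ^ 2) P :=
        ((hv (i + 1)).1.const_mul 2).add ((hv i).1.const_mul 2)
      have hle : ∀ ω, ‖D i ω‖ ^ 2 ≤ 2 * ‖Y (i + 1) ω - y‖ ^ 2 + 2 * ‖Y i ω - y‖ ^ 2 := by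
        intro ω
        have := norm_add_sq_le_two_mul (Y (i + 1) ω - y) (-(Y i ω - y))
        rw [norm_neg] at this
        have e : D i ω = Y (i + 1) ω - y + -(Y i ω - y) := by simp only [hD]; abel
        rwa [e]
      have hint : Integrable (fun ω => ‖D i ω‖ ^ 2) P :=
        Integrable.mono' hb ((hDm i).norm.pow_const 2).aestronglyMeasurable
          (Filter.Eventually.of_forall fun ω => by
            rw [Real.norm_of_nonneg (sq_nonneg _)]
            exact hle ω)
      refine ⟨hint, (integral_mono hint hb hle).trans ?_⟩
      rw [integral_add ((hv (i + 1)).1.const_mul 2) ((hv i).1.const_mul 2), integral_const_mul,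
        integral_const_mul]
      have e : 6 * B / 2 ^ (i + 1) = 2 * (B / 2 ^ (i + 1)) + 2 * (B / 2 ^ i) := by
        rw [pow_succ]
        field_simp
        ring
      rw [e]
      linarith [(hv (i + 1)).2, (hv i).2]
    have hq : ∀ i, Integrable
        ((A i).indicator fun ω => 2 * (2 ^ (i + 1)) ^ 2 * ‖D i ω‖ ^ 2) P :=
      fun i => ((hD2 i).1.const_mul _).indicator (hAm i)
    -- Squared weight, probability and the decay of `𝔼‖D i‖²` cancel: every level contributes at
    -- most `12 * B`, whence linear growth in `n`.
    have hqle : ∀ i, ∫ ω, (A i).indicator (fun ω => 2 * (2 ^ (i + 1)) ^ 2 * ‖D i ω‖ ^ 2) ω ∂P ≤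
        12 * B := by
      intro i
      rw [integral_indicator (hAm i), integral_const_mul,
        Indep.setIntegral_eq_mul (X := D i) (f := fun d => ‖d‖ ^ 2) hJ.comap_le (hAD i)
          (hDm i).aemeasurable (hAJ i) (measurable_norm.pow_const 2).aestronglyMeasurable, hAP i]
      have h1 : (2 : ℝ) * (2 ^ (i + 1)) ^ 2 * ((1 / 2) ^ (i + 1) * ∫ ω, ‖D i ω‖ ^ 2 ∂P) =
          2 * 2 ^ (i + 1) * ∫ ω, ‖D i ω‖ ^ 2 ∂P := by
        rw [one_div, inv_pow]
        field_simp
      have h2 : (2 : ℝ) * 2 ^ (i + 1) * ∫ ω, ‖D i ω‖ ^ 2 ∂P ≤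
          2 * 2 ^ (i + 1) * (6 * B / 2 ^ (i + 1)) := by
        gcongr
        exact (hD2 i).2
      have h3 : (2 : ℝ) * 2 ^ (i + 1) * (6 * B / 2 ^ (i + 1)) = 12 * B := by
        field_simp
        ring
      linarith
    have hbi : Integrable (fun ω => 2 * ‖Y 0 ω - y‖ ^ 2 + ∑ i ∈ Finset.range n,
        (A i).indicator (fun ω => 2 * (2 ^ (i + 1)) ^ 2 * ‖D i ω‖ ^ 2) ω) P :=
      ((hv 0).1.const_mul 2).add (integrable_finsetSum _ fun i _ => hq i)
    have hnn : ∀ i ω, 0 ≤ (A i).indicator (fun ω => 2 * (2 ^ (i + 1)) ^ 2 * ‖D i ω‖ ^ 2) ω :=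
      fun i ω => Set.indicator_nonneg (fun ω _ => by positivity) ω
    -- `Y 0` need not be independent of the correction, so the square is split with a factor 2; at
    -- most one indicator is nonzero.
    have hle : ∀ ω, ‖V ω - y‖ ^ 2 ≤ 2 * ‖Y 0 ω - y‖ ^ 2 + ∑ i ∈ Finset.range n,
        (A i).indicator (fun ω => 2 * (2 ^ (i + 1)) ^ 2 * ‖D i ω‖ ^ 2) ω := by
      intro ω
      rcases hVcase ω with h | ⟨j, hj, hω, h⟩
      · rw [h]
        have := Finset.sum_nonneg fun i (_ : i ∈ Finset.range n) => hnn i ω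
        nlinarith [sq_nonneg ‖Y 0 ω - y‖]
      · have h1 := Finset.single_le_sum (fun i _ => hnn i ω) (Finset.mem_range.2 hj)
        rw [Set.indicator_of_mem hω] at h1
        have h2 := norm_add_sq_le_two_mul (Y 0 ω - y) ((2 ^ (j + 1) : ℝ) • D j ω)
        rw [norm_smul, mul_pow, Real.norm_of_nonneg (by positivity), ← mul_assoc] at h2
        rw [h, add_sub_right_comm]
        linarith
    have hVm : AEStronglyMeasurable (fun ω => ‖V ω - y‖ ^ 2) P :=
      (hVint.aestronglyMeasurable.sub aestronglyMeasurable_const).norm.pow 2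
    have hVi2 : Integrable (fun ω => ‖V ω - y‖ ^ 2) P :=
      Integrable.mono' hbi hVm (Filter.Eventually.of_forall fun ω => by
        rw [Real.norm_of_nonneg (sq_nonneg _)]
        exact hle ω)
    refine ⟨hVi2, (integral_mono hVi2 hbi hle).trans ?_⟩
    rw [integral_add ((hv 0).1.const_mul 2) (integrable_finsetSum _ fun i _ => hq i),
      integral_const_mul, integral_finsetSum _ fun i _ => hq i]
    have h1 := Finset.sum_le_sum fun i (_ : i ∈ Finset.range n) => hqle i
    rw [Finset.sum_const, Finset.card_range, nsmul_eq_mul] at h1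
    have h2 := (hv 0).2
    rw [pow_zero, div_one] at h2
    linarith

end MeanSquare

-- Consequences of the choice of `α_k`, `N_k` and `M_k`.

section StepSizes

variable {η ρ : ℝ}

theorem relax_pos (hρη : ρ < η) (hη : 0 < η) : 0 < relax η ρ := by
  rw [relax, sub_pos, div_lt_one hη]
  exact hρη

theorem one_lt_log_add_three (k : ℕ) : 1 < Real.log ((k : ℝ) + 3) := by
  rw [Real.lt_log_iff_exp_lt (by positivity)]
  have h1 := Real.exp_one_lt_d9
  have h2 : (0 : ℝ) ≤ k := k.cast_nonneg
  linarith

theorem one_lt_sqrt_add_two (k : ℕ) : 1 < √((k : ℝ) + 2) := by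
  rw [Real.lt_sqrt zero_le_one]
  have h2 : (0 : ℝ) ≤ k := k.cast_nonneg
  linarith

theorem stepSize_pos (hρη : ρ < η) (hη : 0 < η) (k : ℕ) : 0 < stepSize η ρ k :=
  div_pos (relax_pos hρη hη) (mul_pos (zero_lt_one.trans (one_lt_sqrt_add_two k))
    (zero_lt_one.trans (one_lt_log_add_three k)))

theorem stepSize_le (hρη : ρ < η) (hη : 0 < η) (k : ℕ) : stepSize η ρ k ≤ relax η ρ :=
  div_le_self (relax_pos hρη hη).le
    (one_le_mul_of_one_le_of_one_le (one_lt_sqrt_add_two k).le (one_lt_log_add_three k).le)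

/-- The relative weight `α_k / (α (k + 1))`, which is summable. -/
def driftWeight (k : ℕ) : ℝ :=
  1 / (((k : ℝ) + 1) * (√((k : ℝ) + 2) * Real.log ((k : ℝ) + 3)))

theorem driftWeight_pos (k : ℕ) : 0 < driftWeight k := by
  have h1 := one_lt_log_add_three k
  have h2 := one_lt_sqrt_add_two k
  unfold driftWeight
  positivity

theorem stepSize_eq_driftWeight (k : ℕ) :
    stepSize η ρ k = driftWeight k * (relax η ρ * ((k : ℝ) + 1)) := by
  have h1 := one_lt_log_add_three k
  have h2 := one_lt_sqrt_add_two k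
  rw [stepSize, driftWeight]
  field_simp

/-- The factor `α` cancels. Hence `N_k` and `M_k` are independent of `ρ`, and the cost constant can
depend on `η` and `L` only. -/
theorem levelCap_eq (L : ℝ) (hρη : ρ < η) (hη : 0 < η) (k : ℕ) :
    levelCap L η ρ k = ⌈96 * ((1 - η * L) ^ 2)⁻¹ / min (driftWeight k / 120) (1 / 120)⌉₊ := by
  have h := relax_pos hρη hη
  have e : stepSize η ρ k / (120 * relax η ρ * ((k : ℝ) + 1)) = driftWeight k / 120 := by
    rw [stepSize_eq_driftWeight]
    field_simp
  rw [levelCap, e]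

variable {L : ℝ}

theorem le_levelCap_mul (hρη : ρ < η) (hη : 0 < η) (k : ℕ) :
    96 * ((1 - η * L) ^ 2)⁻¹ ≤ levelCap L η ρ k * min (driftWeight k / 120) (1 / 120) := by
  have h : 0 < min (driftWeight k / 120) (1 / 120) :=
    lt_min (div_pos (driftWeight_pos k) (by norm_num)) (by norm_num)
  rw [← div_le_iff₀ h, levelCap_eq L hρη hη]
  exact Nat.le_ceil _

theorem two_le_levelCap (hρη : ρ < η) (hη : 0 < η) (hL : 0 ≤ η * L) (hL1 : η * L < 1) (k : ℕ) :
    2 ≤ levelCap L η ρ k := by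
  have h1 := le_levelCap_mul (L := L) hρη hη k
  have h2 : (levelCap L η ρ k : ℝ) * min (driftWeight k / 120) (1 / 120) ≤
      levelCap L η ρ k * (1 / 120) := by
    gcongr
    exact min_le_right _ _
  have h3 : 1 ≤ ((1 - η * L) ^ 2)⁻¹ := by
    rw [one_le_inv₀ (pow_pos (by linarith) 2)]
    exact pow_le_one₀ (by linarith) (by linarith)
  have h4 : (2 : ℝ) ≤ levelCap L η ρ k := by linarith
  exact_mod_cast h4

theorem one_le_logb_levelCap (hρη : ρ < η) (hη : 0 < η) (hL : 0 ≤ η * L) (hL1 : η * L < 1)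
    (k : ℕ) : 1 ≤ Real.logb 2 (levelCap L η ρ k) := by
  have h : (2 : ℝ) ≤ levelCap L η ρ k := by exact_mod_cast two_le_levelCap hρη hη hL hL1 k
  rw [Real.le_logb_iff_rpow_le (by norm_num) (by linarith)]
  simpa using h

theorem batchSize_pos (hρη : ρ < η) (hη : 0 < η) (hL : 0 ≤ η * L) (hL1 : η * L < 1) (k : ℕ) :
    0 < batchSize L η ρ k := by
  have h1 := one_le_logb_levelCap hρη hη hL hL1 k
  have h2 : 0 < (1 - η * L) ^ 2 := pow_pos (by linarith) 2
  rw [batchSize, Nat.ceil_pos]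
  positivity

/-- Rounding `N` down to a power of two loses at most a factor 2, and `24 / 96 = 1 / 4`. -/
theorem bias_bound (hρη : ρ < η) (hη : 0 < η) {S : ℝ} (hS : 0 ≤ S) (k : ℕ) :
    12 * ((1 - η * L) ^ 2)⁻¹ * S / 2 ^ Nat.log 2 (levelCap L η ρ k) ≤
      min (driftWeight k / 120) (1 / 120) / 4 * S := by
  have h0 := le_levelCap_mul (L := L) hρη hη k
  set N := levelCap L η ρ k
  set δ := min (driftWeight k / 120) (1 / 120)
  have hδ : 0 < δ := lt_min (div_pos (driftWeight_pos k) (by norm_num)) (by norm_num)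
  have h1 : (N : ℝ) ≤ 2 ^ Nat.log 2 N * 2 := by
    rw [← pow_succ]
    exact_mod_cast (Nat.lt_pow_succ_log_self (by norm_num) N).le
  rw [div_le_iff₀ (by positivity)]
  have h2 : (N : ℝ) * δ ≤ 2 ^ Nat.log 2 N * 2 * δ := by gcongr
  have h3 : 12 * ((1 - η * L) ^ 2)⁻¹ * S ≤ (2 ^ Nat.log 2 N * 2 * δ / 8) * S := by
    gcongr
    linarith
  linarith

/-- As `log₂ N ≥ 1`, the numerator is at most `14 * 12 = 168` times `S log₂ N / μ²`, and `672 * 120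
= 168 * 480`. -/
theorem second_moment_bound (hL1 : η * L < 1) {S : ℝ}
    (hS : 0 ≤ S) (k : ℕ) (hN : 1 ≤ Real.logb 2 (levelCap L η ρ k)) :
    (2 + 12 * (Nat.log 2 (levelCap L η ρ k) : ℝ)) * (12 * ((1 - η * L) ^ 2)⁻¹ * S) /
      batchSize L η ρ k ≤ S / 480 := by
  set N := levelCap L η ρ k
  have hμ : 0 < (1 - η * L) ^ 2 := pow_pos (by linarith) 2
  have h1 : 672 * 120 * Real.logb 2 N / (1 - η * L) ^ 2 ≤ batchSize L η ρ k := Nat.le_ceil _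
  have h2 : (Nat.log 2 N : ℝ) ≤ Real.logb 2 N := by exact_mod_cast Real.natLog_le_logb N 2
  have hM : 0 < (batchSize L η ρ k : ℝ) := lt_of_lt_of_le (by positivity) h1
  rw [div_le_iff₀ hM]
  rw [div_le_iff₀ hμ] at h1
  calc (2 + 12 * (Nat.log 2 N : ℝ)) * (12 * ((1 - η * L) ^ 2)⁻¹ * S)
      ≤ (14 * Real.logb 2 N) * (12 * ((1 - η * L) ^ 2)⁻¹ * S) := by
        gcongr
        linarith
    _ = 672 * 120 * Real.logb 2 N * ((1 - η * L) ^ 2)⁻¹ * (S / 480) := by ring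
    _ ≤ (batchSize L η ρ k * (1 - η * L) ^ 2) * ((1 - η * L) ^ 2)⁻¹ * (S / 480) := by gcongr
    _ = S / 480 * batchSize L η ρ k := by
        rw [mul_assoc (batchSize L η ρ k : ℝ), mul_inv_cancel₀ hμ.ne', mul_one, mul_comm]

end StepSizes

-- The estimate of the resolvent and one outer step from a fixed point.

section Estimate

variable {E : Type*} [NormedAddCommGroup E] [InnerProductSpace ℝ E] [FiniteDimensional ℝ E]
  [MeasurableSpace E] [BorelSpace E] {Ξ Ω : Type*} [MeasurableSpace Ξ] [MeasurableSpace Ω]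
  {L : ℝ≥0} {η ρ σ : ℝ} {F : E → E} {G : E → Set E} {Ft : E → Ξ → E} {ν : Measure Ξ}
  {P : Measure Ω} [IsProbabilityMeasure P] {ξ : SeedIndex → Ω → Ξ} {I : ℕ × ℕ → Ω → ℕ}

/-- The iterate `y ^ i` of copy `m` in iteration `k`, started from `x`. -/
def levelPoint (L : ℝ≥0) (η : ℝ) (G : E → Set E) (Ft : E → Ξ → E) (ξ : SeedIndex → Ω → Ξ)
    (k m : ℕ) (x : E) (i : ℕ) (ω : Ω) : E :=
  (innerFbf L η G Ft x (fun t b => ξ ⟨k, m, i, t, b⟩ ω) (2 ^ i)).point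

/-- Copy `m` of the multilevel estimator of iteration `k`, at the point `x`. -/
def copyRun (L : ℝ≥0) (η ρ : ℝ) (G : E → Set E) (Ft : E → Ξ → E) (ξ : SeedIndex → Ξ)
    (I : ℕ × ℕ → ℕ) (k m : ℕ) (x : E) : Run E :=
  mlmcFbf (1 - η * L) (1 + η * L) (opSmul η G) (fun z s => z + η • Ft z s) x
    (levelCap L η ρ k) (I (k, m)) (fun i t b => ξ ⟨k, m, i, t, b⟩)

omit [FiniteDimensional ℝ E] [MeasurableSpace E] [BorelSpace E] [MeasurableSpace Ξ]
  [MeasurableSpace Ω] in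
theorem copyRun_point (k m : ℕ) (x : E) (ω : Ω) :
    (copyRun L η ρ G Ft (fun j => ξ j ω) (fun j => I j ω) k m x).point =
      if 2 ^ I (k, m) ω ≤ levelCap L η ρ k then
        levelPoint L η G Ft ξ k m x 0 ω + (2 ^ I (k, m) ω : ℝ) •
          (levelPoint L η G Ft ξ k m x (I (k, m) ω) ω -
            levelPoint L η G Ft ξ k m x (I (k, m) ω - 1) ω)
      else levelPoint L η G Ft ξ k m x 0 ω := by
  rw [copyRun, mlmcFbf, apply_ite Run.point]
  rfl

namespace InnerProblem

variable (h : InnerProblem L η σ F G Ft ν)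
include h

theorem measurable_copyRun {Ω' : Type*} {_ : MeasurableSpace Ω'} {ξ : SeedIndex → Ω' → Ξ}
    {I : ℕ × ℕ → Ω' → ℕ} {k m : ℕ} (hξ : ∀ i t b, Measurable (ξ ⟨k, m, i, t, b⟩))
    (hI : Measurable (I (k, m))) {X : Ω' → E} (hX : Measurable X) :
    Measurable fun ω => (copyRun L η ρ G Ft (fun j => ξ j ω) (fun j => I j ω) k m (X ω)).point := by
  have hlevel : ∀ i, Measurable fun ω => levelPoint L η G Ft ξ k m (X ω) i ω := fun i =>
    h.measurable_innerFbf (s := fun t b => ξ ⟨k, m, i, t, b⟩) hX fun t _ b => hξ _ _ _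
  -- The level is random; separating it as a variable of countable type leaves measurability to be
  -- checked level by level.
  have hpair : Measurable fun p : ℕ × Ω' => if 2 ^ p.1 ≤ levelCap L η ρ k then
      levelPoint L η G Ft ξ k m (X p.2) 0 p.2 + (2 ^ p.1 : ℝ) •
        (levelPoint L η G Ft ξ k m (X p.2) p.1 p.2 -
          levelPoint L η G Ft ξ k m (X p.2) (p.1 - 1) p.2)
      else levelPoint L η G Ft ξ k m (X p.2) 0 p.2 := by
    refine measurable_from_prod_countable_right fun i => ?_
    dsimp only
    split_ifs
    · exact (hlevel 0).add (((hlevel i).sub (hlevel (i - 1))).const_smul _)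
    · exact hlevel 0
  simp only [copyRun_point]
  exact hpair.comp (hI.prodMk measurable_id)

/-- Measurability of the estimate of the resolvent jointly in the point and the draws. -/
theorem measurable_estimate {Ω' : Type*} {_ : MeasurableSpace Ω'} {ξ : SeedIndex → Ω' → Ξ}
    {I : ℕ × ℕ → Ω' → ℕ} {k : ℕ} (hξ : ∀ m i t b, Measurable (ξ ⟨k, m, i, t, b⟩))
    (hI : ∀ m, Measurable (I (k, m))) {X : Ω' → E} (hX : Measurable X) :
    Measurable fun ω => (estimate L η ρ G Ft (fun j => ξ j ω) (fun j => I j ω) k (X ω)).point :=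
  (Finset.measurable_sum _ fun m _ => h.measurable_copyRun (hξ m) (hI m) hX).const_smul
    ((batchSize L η ρ k : ℝ)⁻¹)

omit [MeasurableSpace Ω] in
theorem measurable_levelPoint_drawsSigma (k m : ℕ) (x : E) (i : ℕ) :
    Measurable[drawsSigma ξ I
      {j | ∃ t b, j = .inl ⟨k, m, i, t, b⟩}] (levelPoint L η G Ft ξ k m x i) :=
  h.measurable_innerFbf (s := fun t b => ξ ⟨k, m, i, t, b⟩) measurable_const
    fun t _ b => measurable_seed_drawsSigma ⟨t, b, rfl⟩

/-- The inner solver starts at `x`, so its initial distance is the residual. Independence holds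
because `z_t` uses only seeds of steps before `t`. -/
theorem expectationLE_levelPoint (hS : IsSampling P ν ξ I) (k m : ℕ) (x : E) (i : ℕ) :
    ExpectationLE P (fun ω => ‖levelPoint L η G Ft ξ k m x i ω -
      resolventMap (opSmul η (opAdd F G)) x‖ ^ 2)
      (12 * ((1 - η * L) ^ 2)⁻¹ * (fpResidual η F G x ^ 2 + η ^ 2 * σ ^ 2) / 2 ^ i) := by
  let A : ℕ → Set (SeedIndex ⊕ (ℕ × ℕ)) := fun t => {j | ∃ u < t, ∃ b, j = .inl ⟨k, m, i, u, b⟩}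
  have hA : ∀ t, Measurable[drawsSigma ξ I (A t)]
      fun ω => (innerFbf L η G Ft x (fun t b => ξ ⟨k, m, i, t, b⟩ ω) t).point := fun t =>
    h.measurable_innerFbf (s := fun t b => ξ ⟨k, m, i, t, b⟩) measurable_const
      fun u hu b => measurable_seed_drawsSigma ⟨u, hu, b, rfl⟩
  have key := h.expectationLE_innerFbf (P := P) x (s := fun t b => ξ ⟨k, m, i, t, b⟩)
    (fun t b => hS.measurable_seed _) (fun t b => hS.law_seed _)
    (fun t => hS.indepFun (S := A t) (T := {.inl ⟨k, m, i, t, false⟩}) ?_ (hA t)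
      (measurable_seed_drawsSigma rfl))
    (fun t => hS.indepFun (S := A t ∪ {.inl ⟨k, m, i, t, false⟩})
      (T := {.inl ⟨k, m, i, t, true⟩}) ?_
      (Measurable.prodMk ((hA t).mono (drawsSigma_mono Set.subset_union_left) le_rfl)
        (measurable_seed_drawsSigma (Or.inr rfl))) (measurable_seed_drawsSigma rfl))
    (T := 2 ^ i) Nat.one_le_two_pow
  · push_cast at key
    exact key
  · rw [Set.disjoint_singleton_right]
    rintro ⟨u, hu, b, hj⟩
    simp only [Sum.inl.injEq, SeedIndex.mk.injEq] at hj
    omega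
  · rw [Set.disjoint_singleton_right]
    rintro (⟨u, hu, b, hj⟩ | hj)
    · simp only [Sum.inl.injEq, SeedIndex.mk.injEq] at hj
      omega
    · simp at hj

/-- Bias and second moment of the estimate of the resolvent at a fixed point. -/
theorem estimate_moments (hS : IsSampling P ν ξ I) (hρη : ρ < η) (k : ℕ) (x : E) :
    Integrable (fun ω =>
        (estimate L η ρ G Ft (fun j => ξ j ω) (fun j => I j ω) k x).point) P ∧
      ‖∫ ω, (estimate L η ρ G Ft (fun j => ξ j ω) (fun j => I j ω) k x).point ∂P -
        resolventMap (opSmul η (opAdd F G)) x‖ ^ 2 ≤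
          driftWeight k / 480 * (fpResidual η F G x ^ 2 + η ^ 2 * σ ^ 2) ∧
      ExpectationLE P (fun ω =>
        ‖(estimate L η ρ G Ft (fun j => ξ j ω) (fun j => I j ω) k x).point -
          resolventMap (opSmul η (opAdd F G)) x‖ ^ 2)
          ((fpResidual η F G x ^ 2 + η ^ 2 * σ ^ 2) / 240) := by
  have hηL := h.eta_mul_lt
  have hηL0 : 0 ≤ η * L := mul_nonneg h.eta_pos.le L.2
  set S := fpResidual η F G x ^ 2 + η ^ 2 * σ ^ 2 with hSdef
  have hS0 : 0 ≤ S := by positivity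
  have hN := two_le_levelCap (L := L) hρη h.eta_pos hηL0 hηL k
  set B := 12 * ((1 - η * L) ^ 2)⁻¹ * S with hB
  let V : ℕ → Ω → E := fun m ω =>
    (copyRun L η ρ G Ft (fun j => ξ j ω) (fun j => I j ω) k m x).point
  have hlevel : ∀ m i, Measurable (levelPoint L η G Ft ξ k m x i) := fun m i =>
    (h.measurable_levelPoint_drawsSigma (I := I) k m x i).mono (hS.drawsSigma_le _) le_rfl
  have hcopy := fun m => multilevel_estimator (P := P) (hlevel m)
    (hS.measurable_level (k, m)) (hS.law_level (k, m))
    (fun i => hS.indepFun (S := {.inr (k, m)}) (T := {j | ∃ q, j = .inl q})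
      (by
        rw [Set.disjoint_singleton_left]
        rintro ⟨q, hq⟩
        cases hq)
      (measurable_level_drawsSigma rfl)
      (Measurable.sub
        ((h.measurable_levelPoint_drawsSigma k m x (i + 1)).mono
          (drawsSigma_mono (by rintro _ ⟨t, b, rfl⟩; exact ⟨_, rfl⟩)) le_rfl)
        ((h.measurable_levelPoint_drawsSigma k m x i).mono
          (drawsSigma_mono (by rintro _ ⟨t, b, rfl⟩; exact ⟨_, rfl⟩)) le_rfl)))
    (fun i => h.expectationLE_levelPoint hS k m x i) (N := levelCap L η ρ k) (by omega)
  simp only [← copyRun_point (L := L) (η := η) (ρ := ρ) (G := G) (Ft := Ft) (ξ := ξ) (I := I)]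
    at hcopy
  let T : ℕ → Set (SeedIndex ⊕ (ℕ × ℕ)) :=
    fun m => {j | (∃ i t b, j = .inl ⟨k, m, i, t, b⟩) ∨ j = .inr (k, m)}
  have hVT : ∀ m, Measurable[drawsSigma ξ I (T m)] (V m) := fun m =>
    h.measurable_copyRun (fun i t b => measurable_seed_drawsSigma (Or.inl ⟨i, t, b, rfl⟩))
      (measurable_level_drawsSigma (Or.inr rfl)) measurable_const
  have hind : ∀ m n, m ≠ n → IndepFun (V m) (V n) P := fun m n hmn =>
    hS.indepFun (Set.disjoint_left.2 (by
      rintro _ (⟨i, t, b, rfl⟩ | rfl) (⟨i', t', b', hj⟩ | hj)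
      · simp only [Sum.inl.injEq, SeedIndex.mk.injEq] at hj
        exact hmn hj.2.1
      · cases hj
      · cases hj
      · simp only [Sum.inr.injEq, Prod.mk.injEq, true_and] at hj
        exact hmn hj)) (hVT m) (hVT n)
  have havg := average_estimator (fun m => (hcopy m).1) hind
    (fun m => Real.le_sqrt_of_sq_le (hcopy m).2.1) (fun m => (hcopy m).2.2)
    (batchSize_pos (L := L) hρη h.eta_pos hηL0 hηL k)
  have hbias := bias_bound (L := L) hρη h.eta_pos hS0 k
  have hmom := second_moment_bound (L := L) (ρ := ρ) hηL hS0 k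
    (one_le_logb_levelCap hρη h.eta_pos hηL0 hηL k)
  have hsq : √(B / 2 ^ Nat.log 2 (levelCap L η ρ k)) ^ 2 =
      B / 2 ^ Nat.log 2 (levelCap L η ρ k) := Real.sq_sqrt (by positivity)
  refine ⟨havg.1, ?_, havg.2.2.mono ?_⟩
  · have h1 : ‖∫ ω, (batchSize L η ρ k : ℝ)⁻¹ • ∑ m ∈ Finset.range (batchSize L η ρ k), V m ω ∂P -
        resolventMap (opSmul η (opAdd F G)) x‖ ^ 2 ≤
        √(B / 2 ^ Nat.log 2 (levelCap L η ρ k)) ^ 2 :=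
      pow_le_pow_left₀ (norm_nonneg _) havg.2.1 2
    rw [hsq] at h1
    refine h1.trans (hbias.trans ?_)
    -- The first entry of the minimum controls the bias. The second, used below, bounds the squared
    -- bias by `S / 480`; with the variance part `S / 480` this gives `S / 240`.
    have : min (driftWeight k / 120) (1 / 120) / 4 ≤ driftWeight k / 480 := by
      linarith [min_le_left (driftWeight k / 120) (1 / 120)]
    exact mul_le_mul_of_nonneg_right this hS0
  · rw [hsq]
    have : min (driftWeight k / 120) (1 / 120) / 4 * S ≤ 1 / 480 * S := by
      refine mul_le_mul_of_nonneg_right ?_ hS0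
      linarith [min_le_right (driftWeight k / 120) (1 / 120)]
    linarith

/-- Expected decrease of the distance to the solution in one iteration started at `x`. -/
theorem expectationLE_step (hS : IsSampling P ν ξ I) (hρη : ρ < η) {xs : E}
    (hW : WeakMVI ρ F G xs) (k : ℕ) (x : E) :
    ExpectationLE P (fun ω => ‖(1 - stepSize η ρ k) • x + stepSize η ρ k •
        (estimate L η ρ G Ft (fun j => ξ j ω) (fun j => I j ω) k x).point - xs‖ ^ 2)
      ((1 + driftWeight k) * ‖x - xs‖ ^ 2 -
        relax η ρ * stepSize η ρ k / 2 * fpResidual η F G x ^ 2 +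
        stepSize η ρ k ^ 2 * (η ^ 2 * σ ^ 2) / 160) := by
  obtain ⟨hint, hbias, hmom⟩ := h.estimate_moments hS hρη k x
  have hconic := hW.relax_mul_sq_le h.lipschitz h.maximal h.eta_pos h.eta_mul_lt x
  set J := resolventMap (opSmul η (opAdd F G)) x
  have hR : fpResidual η F G x = ‖x - J‖ := rfl
  set V := fun ω => (estimate L η ρ G Ft (fun j => ξ j ω) (fun j => I j ω) k x).point
  set a := stepSize η ρ k with ha
  set α := relax η ρ with hα
  set β := driftWeight k with hβ
  have hα0 : 0 < α := relax_pos hρη h.eta_pos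
  have ha0 : 0 < a := stepSize_pos hρη h.eta_pos k
  have haα : a ≤ α := stepSize_le hρη h.eta_pos k
  have hβ0 : 0 < β := driftWeight_pos k
  have haβ : a = β * (α * ((k : ℝ) + 1)) := stepSize_eq_driftWeight k
  -- `u` is the error after the exact step; the actual error is `u + a • (V ω - J)`.
  set u := x - xs - a • (x - J) with hu
  have hmean : ∫ ω, (V ω - J) ∂P = ∫ ω, V ω ∂P - J := by
    rw [integral_sub hint (integrable_const _)]
    simp
  have h1 := expectationLE_norm_add_smul_sq (hint.sub (integrable_const J)) hmom u a
  simp only [Pi.sub_apply, hmean] at h1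
  have e : (fun ω => ‖u + a • (V ω - J)‖ ^ 2) =
      fun ω => ‖(1 - a) • x + a • V ω - xs‖ ^ 2 := by
    funext ω
    congr 2
    rw [hu]
    module
  rw [e] at h1
  refine h1.mono ?_
  set S := fpResidual η F G x ^ 2 + η ^ 2 * σ ^ 2 with hSdef
  have hS0 : 0 ≤ S := by positivity
  rw [hR] at hSdef ⊢
  set R := ‖x - J‖
  set b := ∫ ω, V ω ∂P - J
  set D := ‖x - xs‖
  have hun : ‖u‖ ^ 2 ≤ D ^ 2 - a * α * R ^ 2 := by
    rw [hu, norm_sub_sq_real, norm_smul, mul_pow, Real.norm_of_nonneg ha0.le, inner_smul_right,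
      real_inner_comm]
    have h2 : a * (α * R ^ 2) ≤ a * ⟪x - J, x - xs⟫ := by gcongr
    have h3 : a * a * R ^ 2 ≤ a * α * R ^ 2 := by gcongr
    change D ^ 2 - 2 * (a * ⟪x - J, x - xs⟫) + a ^ 2 * R ^ 2 ≤ _
    linarith
  have huD : ‖u‖ ^ 2 ≤ D ^ 2 := hun.trans (by
    have : 0 ≤ a * α * R ^ 2 := by positivity
    linarith)
  -- Young with weight `β`. The bound `‖b‖² ≤ β S / 480` cancels the `1 / β`; the computation is
  -- multiplied through by `β` to avoid division.
  have hcross : 2 * a * ⟪u, b⟫ ≤ β * D ^ 2 + a ^ 2 / 480 * S := by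
    have h2 : ⟪u, b⟫ ≤ ‖u‖ * ‖b‖ := real_inner_le_norm u b
    have h3 : 2 * a * (‖u‖ * ‖b‖) * β ≤ β * β * ‖u‖ ^ 2 + a ^ 2 * ‖b‖ ^ 2 := by
      nlinarith [sq_nonneg (β * ‖u‖ - a * ‖b‖)]
    have h4 : a ^ 2 * ‖b‖ ^ 2 ≤ a ^ 2 * (β / 480 * S) := by gcongr
    have h5 : β * β * ‖u‖ ^ 2 ≤ β * β * D ^ 2 := by gcongr
    have h6 : (2 * a * (‖u‖ * ‖b‖)) * β ≤ (β * D ^ 2 + a ^ 2 / 480 * S) * β := by linarith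
    have h7 := le_of_mul_le_mul_right h6 hβ0
    have h8 : 2 * a * ⟪u, b⟫ ≤ 2 * a * (‖u‖ * ‖b‖) := by gcongr
    linarith
  -- The error terms total `a² S (1/240 + 1/480) = a² S / 160`. Their `R²` part fits within half of
  -- the decrease `a α R²`, leaving the noise part.
  have hRa : a ^ 2 * R ^ 2 ≤ a * α * R ^ 2 := by
    rw [pow_two a]
    gcongr
  have hVar : 0 ≤ a ^ 2 * (η ^ 2 * σ ^ 2) := by positivity
  have hRR : 0 ≤ a * α * R ^ 2 := by positivity
  have hSm : a ^ 2 * S = a ^ 2 * R ^ 2 + a ^ 2 * (η ^ 2 * σ ^ 2) := by rw [hSdef]; ring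
  have : a ^ 2 * (S / 240) = a ^ 2 * S / 240 := by ring
  have h9 : a ^ 2 / 480 * S = a ^ 2 * S / 480 := by ring
  rw [this]
  rw [h9] at hcross
  linarith

end InnerProblem

end Estimate

-- Summability of the weights and a Grönwall inequality.

section Series

theorem sum_driftWeight_le (k : ℕ) : ∑ j ∈ Finset.range k, driftWeight j ≤ 3 := by
  -- Comparison with a telescoping sum: after bounding the logarithm below by 1, the increment
  -- inequality reduces to `√(k + 2) ≤ 2 √(k + 1)`.
  have h : ∑ j ∈ Finset.range k, driftWeight j ≤ 3 - 3 / √((k : ℝ) + 1) := by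
    induction k with
    | zero => simp
    | succ k ih =>
      rw [Finset.sum_range_succ]
      have e : ((k + 1 : ℕ) : ℝ) + 1 = (k : ℝ) + 2 := by push_cast; ring
      rw [e]
      set p := √((k : ℝ) + 1) with hp
      set q := √((k : ℝ) + 2) with hq
      have hp0 : 0 < p := Real.sqrt_pos.2 (by positivity)
      have hq0 : 0 < q := Real.sqrt_pos.2 (by positivity)
      have hp2 : p ^ 2 = (k : ℝ) + 1 := Real.sq_sqrt (by positivity)
      have hq2 : q ^ 2 = (k : ℝ) + 2 := Real.sq_sqrt (by positivity)
      have hk : (0 : ℝ) ≤ k := k.cast_nonneg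
      have hq2p : q ≤ 2 * p := by
        refine le_of_sq_le_sq ?_ (by positivity)
        nlinarith
      have h1 : driftWeight k ≤ 1 / (p ^ 2 * q) := by
        unfold driftWeight
        rw [hp2]
        refine one_div_le_one_div_of_le (by positivity) ?_
        exact mul_le_mul_of_nonneg_left
          (le_mul_of_one_le_right hq0.le (one_lt_log_add_three k).le) (by positivity)
      have h2 : 1 / (p ^ 2 * q) ≤ 3 / p - 3 / q := by
        rw [div_sub_div _ _ hp0.ne' hq0.ne', div_le_div_iff₀ (by positivity) (by positivity)]
        have h3 : (q - p) * (q + p) = 1 := by nlinarith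
        have h4 : q - p = 1 / (q + p) := by
          rw [eq_div_iff (by positivity)]
          exact h3
        have h5 : 3 * q - p * 3 = 3 / (q + p) := by
          rw [show 3 * q - p * 3 = 3 * (q - p) by ring, h4]
          ring
        rw [h5, one_mul, div_mul_eq_mul_div, le_div_iff₀ (by positivity)]
        nlinarith [mul_pos hp0 hq0]
      linarith
  have : 0 ≤ 3 / √((k : ℝ) + 1) := by positivity
  linarith

theorem sum_stepSize_sq_le {η ρ : ℝ} (k : ℕ) :
    ∑ j ∈ Finset.range k, stepSize η ρ j ^ 2 ≤ 3 * relax η ρ ^ 2 := by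
  -- Comparison with the telescoping `1 / log (k + 2)`; the factor `3 / 2` pays for `(k + 3) / (k +
  -- 2) ≤ 3 / 2`.
  have h : ∑ j ∈ Finset.range k, 1 / (((j : ℝ) + 2) * Real.log ((j : ℝ) + 3) ^ 2) ≤
      3 - 3 / 2 / Real.log ((k : ℝ) + 2) := by
    induction k with
    | zero =>
      have := Real.log_two_gt_d9
      have h2 : 3 / 2 / Real.log 2 ≤ 3 := by
        rw [div_le_iff₀ (by linarith)]
        linarith
      simpa using h2
    | succ k ih =>
      rw [Finset.sum_range_succ]
      have e : ((k + 1 : ℕ) : ℝ) + 2 = (k : ℝ) + 3 := by push_cast; ring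
      rw [e]
      have hk : (0 : ℝ) ≤ k := k.cast_nonneg
      have hp0 : 0 < Real.log ((k : ℝ) + 2) := Real.log_pos (by linarith)
      have hpq : Real.log ((k : ℝ) + 2) ≤ Real.log ((k : ℝ) + 3) :=
        Real.log_le_log (by linarith) (by linarith)
      have hdiff : 1 / ((k : ℝ) + 3) ≤ Real.log ((k : ℝ) + 3) - Real.log ((k : ℝ) + 2) := by
        rw [← Real.log_div (by positivity) (by positivity)]
        have := Real.one_sub_inv_le_log_of_pos (x := ((k : ℝ) + 3) / ((k : ℝ) + 2)) (by positivity)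
        refine le_trans (le_of_eq ?_) this
        field_simp
        ring
      set p := Real.log ((k : ℝ) + 2)
      set q := Real.log ((k : ℝ) + 3)
      have hq0 : 0 < q := hp0.trans_le hpq
      have h1 : 1 / (((k : ℝ) + 2) * q ^ 2) ≤ 3 / 2 / p - 3 / 2 / q := by
        rw [div_sub_div _ _ hp0.ne' hq0.ne', div_le_div_iff₀ (by positivity) (by positivity)]
        have h2 : 1 ≤ 3 / 2 * (q - p) * ((k : ℝ) + 2) := by
          rw [div_le_iff₀ (by positivity)] at hdiff
          nlinarith
        have h3 : p * q ≤ q ^ 2 := by nlinarith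
        calc 1 * (p * q) ≤ 1 * q ^ 2 := by linarith
          _ ≤ (3 / 2 * (q - p) * ((k : ℝ) + 2)) * q ^ 2 := by gcongr
          _ = (3 / 2 * q - p * (3 / 2)) * (((k : ℝ) + 2) * q ^ 2) := by ring
      linarith
  have h0 : 0 ≤ 3 / 2 / Real.log ((k : ℝ) + 2) := by
    have hk : (0 : ℝ) ≤ k := k.cast_nonneg
    have := Real.log_pos (x := (k : ℝ) + 2) (by linarith)
    positivity
  have e : ∀ j : ℕ, stepSize η ρ j ^ 2 =
      relax η ρ ^ 2 * (1 / (((j : ℝ) + 2) * Real.log ((j : ℝ) + 3) ^ 2)) := by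
    intro j
    rw [stepSize, div_pow, mul_pow, Real.sq_sqrt (by positivity)]
    ring
  simp only [e, ← Finset.mul_sum]
  nlinarith [sq_nonneg (relax η ρ)]

/-- A discrete Grönwall inequality with dissipation. -/
theorem gronwall_dissipation {e r β c : ℕ → ℝ} (he : ∀ k, 0 ≤ e k) (hr : ∀ k, 0 ≤ r k)
    (hβ : ∀ k, 0 ≤ β k) (hc : ∀ k, 0 ≤ c k)
    (h : ∀ k, e (k + 1) ≤ (1 + β k) * e k - r k + c k) (k : ℕ) :
    e k + ∑ j ∈ Finset.range k, r j ≤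
      Real.exp (∑ j ∈ Finset.range k, β j) * (e 0 + ∑ j ∈ Finset.range k, c j) := by
  induction k with
  | zero => simp
  | succ k ih =>
    rw [Finset.sum_range_succ, Finset.sum_range_succ, Finset.sum_range_succ, Real.exp_add]
    set R := ∑ j ∈ Finset.range k, r j
    set B := ∑ j ∈ Finset.range k, β j
    set C := ∑ j ∈ Finset.range k, c j
    have hR : 0 ≤ R := Finset.sum_nonneg fun j _ => hr j
    have hB : 0 ≤ B := Finset.sum_nonneg fun j _ => hβ j
    have h1 : 1 + β k ≤ Real.exp (β k) := by linarith [Real.add_one_le_exp (β k)]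
    have h2 : 1 ≤ Real.exp B * Real.exp (β k) := by
      rw [← Real.exp_add]
      exact Real.one_le_exp (by linarith [hβ k])
    have h3 : (1 + β k) * e k + R ≤ Real.exp (β k) * (e k + R) := by
      have h4 : (1 + β k) * e k ≤ Real.exp (β k) * e k := mul_le_mul_of_nonneg_right h1 (he k)
      have h5 : R ≤ Real.exp (β k) * R := le_mul_of_one_le_left hR (by linarith [hβ k])
      linarith
    have h6 : Real.exp (β k) * (e k + R) ≤ Real.exp (β k) * (Real.exp B * (e 0 + C)) := by gcongr
    have h7 : c k ≤ Real.exp B * Real.exp (β k) * c k := le_mul_of_one_le_left (hc k) h2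
    linarith [h k]

end Series

-- Expectation at a uniformly drawn index.

section UniformIndex

variable {Ω : Type*} [MeasurableSpace Ω] {P : Measure Ω} [IsProbabilityMeasure P]

theorem expectationLE_withUniformIndex {f : ℕ × Ω → ℝ} (hm : ∀ k, Measurable fun ω => f (k, ω))
    (hi : ∀ k, Integrable (fun ω => f (k, ω)) P) {K : ℕ} (hK : 1 ≤ K) {c : ℝ}
    (hc : (∑ k ∈ Finset.range K, ∫ ω, f (k, ω) ∂P) / K ≤ c) :
    ExpectationLE (withUniformIndex K P) f c := by
  have hprob : IsProbabilityMeasure (uniformOn (Set.Iio K)) :=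
    isProbabilityMeasure_uniformOn (Set.finite_Iio K) ⟨0, hK⟩
  have hint : ∀ g : ℕ → ℝ, Integrable g (uniformOn (Set.Iio K)) ∧
      ∫ k, g k ∂(uniformOn (Set.Iio K)) = (∑ k ∈ Finset.range K, g k) / K := by
    intro g
    have hs : (Set.Iio K : Set ℕ) = (Finset.range K : Set ℕ) := by ext; simp
    have hfin : Measure.count (Finset.range K : Set ℕ) = (K : ENNReal) := by
      rw [Measure.count_apply_finset, Finset.card_range]
    have hfinite : IsFiniteMeasure (Measure.count.restrict (Finset.range K : Set ℕ)) :=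
      ⟨by rw [Measure.restrict_apply_univ, hfin]; exact ENNReal.natCast_lt_top K⟩
    have hon : IntegrableOn g (Finset.range K : Set ℕ) Measure.count := by
      have := IntegrableOn.finset (μ := Measure.count.restrict (Finset.range K : Set ℕ))
        (s := Finset.range K) (f := g)
      rwa [IntegrableOn, Measure.restrict_restrict (Finset.measurableSet _), Set.inter_self] at this
    rw [uniformOn, ProbabilityTheory.cond, hs, hfin]
    refine ⟨hon.smul_measure (by simp; omega), ?_⟩
    rw [integral_smul_measure, setIntegral_finset _ hon]
    simp [Measure.real, div_eq_inv_mul]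
  have hf : Measurable f := measurable_from_prod_countable_right hm
  have hif : Integrable f (withUniformIndex K P) := by
    rw [withUniformIndex, integrable_prod_iff hf.aestronglyMeasurable]
    exact ⟨Filter.Eventually.of_forall hi, (hint _).1⟩
  refine ⟨hif, ?_⟩
  rw [withUniformIndex, integral_prod _ hif, (hint _).2]
  exact hc

end UniformIndex

-- Convergence of the outer iteration.

section OuterIteration

variable {E : Type*} [NormedAddCommGroup E] [InnerProductSpace ℝ E] [FiniteDimensional ℝ E]
  [MeasurableSpace E] [BorelSpace E] {Ξ Ω : Type*} [MeasurableSpace Ξ] [MeasurableSpace Ω]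
  {L : ℝ≥0} {η ρ σ : ℝ} {F : E → E} {G : E → Set E} {Ft : E → Ξ → E} {ν : Measure Ξ}
  {P : Measure Ω} [IsProbabilityMeasure P] {ξ : SeedIndex → Ω → Ξ} {I : ℕ × ℕ → Ω → ℕ}
  {x₀ xs : E}

/-- The outer iteration to which a draw belongs. -/
def drawIter : SeedIndex ⊕ (ℕ × ℕ) → ℕ :=
  Sum.elim SeedIndex.iter Prod.fst

/-- The draws of iteration `k`, as seen by the estimate of that iteration. -/
def iterDraws (ξ : SeedIndex → Ω → Ξ) (I : ℕ × ℕ → Ω → ℕ) (k : ℕ) (ω : Ω) :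
    (SeedIndex → Ξ) × (ℕ × ℕ → ℕ) :=
  (fun j => ξ { j with iter := k } ω, fun j => I (k, j.2) ω)

omit [MeasurableSpace Ω] in
theorem measurable_iterDraws_drawsSigma (k : ℕ) :
    Measurable[drawsSigma ξ I {j | drawIter j = k}] (iterDraws ξ I k) := by
  let _ := drawsSigma ξ I {j | drawIter j = k}
  exact Measurable.prodMk (measurable_pi_lambda _ fun _ => measurable_seed_drawsSigma rfl)
    (measurable_pi_lambda _ fun _ => measurable_level_drawsSigma rfl)

omit [FiniteDimensional ℝ E] [MeasurableSpace E] [BorelSpace E] [MeasurableSpace Ξ]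
  [MeasurableSpace Ω] in
theorem run_succ_point (k : ℕ) (ω : Ω) :
    (run L η ρ G Ft x₀ ξ I (k + 1) ω).point =
      (1 - stepSize η ρ k) • (run L η ρ G Ft x₀ ξ I k ω).point + stepSize η ρ k •
        (estimate L η ρ G Ft (fun j => ξ j ω) (fun j => I j ω) k
          (run L η ρ G Ft x₀ ξ I k ω).point).point :=
  rfl

namespace InnerProblem

variable (h : InnerProblem L η σ F G Ft ν)
include h

omit [MeasurableSpace Ω] in
theorem measurable_run_drawsSigma (k : ℕ) :
    Measurable[drawsSigma ξ I {j | drawIter j < k}]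
      fun ω => (run L η ρ G Ft x₀ ξ I k ω).point := by
  induction k with
  | zero => exact measurable_const
  | succ k ih =>
    have hX : Measurable[drawsSigma ξ I {j | drawIter j < k + 1}]
        fun ω => (run L η ρ G Ft x₀ ξ I k ω).point :=
      ih.mono (drawsSigma_mono fun j hj => Nat.lt_succ_of_lt hj) le_rfl
    have hest := h.measurable_estimate (ρ := ρ) (k := k)
      (fun m i t b => measurable_seed_drawsSigma (ξ := ξ) (I := I)
        (S := {j | drawIter j < k + 1}) (j := ⟨k, m, i, t, b⟩) (Nat.lt_succ_self k))
      (fun m => measurable_level_drawsSigma (ξ := ξ) (I := I) (j := (k, m)) (Nat.lt_succ_self k))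
      hX
    simp only [run_succ_point]
    exact (hX.const_smul _).add (hest.const_smul _)

omit [IsProbabilityMeasure P] in
theorem measurable_run (hS : IsSampling P ν ξ I) (k : ℕ) :
    Measurable fun ω => (run L η ρ G Ft x₀ ξ I k ω).point :=
  (h.measurable_run_drawsSigma k).mono (hS.drawsSigma_le _) le_rfl

theorem measurable_fpResidual : Measurable (fpResidual η F G) :=
  (continuous_id.sub (continuous_resolventMap_opAdd h.lipschitz h.maximal h.eta_pos
    h.eta_mul_lt)).norm.measurable

omit [MeasurableSpace Ω] [BorelSpace E] in
-- Cauchy-Schwarz in the conic inequality; it passes square integrability from the distance to the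
-- residual.
theorem fpResidual_sq_le (hρη : ρ < η) (hW : WeakMVI ρ F G xs) (x : E) :
    fpResidual η F G x ^ 2 ≤ (relax η ρ ^ 2)⁻¹ * ‖x - xs‖ ^ 2 := by
  have hα := relax_pos hρη h.eta_pos
  have h1 := hW.relax_mul_sq_le h.lipschitz h.maximal h.eta_pos h.eta_mul_lt x
  have h2 := h1.trans (real_inner_le_norm _ _)
  change relax η ρ * fpResidual η F G x ^ 2 ≤ fpResidual η F G x * ‖x - xs‖ at h2
  rw [inv_mul_eq_div, le_div_iff₀ (by positivity)]
  have hR : 0 ≤ fpResidual η F G x := norm_nonneg _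
  nlinarith [sq_nonneg (relax η ρ * fpResidual η F G x - ‖x - xs‖)]

omit [IsProbabilityMeasure P] in
theorem integrable_fpResidual_sq (hS : IsSampling P ν ξ I) (hρη : ρ < η)
    (hW : WeakMVI ρ F G xs) {k : ℕ}
    (hk : Integrable (fun ω => ‖(run L η ρ G Ft x₀ ξ I k ω).point - xs‖ ^ 2) P) :
    Integrable (fun ω => fpResidual η F G (run L η ρ G Ft x₀ ξ I k ω).point ^ 2) P :=
  Integrable.mono' (hk.const_mul (relax η ρ ^ 2)⁻¹)
    ((h.measurable_fpResidual.comp (h.measurable_run hS k)).pow_const 2).aestronglyMeasurable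
    (Filter.Eventually.of_forall fun ω => by
      rw [Real.norm_of_nonneg (sq_nonneg _)]
      exact h.fpResidual_sq_le hρη hW _)

theorem expectationLE_run_succ (hS : IsSampling P ν ξ I) (hρη : ρ < η) (hW : WeakMVI ρ F G xs)
    {k : ℕ} (hk : Integrable (fun ω => ‖(run L η ρ G Ft x₀ ξ I k ω).point - xs‖ ^ 2) P) :
    ExpectationLE P (fun ω => ‖(run L η ρ G Ft x₀ ξ I (k + 1) ω).point - xs‖ ^ 2)
      ((1 + driftWeight k) * ∫ ω, ‖(run L η ρ G Ft x₀ ξ I k ω).point - xs‖ ^ 2 ∂P -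
        relax η ρ * stepSize η ρ k / 2 *
          ∫ ω, fpResidual η F G (run L η ρ G Ft x₀ ξ I k ω).point ^ 2 ∂P +
        stepSize η ρ k ^ 2 * (η ^ 2 * σ ^ 2) / 160) := by
  let X : Ω → E := fun ω => (run L η ρ G Ft x₀ ξ I k ω).point
  let H : E → (SeedIndex → Ξ) × (ℕ × ℕ → ℕ) → ℝ := fun x y =>
    ‖(1 - stepSize η ρ k) • x +
      stepSize η ρ k • (estimate L η ρ G Ft y.1 y.2 k x).point - xs‖ ^ 2
  have hH : Measurable (Function.uncurry H) := by
    have hest := h.measurable_estimate (ρ := ρ) (k := k)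
      (ξ := fun j (p : E × (SeedIndex → Ξ) × (ℕ × ℕ → ℕ)) => p.2.1 j)
      (I := fun j (p : E × (SeedIndex → Ξ) × (ℕ × ℕ → ℕ)) => p.2.2 j)
      (fun m i t b => (measurable_pi_apply _).comp (measurable_fst.comp measurable_snd))
      (fun m => (measurable_pi_apply _).comp (measurable_snd.comp measurable_snd)) measurable_fst
    exact ((((measurable_fst.const_smul _).add (hest.const_smul _)).sub_const xs).norm).pow_const 2
  have hr := h.integrable_fpResidual_sq hS hρη hW hk
  have hφ1 : Integrable (fun ω => (1 + driftWeight k) * ‖X ω - xs‖ ^ 2) P := hk.const_mul _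
  have hφ2 : Integrable (fun ω => relax η ρ * stepSize η ρ k / 2 * fpResidual η F G (X ω) ^ 2) P :=
    hr.const_mul _
  have hφ12 : Integrable (fun ω => (1 + driftWeight k) * ‖X ω - xs‖ ^ 2 -
      relax η ρ * stepSize η ρ k / 2 * fpResidual η F G (X ω) ^ 2) P := hφ1.sub hφ2
  -- `x_k` depends on draws of earlier iterations only, so it can be frozen. The estimate reads only
  -- draws labelled `k`, hence evaluating it on `iterDraws` changes nothing.
  have key := expectationLE_of_indepFun (P := P)
    (hS.indepFun (S := {j | drawIter j < k}) (T := {j | drawIter j = k})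
      (Set.disjoint_left.2 fun j (h1 : drawIter j < k) (h2 : drawIter j = k) => h1.ne h2)
      (h.measurable_run_drawsSigma (ρ := ρ) (x₀ := x₀) k) (measurable_iterDraws_drawsSigma k))
    (h.measurable_run hS k)
    ((measurable_iterDraws_drawsSigma k).mono (hS.drawsSigma_le _) le_rfl) hH
    (fun _ _ => sq_nonneg _) (fun x => h.expectationLE_step hS hρη hW k x)
    (hφ12.add (integrable_const (stepSize η ρ k ^ 2 * (η ^ 2 * σ ^ 2) / 160)))
  refine ExpectationLE.mono key (le_of_eq ?_)
  rw [integral_add hφ12 (integrable_const _), integral_sub hφ1 hφ2, integral_const_mul,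
    integral_const_mul, integral_const]
  simp [X]

theorem integrable_run (hS : IsSampling P ν ξ I) (hρη : ρ < η) (hW : WeakMVI ρ F G xs) (k : ℕ) :
    Integrable (fun ω => ‖(run L η ρ G Ft x₀ ξ I k ω).point - xs‖ ^ 2) P := by
  induction k with
  | zero => exact integrable_const (‖x₀ - xs‖ ^ 2)
  | succ k ih => exact (h.expectationLE_run_succ hS hρη hW ih).1

theorem sum_fpResidual_sq_le (hS : IsSampling P ν ξ I) (hρη : ρ < η) (hW : WeakMVI ρ F G xs)
    (K : ℕ) :
    ∑ k ∈ Finset.range K, relax η ρ * stepSize η ρ k / 2 *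
        ∫ ω, fpResidual η F G (run L η ρ G Ft x₀ ξ I k ω).point ^ 2 ∂P ≤
      Real.exp 3 * (‖x₀ - xs‖ ^ 2 + relax η ρ ^ 2 * (η ^ 2 * σ ^ 2)) := by
  have hα := relax_pos hρη h.eta_pos
  have hg := gronwall_dissipation
    (e := fun k => ∫ ω, ‖(run L η ρ G Ft x₀ ξ I k ω).point - xs‖ ^ 2 ∂P)
    (r := fun k => relax η ρ * stepSize η ρ k / 2 *
        ∫ ω, fpResidual η F G (run L η ρ G Ft x₀ ξ I k ω).point ^ 2 ∂P)
    (β := driftWeight) (c := fun k => stepSize η ρ k ^ 2 * (η ^ 2 * σ ^ 2) / 160)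
    (fun k => integral_nonneg fun ω => sq_nonneg _)
    (fun k => mul_nonneg (by have := stepSize_pos hρη h.eta_pos k; positivity)
      (integral_nonneg fun ω => sq_nonneg _))
    (fun k => (driftWeight_pos k).le) (fun k => by positivity)
    (fun k => (h.expectationLE_run_succ hS hρη hW (h.integrable_run hS hρη hW k)).2) K
  have h0 : 0 ≤ ∫ ω, ‖(run L η ρ G Ft x₀ ξ I K ω).point - xs‖ ^ 2 ∂P :=
    integral_nonneg fun ω => sq_nonneg _
  have he0 : ∫ ω, ‖(run L η ρ G Ft x₀ ξ I 0 ω).point - xs‖ ^ 2 ∂P = ‖x₀ - xs‖ ^ 2 := by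
    change ∫ _, ‖x₀ - xs‖ ^ 2 ∂P = _
    simp
  rw [he0] at hg
  have hc : ∑ k ∈ Finset.range K, stepSize η ρ k ^ 2 * (η ^ 2 * σ ^ 2) / 160 ≤
      relax η ρ ^ 2 * (η ^ 2 * σ ^ 2) := by
    rw [← Finset.sum_div, ← Finset.sum_mul, div_le_iff₀ (by norm_num)]
    have h1 := sum_stepSize_sq_le (η := η) (ρ := ρ) K
    have h2 : (∑ k ∈ Finset.range K, stepSize η ρ k ^ 2) * (η ^ 2 * σ ^ 2) ≤
        3 * relax η ρ ^ 2 * (η ^ 2 * σ ^ 2) := by gcongr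
    have h3 : 0 ≤ relax η ρ ^ 2 * (η ^ 2 * σ ^ 2) := by positivity
    linarith
  have hle : Real.exp (∑ j ∈ Finset.range K, driftWeight j) *
      (‖x₀ - xs‖ ^ 2 + ∑ k ∈ Finset.range K, stepSize η ρ k ^ 2 * (η ^ 2 * σ ^ 2) / 160) ≤
      Real.exp 3 * (‖x₀ - xs‖ ^ 2 + relax η ρ ^ 2 * (η ^ 2 * σ ^ 2)) := by
    gcongr
    exact sum_driftWeight_le K
  linarith

/-- The rate of convergence of the fixed-point residual in mean square. -/
theorem expectationLE_fpResidual_sq (hS : IsSampling P ν ξ I) (hρη : ρ < η)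
    (hW : WeakMVI ρ F G xs) {K : ℕ} (hK : 1 ≤ K) :
    ExpectationLE (withUniformIndex K P)
      (fun q => fpResidual η F G (xout L η ρ G Ft x₀ ξ I q) ^ 2)
      (64 * (‖x₀ - xs‖ ^ 2 + relax η ρ ^ 2 * (η ^ 2 * σ ^ 2)) * Real.log ((K : ℝ) + 3) /
        (relax η ρ ^ 2 * √(K : ℝ))) := by
  refine expectationLE_withUniformIndex
    (fun k => (h.measurable_fpResidual.comp (h.measurable_run hS k)).pow_const 2)
    (fun k => h.integrable_fpResidual_sq hS hρη hW (h.integrable_run hS hρη hW k)) hK ?_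
  have hα := relax_pos hρη h.eta_pos
  have hsum := h.sum_fpResidual_sq_le hS hρη hW (x₀ := x₀) K
  set α := relax η ρ
  set W := ‖x₀ - xs‖ ^ 2 + α ^ 2 * (η ^ 2 * σ ^ 2) with hWdef
  have hW0 : 0 ≤ W := by positivity
  set r : ℕ → ℝ := fun k => ∫ ω, fpResidual η F G (run L η ρ G Ft x₀ ξ I k ω).point ^ 2 ∂P with hr
  have hr0 : ∀ k, 0 ≤ r k := fun k => integral_nonneg fun ω => sq_nonneg _
  have hK1 : (1 : ℝ) ≤ K := by exact_mod_cast hK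
  set s := √(K : ℝ) with hs
  have hs1 : 1 ≤ s := Real.one_le_sqrt.2 hK1
  have hss : s ^ 2 = K := Real.sq_sqrt (by positivity)
  set ℓ := Real.log ((K : ℝ) + 3) with hℓ
  have hℓ1 : 1 < ℓ := one_lt_log_add_three K
  -- `1.4143` exceeds `√2` and `k + 2 ≤ 2 K`, so all steps are at least `α / q`. With `exp 3 ≤ 20.1`
  -- the final constant is `2 * 1.4143 * 20.1 < 64`.
  set q : ℝ := 1.4143 * s * ℓ with hq
  have hq0 : 0 < q := by positivity
  have hstep : ∀ k ∈ Finset.range K, α / q ≤ stepSize η ρ k := by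
    intro k hk
    have hk' : (k : ℝ) + 1 ≤ K := by exact_mod_cast Finset.mem_range.1 hk
    have h1 : √((k : ℝ) + 2) ≤ 1.4143 * s := by
      refine Real.sqrt_le_iff.2 ⟨by positivity, ?_⟩
      rw [mul_pow, hss]
      nlinarith
    have h2 : Real.log ((k : ℝ) + 3) ≤ ℓ := Real.log_le_log (by positivity) (by linarith)
    have h3 := one_lt_log_add_three k
    have h4 := one_lt_sqrt_add_two k
    rw [stepSize, hq]
    refine div_le_div_of_nonneg_left hα.le (by positivity) ?_
    gcongr
  have hlow : α * (α / q) / 2 * ∑ k ∈ Finset.range K, r k ≤ Real.exp 3 * W := by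
    refine le_trans ?_ hsum
    rw [Finset.mul_sum]
    refine Finset.sum_le_sum fun k hk => ?_
    have := hstep k hk
    have := hr0 k
    gcongr
  have he : Real.exp 3 ≤ 20.1 := by
    have h1 : Real.exp 3 = Real.exp 1 ^ 3 := by rw [← Real.exp_nat_mul]; norm_num
    rw [h1]
    calc Real.exp 1 ^ 3 ≤ 2.7182818286 ^ 3 := by gcongr; exact Real.exp_one_lt_d9.le
      _ ≤ 20.1 := by norm_num
  have hsum2 : α ^ 2 * ∑ k ∈ Finset.range K, r k ≤ 2 * q * (20.1 * W) := by
    have h1 : Real.exp 3 * W ≤ 20.1 * W := by gcongr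
    have h2 : α * (α / q) / 2 * ∑ k ∈ Finset.range K, r k =
        (α ^ 2 * ∑ k ∈ Finset.range K, r k) / (2 * q) := by
      field_simp
    rw [h2, div_le_iff₀ (by positivity)] at hlow
    nlinarith
  change (∑ k ∈ Finset.range K, r k) / (K : ℝ) ≤ _
  rw [div_le_div_iff₀ (by positivity) (by positivity)]
  have h3 : (∑ k ∈ Finset.range K, r k) * (α ^ 2 * s) ≤ 2 * q * (20.1 * W) * s := by
    have := mul_le_mul_of_nonneg_right hsum2 (zero_le_one.trans hs1)
    linarith
  refine h3.trans ?_
  rw [← hss, hq]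
  have h4 : 0 ≤ s ^ 2 * ℓ * W := by positivity
  nlinarith

/-- Mean absolute residual from the mean square residual. -/
theorem expectationLE_fpResidual (hS : IsSampling P ν ξ I) (hρη : ρ < η) (hW : WeakMVI ρ F G xs)
    {K : ℕ} (hK : 1 ≤ K) {δ : ℝ} (hδ : 0 < δ)
    (hle : 64 * (‖x₀ - xs‖ ^ 2 + relax η ρ ^ 2 * (η ^ 2 * σ ^ 2)) * Real.log ((K : ℝ) + 3) /
        (relax η ρ ^ 2 * √(K : ℝ)) ≤ δ ^ 2) :
    ExpectationLE (withUniformIndex K P)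
      (fun q => fpResidual η F G (xout L η ρ G Ft x₀ ξ I q)) δ := by
  have h1 := (h.expectationLE_fpResidual_sq hS hρη hW (x₀ := x₀) hK).mono hle
  have hprob : IsProbabilityMeasure (uniformOn (Set.Iio K)) :=
    isProbabilityMeasure_uniformOn (Set.finite_Iio K) ⟨0, hK⟩
  have hprob' : IsProbabilityMeasure (withUniformIndex K P) := by
    unfold withUniformIndex
    infer_instance
  have hb : Integrable (fun q => δ / 2 + (2 * δ)⁻¹ *
      fpResidual η F G (xout L η ρ G Ft x₀ ξ I q) ^ 2) (withUniformIndex K P) :=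
    (integrable_const _).add (h1.1.const_mul _)
  -- A pointwise Young inequality in place of Jensen; it also supplies the integrable majorant.
  have hpt : ∀ q, fpResidual η F G (xout L η ρ G Ft x₀ ξ I q) ≤ δ / 2 + (2 * δ)⁻¹ *
      fpResidual η F G (xout L η ρ G Ft x₀ ξ I q) ^ 2 := by
    intro q
    set R := fpResidual η F G (xout L η ρ G Ft x₀ ξ I q)
    have e : δ / 2 + (2 * δ)⁻¹ * R ^ 2 - R = (2 * δ)⁻¹ * (R - δ) ^ 2 := by
      field_simp
      ring
    have : 0 ≤ (2 * δ)⁻¹ * (R - δ) ^ 2 := by positivity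
    linarith
  have hm : Measurable fun q => fpResidual η F G (xout L η ρ G Ft x₀ ξ I q) :=
    h.measurable_fpResidual.comp (measurable_from_prod_countable_right fun k =>
      h.measurable_run hS k)
  have hi : Integrable (fun q => fpResidual η F G (xout L η ρ G Ft x₀ ξ I q))
      (withUniformIndex K P) :=
    Integrable.mono' hb hm.aestronglyMeasurable (Filter.Eventually.of_forall fun q => by
      rw [Real.norm_of_nonneg (show 0 ≤ fpResidual η F G _ from norm_nonneg _)]
      exact hpt q)
  refine ⟨hi, (integral_mono hi hb hpt).trans ?_⟩
  rw [integral_add (integrable_const _) (h1.1.const_mul _), integral_const_mul, integral_const,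
    probReal_univ, one_smul]
  have h2 : (2 * δ)⁻¹ * ∫ q, fpResidual η F G (xout L η ρ G Ft x₀ ξ I q) ^ 2
      ∂(withUniformIndex K P) ≤ (2 * δ)⁻¹ * δ ^ 2 := by
    gcongr
    exact h1.2
  have h3 : (2 * δ)⁻¹ * δ ^ 2 = δ / 2 := by field_simp
  linarith

end InnerProblem

end OuterIteration

-- Expected numbers of oracle and resolvent calls.

section Cost

theorem log_add_two_pos (k : ℕ) : 0 < Real.log ((k : ℝ) + 2) := by
  have hk : (0 : ℝ) ≤ k := k.cast_nonneg
  exact Real.log_pos (by linarith)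

/-- Growth constant of `log₂ N_k` relative to `log (k + 2)`. -/
def levelConst (L η : ℝ) : ℝ :=
  (Real.log (11520 * ((1 - η * L) ^ 2)⁻¹ + 1) / Real.log 2 + 3) / Real.log 2

/-- Constant of the expected cost per iteration. -/
def costConst (L η : ℝ) : ℝ :=
  9 * (80640 / (1 - η * L) ^ 2 + 1) * levelConst L η ^ 2

theorem costConst_nonneg (L η : ℝ) : 0 ≤ costConst L η := by
  unfold costConst
  positivity

/-- `driftWeight k` is at least `(k + 2)⁻³`, so `N_k` is at most cubic in `k + 2`; `log 2 ≤ log (k +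
2)` absorbs the additive constant. -/
theorem logb_levelCap_le {L η ρ : ℝ} (hρη : ρ < η) (hη : 0 < η) (hL : 0 ≤ η * L)
    (hL1 : η * L < 1) (k : ℕ) :
    Real.logb 2 (levelCap L η ρ k) ≤ levelConst L η * Real.log ((k : ℝ) + 2) := by
  have hk : (0 : ℝ) ≤ k := k.cast_nonneg
  have hN := two_le_levelCap hρη hη hL hL1 k
  set c := ((1 - η * L) ^ 2)⁻¹ with hc
  have hμ : 0 < 1 - η * L := by linarith
  have hc0 : 0 < c := by positivity
  set A := 11520 * c + 1 with hA
  set t := (k : ℝ) + 2 with ht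
  have ht2 : 2 ≤ t := by linarith
  have hd : 1 ≤ driftWeight k * t ^ 3 := by
    have h1 := one_lt_log_add_three k
    have h2 := one_lt_sqrt_add_two k
    have h3 : √t ≤ t := Real.sqrt_le_self_iff.2 (Or.inr (by linarith))
    have h4 : Real.log ((k : ℝ) + 3) ≤ t := by
      have := Real.log_le_sub_one_of_pos (x := (k : ℝ) + 3) (by positivity)
      linarith
    rw [driftWeight, one_div_mul_eq_div, le_div_iff₀ (by positivity), one_mul]
    calc ((k : ℝ) + 1) * (√t * Real.log ((k : ℝ) + 3)) ≤ t * (t * t) := by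
          gcongr
          linarith
      _ = t ^ 3 := by ring
  have ht3 : 1 ≤ t ^ 3 := one_le_pow₀ (by linarith)
  have hmin : 1 ≤ min (driftWeight k / 120) (1 / 120) * (120 * t ^ 3) := by
    rcases min_cases (driftWeight k / 120) (1 / 120) with h | h <;> rw [h.1] <;> linarith
  have hmin0 : 0 < min (driftWeight k / 120) (1 / 120) :=
    lt_min (div_pos (driftWeight_pos k) (by norm_num)) (by norm_num)
  have hNle : (levelCap L η ρ k : ℝ) ≤ A * t ^ 3 := by
    rw [levelCap_eq L hρη hη, ← hc]
    have h0 : 0 ≤ 96 * c / min (driftWeight k / 120) (1 / 120) := by positivity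
    refine (Nat.ceil_lt_add_one h0).le.trans ?_
    have h1 : 96 * c / min (driftWeight k / 120) (1 / 120) ≤ 11520 * c * t ^ 3 := by
      rw [div_le_iff₀ hmin0]
      have := mul_le_mul_of_nonneg_left hmin (by positivity : 0 ≤ 96 * c)
      linarith
    rw [hA]
    linarith
  have hN0 : (0 : ℝ) < levelCap L η ρ k := by
    have : (2 : ℝ) ≤ levelCap L η ρ k := by exact_mod_cast hN
    linarith
  have hA1 : 1 ≤ A := by rw [hA]; linarith
  have hl2 : 0 < Real.log 2 := Real.log_pos (by norm_num)
  have h2t : Real.log 2 ≤ Real.log t := Real.log_le_log (by norm_num) ht2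
  rw [Real.logb, levelConst, ← hc, ← hA, div_mul_eq_mul_div]
  gcongr
  refine (Real.log_le_log hN0 hNle).trans ?_
  rw [Real.log_mul (by positivity) (by positivity), Real.log_pow, add_mul]
  have h5 : Real.log A ≤ Real.log A / Real.log 2 * Real.log t := by
    rw [div_mul_eq_mul_div, le_div_iff₀ hl2]
    exact mul_le_mul_of_nonneg_left h2t (Real.log_nonneg hA1)
  push_cast
  linarith

variable {E Ξ : Type*} [NormedAddCommGroup E] [InnerProductSpace ℝ E]

theorem fbf_calls (μ LB : ℝ) (A : E → Set E) (Bin : E → Ξ → E) (z₀ : E) (seed : ℕ → Bool → Ξ)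
    (T : ℕ) : (fbf μ LB A Bin z₀ seed T).oracleCalls = 2 * T ∧
      (fbf μ LB A Bin z₀ seed T).resolventCalls = T := by
  induction T with
  | zero => exact ⟨rfl, rfl⟩
  | succ t ih =>
    refine ⟨?_, ?_⟩
    · change (fbf μ LB A Bin z₀ seed t).oracleCalls + 2 = _
      omega
    · change (fbf μ LB A Bin z₀ seed t).resolventCalls + 1 = _
      omega

/-- Number of resolvent calls of the multilevel estimator at level `i`. -/
def levelCalls (N i : ℕ) : ℕ :=
  if 2 ^ i ≤ N then 1 + 2 ^ i + 2 ^ (i - 1) else 1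

theorem mlmcFbf_calls (μ LB : ℝ) (A : E → Set E) (Bin : E → Ξ → E) (z₀ : E) (N i : ℕ)
    (seed : ℕ → ℕ → Bool → Ξ) :
    (mlmcFbf μ LB A Bin z₀ N i seed).oracleCalls = 2 * levelCalls N i ∧
      (mlmcFbf μ LB A Bin z₀ N i seed).resolventCalls = levelCalls N i := by
  unfold mlmcFbf levelCalls
  split_ifs
  · simp only [fbf_calls]
    refine ⟨?_, ?_⟩ <;> ring
  · simp only [fbf_calls]
    simp

theorem estimate_calls (L η ρ : ℝ) (G : E → Set E) (Ft : E → Ξ → E) (ξ : SeedIndex → Ξ)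
    (I : ℕ × ℕ → ℕ) (k : ℕ) (x : E) :
    (estimate L η ρ G Ft ξ I k x).oracleCalls = 2 * ∑ m ∈ Finset.range (batchSize L η ρ k),
        levelCalls (levelCap L η ρ k) (I (k, m)) ∧
      (estimate L η ρ G Ft ξ I k x).resolventCalls = ∑ m ∈ Finset.range (batchSize L η ρ k),
        levelCalls (levelCap L η ρ k) (I (k, m)) := by
  simp only [estimate, mlmcFbf_calls, Finset.mul_sum, and_self]

theorem ExpectationLE.const_mul {Ω : Type*} [MeasurableSpace Ω] {P : Measure Ω} {f : Ω → ℝ}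
    {a c : ℝ} (h : ExpectationLE P f a) (hc : 0 ≤ c) :
    ExpectationLE P (fun ω => c * f ω) (c * a) :=
  ⟨h.1.const_mul c, by
    rw [integral_const_mul]
    exact mul_le_mul_of_nonneg_left h.2 hc⟩

theorem ExpectationLE.sum {Ω ι : Type*} [MeasurableSpace Ω] {P : Measure Ω} {f : ι → Ω → ℝ}
    {a : ι → ℝ} {s : Finset ι} (h : ∀ i ∈ s, ExpectationLE P (f i) (a i)) :
    ExpectationLE P (fun ω => ∑ i ∈ s, f i ω) (∑ i ∈ s, a i) :=
  ⟨integrable_finsetSum _ fun i hi => (h i hi).1, by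
    rw [integral_finsetSum _ fun i hi => (h i hi).1]
    exact Finset.sum_le_sum fun i hi => (h i hi).2⟩

variable {Ω : Type*} [MeasurableSpace Ω] {P : Measure Ω} [IsProbabilityMeasure P]

/-- Apart from the call for `y 0`, level `i + 1` costs `3/2 * 2 ^ (i + 1)` and has probability `2 ^
-(i + 1)`, so each admissible level contributes `3/2`. -/
theorem expectationLE_levelCalls {J : Ω → ℕ} (hJ : Measurable J)
    (hlaw : ∀ i : ℕ, P {ω | J ω = i + 1} = (1 / 2) ^ (i + 1)) {N : ℕ} (hN : N ≠ 0) :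
    ExpectationLE P (fun ω => (levelCalls N (J ω) : ℝ)) (3 + 3 / 2 * Nat.log 2 N) := by
  set n := Nat.log 2 N with hn
  have hpow : ∀ j, 2 ^ j ≤ N ↔ j ≤ n := fun j => (Nat.le_log_iff_pow_le (by norm_num) hN).symm
  set A : ℕ → Set Ω := fun i => {ω | J ω = i + 1} with hA
  have hAm : ∀ i, MeasurableSet (A i) := fun i => hJ (measurableSet_singleton (i + 1))
  have hAP : ∀ i, P.real (A i) = (1 / 2) ^ (i + 1) := fun i => by
    rw [Measure.real, hlaw i]
    simp
  have hnn : ∀ i ω, 0 ≤ (A i).indicator (fun _ => 3 / 2 * (2 : ℝ) ^ (i + 1)) ω := fun i ω =>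
    Set.indicator_nonneg (fun ω _ => by positivity) ω
  have hle : ∀ ω, (levelCalls N (J ω) : ℝ) ≤
      3 + ∑ i ∈ Finset.range n, (A i).indicator (fun _ => 3 / 2 * (2 : ℝ) ^ (i + 1)) ω := by
    intro ω
    have hs := Finset.sum_nonneg fun i (_ : i ∈ Finset.range n) => hnn i ω
    simp only [levelCalls, hpow]
    -- The additive 3 covers the null value `J ω = 0`, where `levelCalls` equals `1 + 1 + 1`.
    rcases hJω : J ω with _ | j
    · norm_num
      linarith
    · by_cases hj : j + 1 ≤ n
      · have h1 := Finset.single_le_sum (fun i _ => hnn i ω) (Finset.mem_range.2 hj)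
        rw [Set.indicator_of_mem (show ω ∈ A j from hJω)] at h1
        rw [if_pos hj]
        push_cast
        rw [pow_succ] at h1 ⊢
        linarith
      · rw [if_neg hj]
        norm_num
        linarith
  have hterm : ∀ i, Integrable ((A i).indicator fun _ => 3 / 2 * (2 : ℝ) ^ (i + 1)) P :=
    fun i => (integrable_const _).indicator (hAm i)
  have hsum : Integrable (fun ω => ∑ i ∈ Finset.range n,
      (A i).indicator (fun _ => 3 / 2 * (2 : ℝ) ^ (i + 1)) ω) P :=
    integrable_finsetSum _ fun i _ => hterm i
  have hb : Integrable (fun ω => 3 + ∑ i ∈ Finset.range n,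
      (A i).indicator (fun _ => 3 / 2 * (2 : ℝ) ^ (i + 1)) ω) P := (integrable_const _).add hsum
  have hm : Measurable fun ω => (levelCalls N (J ω) : ℝ) :=
    (measurable_of_countable fun i : ℕ => (levelCalls N i : ℝ)).comp hJ
  have hi : Integrable (fun ω => (levelCalls N (J ω) : ℝ)) P :=
    Integrable.mono' hb hm.aestronglyMeasurable (Filter.Eventually.of_forall fun ω => by
      rw [Real.norm_of_nonneg (Nat.cast_nonneg _)]
      exact hle ω)
  refine ⟨hi, (integral_mono hi hb hle).trans ?_⟩
  rw [integral_add (integrable_const _) hsum, integral_finsetSum _ fun i _ => hterm i]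
  have h1 : ∀ i ∈ Finset.range n,
      ∫ ω, (A i).indicator (fun _ => 3 / 2 * (2 : ℝ) ^ (i + 1)) ω ∂P = 3 / 2 := by
    intro i _
    rw [integral_indicator_const _ (hAm i), hAP i, smul_eq_mul, one_div, inv_pow]
    field_simp
  rw [Finset.sum_congr rfl h1]
  simp
  linarith

variable [MeasurableSpace Ξ] {ν : Measure Ξ} {ξ : SeedIndex → Ω → Ξ} {I : ℕ × ℕ → Ω → ℕ}
  {L η ρ : ℝ} {G : E → Set E} {Ft : E → Ξ → E} {x₀ : E}

/-- Expected cost of iteration `k`. -/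
theorem IsSampling.expectationLE_iteration_calls (hS : IsSampling P ν ξ I) (hρη : ρ < η)
    (hη : 0 < η) (hL : 0 ≤ η * L) (hL1 : η * L < 1) (k : ℕ) :
    ExpectationLE P (fun ω => ((iteration L η ρ G Ft x₀ ξ I k ω).oracleCalls : ℝ))
        (costConst L η * Real.log ((k : ℝ) + 2) ^ 2) ∧
      ExpectationLE P (fun ω => ((iteration L η ρ G Ft x₀ ξ I k ω).resolventCalls : ℝ))
        (costConst L η * Real.log ((k : ℝ) + 2) ^ 2) := by
  have hN := two_le_levelCap hρη hη hL hL1 k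
  have hb1 := one_le_logb_levelCap hρη hη hL hL1 k
  have hb2 := logb_levelCap_le hρη hη hL hL1 k
  have hlog : (Nat.log 2 (levelCap L η ρ k) : ℝ) ≤ Real.logb 2 (levelCap L η ρ k) := by
    exact_mod_cast Real.natLog_le_logb (levelCap L η ρ k) 2
  set b := Real.logb 2 (levelCap L η ρ k) with hb
  have hμ : 0 < (1 - η * L) ^ 2 := pow_pos (by linarith) 2
  have hM : (batchSize L η ρ k : ℝ) ≤ (80640 / (1 - η * L) ^ 2 + 1) * b := by
    have h0 : 0 ≤ 672 * 120 * b / (1 - η * L) ^ 2 := by positivity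
    refine (Nat.ceil_lt_add_one h0).le.trans ?_
    have : 672 * 120 * b / (1 - η * L) ^ 2 = 80640 / (1 - η * L) ^ 2 * b := by ring
    rw [this]
    linarith
  have hsum := ExpectationLE.sum (s := Finset.range (batchSize L η ρ k)) fun m _ =>
    expectationLE_levelCalls (hS.measurable_level (k, m)) (hS.law_level (k, m))
      (N := levelCap L η ρ k) (by omega)
  rw [Finset.sum_const, Finset.card_range, nsmul_eq_mul] at hsum
  have htot : 2 * ((batchSize L η ρ k : ℝ) * (3 + 3 / 2 * (Nat.log 2 (levelCap L η ρ k) : ℝ))) ≤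
      costConst L η * Real.log ((k : ℝ) + 2) ^ 2 := by
    have h1 : 3 + 3 / 2 * (Nat.log 2 (levelCap L η ρ k) : ℝ) ≤ 9 / 2 * b := by linarith
    calc 2 * ((batchSize L η ρ k : ℝ) * (3 + 3 / 2 * (Nat.log 2 (levelCap L η ρ k) : ℝ)))
        ≤ 2 * (((80640 / (1 - η * L) ^ 2 + 1) * b) * (9 / 2 * b)) := by gcongr
      _ = 9 * (80640 / (1 - η * L) ^ 2 + 1) * b ^ 2 := by ring
      _ ≤ 9 * (80640 / (1 - η * L) ^ 2 + 1) *
          (levelConst L η * Real.log ((k : ℝ) + 2)) ^ 2 := by gcongr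
      _ = costConst L η * Real.log ((k : ℝ) + 2) ^ 2 := by rw [costConst]; ring
  have h0 : 0 ≤ (batchSize L η ρ k : ℝ) * (3 + 3 / 2 * (Nat.log 2 (levelCap L η ρ k) : ℝ)) := by
    positivity
  simp only [iteration, estimate_calls]
  push_cast
  exact ⟨(hsum.const_mul zero_le_two).mono htot, hsum.mono (by linarith)⟩

omit [MeasurableSpace Ω] [MeasurableSpace Ξ] in
theorem run_calls (K : ℕ) (ω : Ω) :
    (run L η ρ G Ft x₀ ξ I K ω).oracleCalls =
        ∑ k ∈ Finset.range K, (iteration L η ρ G Ft x₀ ξ I k ω).oracleCalls ∧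
      (run L η ρ G Ft x₀ ξ I K ω).resolventCalls =
        ∑ k ∈ Finset.range K, (iteration L η ρ G Ft x₀ ξ I k ω).resolventCalls := by
  induction K with
  | zero => exact ⟨rfl, rfl⟩
  | succ K ih =>
    rw [Finset.sum_range_succ, Finset.sum_range_succ, ← ih.1, ← ih.2]
    exact ⟨rfl, rfl⟩

/-- Expected cost of the first `K` iterations. -/
theorem IsSampling.expectationLE_run_calls (hS : IsSampling P ν ξ I) (hρη : ρ < η)
    (hη : 0 < η) (hL : 0 ≤ η * L) (hL1 : η * L < 1) (K : ℕ) :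
    ExpectationLE P (fun ω => ((run L η ρ G Ft x₀ ξ I K ω).oracleCalls : ℝ))
        (costConst L η * (K * Real.log ((K : ℝ) + 1) ^ 2)) ∧
      ExpectationLE P (fun ω => ((run L η ρ G Ft x₀ ξ I K ω).resolventCalls : ℝ))
        (costConst L η * (K * Real.log ((K : ℝ) + 1) ^ 2)) := by
  have hc := costConst_nonneg L η
  have hle : ∑ k ∈ Finset.range K, costConst L η * Real.log ((k : ℝ) + 2) ^ 2 ≤
      costConst L η * (K * Real.log ((K : ℝ) + 1) ^ 2) := by
    rw [← Finset.mul_sum]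
    refine mul_le_mul_of_nonneg_left ?_ hc
    refine (Finset.sum_le_card_nsmul _ _ (Real.log ((K : ℝ) + 1) ^ 2) fun k hk => ?_).trans
      (by simp)
    have hk' : (k : ℝ) + 1 ≤ K := by exact_mod_cast Finset.mem_range.1 hk
    have h0 := (log_add_two_pos k).le
    have h1 : Real.log ((k : ℝ) + 2) ≤ Real.log ((K : ℝ) + 1) :=
      Real.log_le_log (by positivity) (by linarith)
    gcongr
  have ho := ExpectationLE.sum (s := Finset.range K) fun k _ =>
    (hS.expectationLE_iteration_calls (G := G) (Ft := Ft) (x₀ := x₀) hρη hη hL hL1 k).1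
  have hr := ExpectationLE.sum (s := Finset.range K) fun k _ =>
    (hS.expectationLE_iteration_calls (G := G) (Ft := Ft) (x₀ := x₀) hρη hη hL hL1 k).2
  simp only [run_calls]
  push_cast
  exact ⟨ho.mono hle, hr.mono hle⟩

end Cost

-- Choice of the number of iterations.

section IterationCount

/-- A number of iterations that makes the rate at most `ε ^ 2`, with its growth. -/
theorem exists_iteration_count {B : ℝ} (hB : 0 ≤ B) :
    ∃ A : ℝ, ∃ Kε : ℝ → ℕ, ∀ ε : ℝ, 0 < ε → 1 ≤ Kε ε ∧
      B * Real.log ((Kε ε : ℝ) + 3) ≤ ε ^ 2 * √(Kε ε : ℝ) ∧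
      (ε ≤ 1 → (Kε ε : ℝ) * Real.log ((Kε ε : ℝ) + 1) ^ 2 ≤
        A * ε⁻¹ ^ 4 * (1 + Real.log (1 / ε)) ^ 4) := by
  set s : ℝ := 10 * B + 1 with hs
  have hs1 : 1 ≤ s := by linarith
  -- With `ℓ = 1 + log δ⁻¹` this gives `√K ≥ s² δ⁻² ℓ`, while `log (K + 3) ≤ 10 s ℓ`; the spare
  -- factor `s` dominates `10 B`. Truncating `ε` at 1 keeps `ℓ ≥ 1`.
  let T : ℝ → ℝ := fun ε => s ^ 4 * (min ε 1)⁻¹ ^ 4 * (1 + Real.log (min ε 1)⁻¹) ^ 2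
  refine ⟨200 * s ^ 6, fun ε => ⌈T ε⌉₊, fun ε hε => ?_⟩
  set δ := min ε 1 with hδ
  have hδ0 : 0 < δ := lt_min hε one_pos
  have hδ1 : 1 ≤ δ⁻¹ := (one_le_inv₀ hδ0).2 (min_le_right _ _)
  set ℓ := 1 + Real.log δ⁻¹ with hℓ
  have hℓ1 : 1 ≤ ℓ := by linarith [Real.log_nonneg hδ1]
  have hTdef : T ε = s ^ 4 * δ⁻¹ ^ 4 * ℓ ^ 2 := rfl
  have hT1 : 1 ≤ T ε := by
    rw [hTdef]
    exact one_le_mul_of_one_le_of_one_le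
      (one_le_mul_of_one_le_of_one_le (one_le_pow₀ hs1) (one_le_pow₀ hδ1)) (one_le_pow₀ hℓ1)
  set K : ℕ := ⌈T ε⌉₊ with hK
  have hTK : T ε ≤ K := Nat.le_ceil _
  have hKT : (K : ℝ) ≤ T ε + 1 := (Nat.ceil_lt_add_one (by linarith)).le
  have hlog : Real.log ((K : ℝ) + 3) ≤ 10 * s * ℓ := by
    have h1 : Real.log ((K : ℝ) + 3) ≤ Real.log (5 * T ε) :=
      Real.log_le_log (by positivity) (by linarith)
    have h2 : Real.log (5 * T ε) =
        Real.log 5 + (4 * Real.log s + 4 * Real.log δ⁻¹ + 2 * Real.log ℓ) := by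
      rw [hTdef, Real.log_mul (by norm_num) (by positivity), Real.log_mul (by positivity)
        (by positivity), Real.log_mul (by positivity) (by positivity), Real.log_pow, Real.log_pow,
        Real.log_pow]
      push_cast
      ring
    have h3 := Real.log_le_sub_one_of_pos (x := 5) (by norm_num)
    have h4 := Real.log_le_sub_one_of_pos (x := s) (by linarith)
    have h5 := Real.log_le_sub_one_of_pos (x := ℓ) (by linarith)
    have h6 : Real.log δ⁻¹ = ℓ - 1 := by rw [hℓ]; ring
    rw [h2, h6] at h1
    nlinarith [mul_nonneg (sub_nonneg.2 hs1) (sub_nonneg.2 hℓ1)]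
  refine ⟨Nat.ceil_pos.2 (by linarith), ?_, fun hε1 => ?_⟩
  · have hsq : s ^ 2 * δ⁻¹ ^ 2 * ℓ ≤ √(K : ℝ) := by
      refine Real.le_sqrt_of_sq_le (le_trans (le_of_eq ?_) hTK)
      rw [hTdef]
      ring
    calc B * Real.log ((K : ℝ) + 3) ≤ B * (10 * s * ℓ) := by gcongr
      _ = 10 * B * (s * ℓ) := by ring
      _ ≤ s * (s * ℓ) := by gcongr; linarith
      _ = δ ^ 2 * (s ^ 2 * δ⁻¹ ^ 2 * ℓ) := by field_simp
      _ ≤ ε ^ 2 * √(K : ℝ) := by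
        gcongr
        exact min_le_left _ _
  · have hδε : δ = ε := min_eq_left hε1
    have h1 : Real.log ((K : ℝ) + 1) ≤ 10 * s * ℓ :=
      (Real.log_le_log (by positivity) (by linarith)).trans hlog
    have h0 : 0 ≤ Real.log ((K : ℝ) + 1) := Real.log_nonneg (by linarith [K.cast_nonneg (α := ℝ)])
    have h2 : (K : ℝ) ≤ 2 * T ε := by linarith
    have e : ε⁻¹ = δ⁻¹ := by rw [hδε]
    rw [one_div, e, ← hℓ]
    calc (K : ℝ) * Real.log ((K : ℝ) + 1) ^ 2 ≤ 2 * T ε * (10 * s * ℓ) ^ 2 := by gcongr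
      _ = 200 * s ^ 6 * δ⁻¹ ^ 4 * ℓ ^ 4 := by rw [hTdef]; ring

end IterationCount

end StochKM

end

-- Assembly of the theorem.

theorem theoremC5 (L : ℝ≥0) (η : ℝ) (hL : 0 < L) (hη : η < 1 / L) :
    -- constant of the cost per iteration: it depends on `η` and `L` only
    ∃ C : ℝ, ∀ ρ : ℝ, 0 < ρ → ρ < η → ∀ σ D : ℝ,
    -- constant and number of iterations of the total complexity: they depend on the parameters
    -- and on a bound `D` for the initial distance only
    ∃ C' : ℝ, ∃ Kε : ℝ → ℕ,
    ∀ (d : ℕ) (F : EuclideanSpace ℝ (Fin d) → EuclideanSpace ℝ (Fin d))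
      (G : EuclideanSpace ℝ (Fin d) → Set (EuclideanSpace ℝ (Fin d)))
      (x₀ xs : EuclideanSpace ℝ (Fin d))
      (Ξ : Type*) [MeasurableSpace Ξ] (ν : Measure Ξ) [IsProbabilityMeasure ν]
      (Ft : EuclideanSpace ℝ (Fin d) → Ξ → EuclideanSpace ℝ (Fin d))
      (Ω : Type*) [MeasurableSpace Ω] (P : Measure Ω) [IsProbabilityMeasure P]
      (ξ : SeedIndex → Ω → Ξ) (I : ℕ × ℕ → Ω → ℕ),
    LipschitzWith L F → IsMaximalMonotone G →
    IsSolution F G xs → WeakMVI ρ F G xs →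
    IsStochasticOracle Ft ν F σ → IsSampling P ν ξ I →
    -- the resolvents are everywhere defined and single-valued
    (∀ x, ∃! y, y ∈ resolventValues (opSmul η (opAdd F G)) x) ∧
    (∀ c : ℝ, 0 < c → ∀ x, ∃! y, y ∈ resolventValues (opSmul c G) x) ∧
    -- rate
    (∀ K : ℕ, 1 ≤ K →
      ExpectationLE (withUniformIndex K P) (fun q => fpResidual η F G (xout L η ρ G Ft x₀ ξ I q) ^ 2)
        (64 * (‖x₀ - xs‖ ^ 2 + relax η ρ ^ 2 * (η ^ 2 * σ ^ 2)) * Real.log ((K : ℝ) + 3) /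
          (relax η ρ ^ 2 * √(K : ℝ)))) ∧
    -- expected cost of iteration `k`
    (∀ k : ℕ,
      ExpectationLE P (fun ω => ((iteration L η ρ G Ft x₀ ξ I k ω).oracleCalls : ℝ))
        (C * Real.log ((k : ℝ) + 2) ^ 2) ∧
      ExpectationLE P (fun ω => ((iteration L η ρ G Ft x₀ ξ I k ω).resolventCalls : ℝ))
        (C * Real.log ((k : ℝ) + 2) ^ 2)) ∧
    -- expected total complexity
    (‖x₀ - xs‖ ≤ D → ∀ ε : ℝ, 0 < ε →
      1 ≤ Kε ε ∧
      ExpectationLE (withUniformIndex (Kε ε) P) (fun q => fpResidual η F G (xout L η ρ G Ft x₀ ξ I q)) ε ∧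
      ExpectationLE (withUniformIndex (Kε ε) P) (fun q => η⁻¹ * fpResidual η F G (xout L η ρ G Ft x₀ ξ I q)) ε ∧
      (ε ≤ 1 →
        ExpectationLE P (fun ω => ((run L η ρ G Ft x₀ ξ I (Kε ε) ω).oracleCalls : ℝ))
          (C' * ε⁻¹ ^ 4 * (1 + Real.log (1 / ε)) ^ 4) ∧
        ExpectationLE P (fun ω => ((run L η ρ G Ft x₀ ξ I (Kε ε) ω).resolventCalls : ℝ))
          (C' * ε⁻¹ ^ 4 * (1 + Real.log (1 / ε)) ^ 4))) := by
  refine ⟨costConst L η, fun ρ hρ hρη σ D => ?_⟩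
  have hη0 : 0 < η := hρ.trans hρη
  have hL' : (0 : ℝ) < L := hL
  have hηL : η * L < 1 := (lt_div_iff₀ hL').1 hη
  have hηL0 : 0 ≤ η * (L : ℝ) := by positivity
  have hα := relax_pos hρη hη0
  -- Aiming at residual `ε / m` meets both accuracy criteria at once; the price is the factor `m ^
  -- 2` in `B`.
  set m : ℝ := max 1 η⁻¹ with hm
  have hm1 : 1 ≤ m := le_max_left _ _
  have hm0 : 0 < m := by linarith
  obtain ⟨A, Kε, hK⟩ := exists_iteration_count
    (B := m ^ 2 * (64 * (D ^ 2 + relax η ρ ^ 2 * (η ^ 2 * σ ^ 2)) / relax η ρ ^ 2)) (by positivity)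
  refine ⟨costConst L η * A, Kε, ?_⟩
  intro d F G x₀ xs Ξ _ ν _ Ft Ω _ P _ ξ I hF hG _ hW hO hS
  have h : InnerProblem L η σ F G Ft ν := ⟨hF, hG, hη0, hηL, hO⟩
  refine ⟨existsUnique_resolvent_opAdd hF hG hη0 hηL,
    fun c hc => hG.existsUnique_resolvent hc,
    fun K hK1 => h.expectationLE_fpResidual_sq hS hρη hW hK1,
    fun k => hS.expectationLE_iteration_calls hρη hη0 hηL0 hηL k, fun hD ε hε => ?_⟩
  obtain ⟨hK1, hKB, hKA⟩ := hK ε hε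
  have hres : ExpectationLE (withUniformIndex (Kε ε) P)
      (fun q => fpResidual η F G (xout L η ρ G Ft x₀ ξ I q)) (ε / m) := by
    refine h.expectationLE_fpResidual hS hρη hW hK1 (by positivity) ?_
    have hK0 : 0 < √(Kε ε : ℝ) := Real.sqrt_pos.2 (by exact_mod_cast hK1)
    have hlog := one_lt_log_add_three (Kε ε)
    rw [div_pow, div_le_div_iff₀ (by positivity) (by positivity)]
    have h1 : ‖x₀ - xs‖ ^ 2 ≤ D ^ 2 := by gcongr
    calc 64 * (‖x₀ - xs‖ ^ 2 + relax η ρ ^ 2 * (η ^ 2 * σ ^ 2)) *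
          Real.log ((Kε ε : ℝ) + 3) * m ^ 2
        ≤ 64 * (D ^ 2 + relax η ρ ^ 2 * (η ^ 2 * σ ^ 2)) *
          Real.log ((Kε ε : ℝ) + 3) * m ^ 2 := by gcongr
      _ = relax η ρ ^ 2 * (m ^ 2 * (64 * (D ^ 2 + relax η ρ ^ 2 * (η ^ 2 * σ ^ 2)) /
          relax η ρ ^ 2) * Real.log ((Kε ε : ℝ) + 3)) := by
        field_simp
      _ ≤ relax η ρ ^ 2 * (ε ^ 2 * √(Kε ε : ℝ)) := by gcongr
      _ = ε ^ 2 * (relax η ρ ^ 2 * √(Kε ε : ℝ)) := by ring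
  refine ⟨hK1, hres.mono (div_le_self hε.le hm1), ?_, fun hε1 => ?_⟩
  · refine (hres.const_mul (inv_nonneg.2 hη0.le)).mono ?_
    rw [← mul_div_assoc, div_le_iff₀ hm0, mul_comm]
    exact mul_le_mul_of_nonneg_left (le_max_right _ _) hε.le
  · have hle : costConst L η * ((Kε ε : ℝ) * Real.log ((Kε ε : ℝ) + 1) ^ 2) ≤
        costConst L η * A * ε⁻¹ ^ 4 * (1 + Real.log (1 / ε)) ^ 4 := by
      have := mul_le_mul_of_nonneg_left (hKA hε1) (costConst_nonneg L η)
      linarith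
    have hrun := hS.expectationLE_run_calls (G := G) (Ft := Ft) (x₀ := x₀) hρη hη0 hηL0 hηL (Kε ε)
    exact ⟨hrun.1.mono hle, hrun.2.mono hle⟩
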